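/- Let $\Psi(x,y)$ be the number of positive integers $n\le x$ all of whose prime factors are at most $y$. Let $\rho$ be the Dickman function: the continuous function on $[0,\infty)$ with $\rho(t)=1$ on $[0,1]$ and $t\rho'(t)=-\rho(t-1)$ for $t>1$. Write $u=\log x/\log y$. For $u\ge 1$ let $\xi(u)\ge 0$ be given by $\xi(1)=0$ and, for $u>1$, by the unique $\xi(u)>0$ with $e^{\xi(u)}=1+u\,\xi(u)$. For $x\ge y>2$ put $\sigma(x,y)=1-\xi(u)/\log y$. For $x>1$, $y\ge 2$ let $\alpha(x,y)>0$ be the point at which $s\mapsto x^{s}\prod_{p\le y}(1-p^{-s})^{-1}$ attains its minimum on $(0,\infty)$. For real functions $h,g$ with $g>0$, $h=\Omega_+(g)$ (resp. $h=\Omega_-(g)$) means that there is $c>0$ such that $h(y)\ge c\,g(y)$ (resp. $h(y)\le -c\,g(y)$) for arbitrarily large $y$; $\exp(\Omega_\pm(g))$ stands for $\exp(h(y))$ with some $h=\Omega_\pm(g)$. The constants implied by $\ll$ and $\gg$ are absolute and positive. Let $\Theta\in[1/2,1]$ be the supremum of the real parts of the zeros of the Riemann zeta function, and let $\varepsilon>0$.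 1. Assume that the Riemann Hypothesis fails and fix $\sigma_0\in(1-\Theta,\Theta)$. For each $y>2$ there is a unique $x=x(y)\ge y$ with $\sigma(x,y)=\sigma_0$, and for all $y>2$ \[ \Psi(x(y),y)\ll x\rho(u)\exp\left(\Omega_{-}\left(y^{\Theta-\sigma_0-\varepsilon}\right)\right). \] 2. Fix $\alpha_0\in(0,\Theta)$. For each $y>2$ there is a unique $x=x(y)>1$ with $\alpha(x,y)=\alpha_0$. Regardless of the truth of the Riemann Hypothesis, there is $c_{\alpha_0}>0$, depending only on $\alpha_0$, such that for all $y>2$ \[ \Psi(x(y),y)\gg x\rho(u)\exp\left(c_{\alpha_0}\,y^{\max\{1-2\alpha_0,\,\frac12-\alpha_0\}}/\log y\right)\exp\left(\Omega_{+}\left(y^{\Theta-\alpha_0-\varepsilon}\right)\right). \] -/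

import Mathlib

open Filter Topology

noncomputable section

/-- `Ψ(x, y)`: the number of positive integers `n ≤ x` all of whose prime factors are `≤ y`
(for a prime `p`, `p < ⌊y⌋₊ + 1` is the same as `p ≤ y`). -/
def friableCount (x y : ℝ) : ℕ := (Nat.smoothNumbersUpTo ⌊x⌋₊ (⌊y⌋₊ + 1)).card

/-- Successive integrations of the delay equation `t ρ'(t) = -ρ(t - 1)` from `ρ = 1` on `[0, 1]`;
the `n`-th iterate is the Dickman function on `[0, n + 1]`. -/
def dickmanIter : ℕ → ℝ → ℝ
  | 0, _ => 1
  | n + 1, t => 1 - ∫ s in (1 : ℝ)..max 1 t, dickmanIter n (s - 1) / s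

/-- The Dickman function `ρ` (characterised by the next three theorems). -/
def dickman (t : ℝ) : ℝ := dickmanIter ⌈t⌉₊ t

theorem continuous_dickmanIter (n : ℕ) : Continuous (dickmanIter n) := by
  induction n with
  | zero => exact continuous_const
  | succ n ih =>
    have hg : Continuous (fun s : ℝ => dickmanIter n (s - 1) / max 1 s) := by
      refine (ih.comp (continuous_id.sub continuous_const)).div (by fun_prop) ?_
      intro s
      have : (1 : ℝ) ≤ max 1 s := le_max_left _ _
      positivity
    have hF : Continuous (fun t : ℝ =>
        1 - ∫ s in (1 : ℝ)..max 1 t, dickmanIter n (s - 1) / max 1 s) :=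
      continuous_const.sub ((intervalIntegral.continuous_primitive
        (fun a b => hg.intervalIntegrable a b) 1).comp (by fun_prop))
    convert hF using 1
    funext t
    simp only [dickmanIter]
    congr 1
    refine intervalIntegral.integral_congr ?_
    intro s hs
    rw [Set.uIcc_of_le (le_max_left _ _)] at hs
    simp only [max_eq_right hs.1]

theorem dickmanIter_succ_eq (n : ℕ) (t : ℝ) (ht : t ≤ n + 1) :
    dickmanIter (n + 1) t = dickmanIter n t := by
  induction n generalizing t with
  | zero =>
    have h : max 1 t = 1 := max_eq_left (by simpa using ht)
    simp [dickmanIter, h]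
  | succ n ih =>
    rw [dickmanIter, dickmanIter]
    congr 1
    refine intervalIntegral.integral_congr ?_
    intro s hs
    rw [Set.uIcc_of_le (le_max_left _ _)] at hs
    have h2 : s ≤ (n : ℝ) + 2 := by
      refine hs.2.trans (max_le ?_ ?_)
      · have : (0 : ℝ) ≤ n := Nat.cast_nonneg n
        linarith
      · push_cast at ht
        linarith
    simp only [ih (s - 1) (by linarith)]

theorem dickman_eq_dickmanIter (n : ℕ) (t : ℝ) (ht : t ≤ n) : dickman t = dickmanIter n t := by
  have hn : ⌈t⌉₊ ≤ n := Nat.ceil_le.mpr ht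
  induction n, hn using Nat.le_induction with
  | base => rfl
  | succ m hm ih =>
    have h1 : t ≤ m := Nat.ceil_le.mp hm
    rw [dickmanIter_succ_eq m t (by linarith), ih h1]

theorem dickman_of_le_one {t : ℝ} (ht : t ≤ 1) : dickman t = 1 := by
  rw [dickman_eq_dickmanIter 1 t (by simpa using ht)]
  simp [dickmanIter, max_eq_left ht]

theorem continuous_dickman : Continuous dickman := by
  rw [continuous_iff_continuousAt]
  intro t
  obtain ⟨n, hn⟩ := exists_nat_gt t
  refine (continuous_dickmanIter n).continuousAt.congr ?_
  filter_upwards [Iio_mem_nhds hn] with s hs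
  exact (dickman_eq_dickmanIter n s (le_of_lt hs)).symm

theorem hasDerivAt_dickman {t : ℝ} (ht : 1 < t) :
    HasDerivAt dickman (-dickman (t - 1) / t) t := by
  obtain ⟨n, hn⟩ := exists_nat_gt t
  have hcont : ContinuousOn (fun s : ℝ => dickmanIter n (s - 1) / s) (Set.Ioi 0) := by
    refine ContinuousOn.div ?_ continuousOn_id (fun s hs => (ne_of_gt hs))
    exact ((continuous_dickmanIter n).comp (continuous_id.sub continuous_const)).continuousOn
  have hsub : Set.uIcc 1 t ⊆ Set.Ioi 0 := by
    rw [Set.uIcc_of_le ht.le]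
    intro s hs
    exact lt_of_lt_of_le one_pos hs.1
  have h0 : (0 : ℝ) < t := by linarith
  have hd := (intervalIntegral.integral_hasDerivAt_right
    ((hcont.mono hsub).intervalIntegrable)
    (hcont.stronglyMeasurableAtFilter isOpen_Ioi t h0)
    (hcont.continuousAt (Ioi_mem_nhds h0))).const_sub 1
  rw [dickman_eq_dickmanIter n (t - 1) (by linarith), neg_div]
  refine hd.congr_of_eventuallyEq ?_
  filter_upwards [Iio_mem_nhds hn, Ioi_mem_nhds ht] with s hs hs1
  have hs' : s < n := hs
  have hs1' : 1 < s := hs1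
  rw [dickman_eq_dickmanIter (n + 1) s (by push_cast; linarith), dickmanIter,
    max_eq_right hs1'.le]

/-- `ξ(u)` for `u ≥ 1`: the largest solution `t ≥ 0` of `e ^ t = 1 + u t`, that is, `ξ(1) = 0` and,
for `u > 1`, the unique solution `t > 0`. -/
def xi (u : ℝ) : ℝ := sSup {t : ℝ | 0 ≤ t ∧ Real.exp t = 1 + u * t}

/-- `σ(x, y) = 1 - ξ(u) / log y` with `u = log x / log y`. -/
def sigma (x y : ℝ) : ℝ := 1 - xi (Real.log x / Real.log y) / Real.log y

/-- The partial zeta function `ζ(s, y) = ∏_{p ≤ y} (1 - p ^ (-s))⁻¹` at real `s`. -/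
def partialZeta (s y : ℝ) : ℝ :=
  ∏ p ∈ Nat.primesBelow (⌊y⌋₊ + 1), (1 - (p : ℝ) ^ (-s))⁻¹

/-- `α(x, y) = a`: the function `s ↦ ζ(s, y) x ^ s` on `s > 0` attains its minimum at `a`. -/
def IsSaddlePoint (x y a : ℝ) : Prop :=
  0 < a ∧ IsMinOn (fun s : ℝ => partialZeta s y * x ^ s) (Set.Ioi 0) a

/-- The supremum `Θ` of the real parts of the zeros of the Riemann zeta function. -/
def zetaTheta : ℝ := sSup {r : ℝ | ∃ s : ℂ, riemannZeta s = 0 ∧ s.re = r}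

/-- `h(y) = Ω₊(g(y))` as `y → ∞`. -/
def IsOmegaPlus (h g : ℝ → ℝ) : Prop := ∃ c > 0, ∃ᶠ y in atTop, c * g y ≤ h y

/-- `h(y) = Ω₋(g(y))` as `y → ∞`. -/
def IsOmegaMinus (h g : ℝ → ℝ) : Prop := ∃ c > 0, ∃ᶠ y in atTop, h y ≤ -(c * g y)

end

/-! ### Landau's theorem for moment generating functions -/

section Landau

open MeasureTheory ProbabilityTheory Set

/-! Write `S(y)` for `primePowSum a y` and `I(y)` for `expQuotInt ((1 - a) * log y)`. The
substitution `t = (1 - a) log v` turns `I(y)` into `∫_1^y (v^(-a) - v^(-1)) / log v dv`, the smooth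
approximation to `S(y)`. At the point `x(y)` attached to `a`, both parts reduce to the statement
that `log (Ψ / (x ρ(u)))` is essentially `log ζ(a, y) - I(y)`, hence `S(y) - I(y)` plus the
contribution of prime powers exceeding `y`. The oscillation of `S - I` then gives the result.

Oscillation (`frequently_rpow_le_primePowSum_sub`). The Laplace transform of `S - I` in `t = log y`
is `(log ((s + a - 1) ζ(s + a)) - log s + c) / s`, where subtracting `I` has cancelled the pole of
`ζ`. It is real analytic for real `s > 0`, because `(s - 1) ζ(s)` is positive there. If `S - I` were
eventually below `y^β` (or above `-y^β`) with `0 < β < Θ - a`, Landau's theorem would continue the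
transform to `Re s > β`; exponentiating, `ζ` would have no zero with real part exceeding `a + β`,
against the definition of `Θ`.

Upper bound for `Ψ`. Rankin's inequality `Ψ ≤ x^a ζ(a, y)` is paired with a lower bound for `ρ` at
its saddle point (`eventually_exp_le_dickman`); this is why `σ(x, y) = a` is the natural
normalisation. Prime powers above `y` cost about `y^max(1 - 2a, 0)`, which is smaller than `y^(Θ -
a)` when `1 - Θ < a < Θ`.

Lower bound for `Ψ`. Here `x` is the saddle point of `x^s ζ(s, y)`, and `Ψ` is at least `x^a ζ(a,
y)` up to a small exponential loss (`eventually_partialZeta_mul_rpow_le`). The matching upper bound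
for `ρ` (`dickman_mul_exp_le`) holds at every exponent, so `ρ` need not be at its own saddle point.
The squares of the primes in `(√y, y]` supply the extra term `y^(1 - 2a) / log y`.

Both saddle point lower bounds, for `ρ` and for `Ψ`, use one elementary scheme in place of contour
integration: tilt the weight slightly past the saddle, show by Chernoff bounds that half of its mass
lies in a window on the correct side, and push that mass to the end of the window in many short
steps, each losing a factor close to 1. For `ρ` the step is the delay equation, for `Ψ` it is
multiplication by primes in `(√y, y]`. -/

/-- For a measure on `[0, ∞)` the set of exponents with finite exponential moment is
downward closed. -/
lemma mem_integrableExpSet_of_le {ν : Measure ℝ} (hν : ∀ᵐ x ∂ν, 0 ≤ x) {t t' : ℝ}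
    (h : t' ∈ integrableExpSet id ν) (htt : t ≤ t') : t ∈ integrableExpSet id ν := by
  refine Integrable.mono' (g := fun x => Real.exp (t' * x)) h (by fun_prop) ?_
  filter_upwards [hν] with x hx
  simp only [id, Real.norm_eq_abs, Real.abs_exp]
  exact Real.exp_le_exp.mpr (mul_le_mul_of_nonneg_right htt hx)

/-- Nonnegative Taylor coefficients: if the Taylor series of the moment generating function at `c`
converges at `c + h`, then the exponential moment at `c + h` is finite. -/
lemma add_mem_integrableExpSet_of_summable {ν : Measure ℝ} (hν : ∀ᵐ x ∂ν, 0 ≤ x) {c h : ℝ}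
    (hc : c ∈ interior (integrableExpSet id ν)) (hh : 0 ≤ h)
    (hs : Summable fun n : ℕ => (∫ x, x ^ n * Real.exp (c * x) ∂ν) / n.factorial * h ^ n) :
    c + h ∈ integrableExpSet id ν := by
  have hmom : ∀ n : ℕ, Integrable (fun x => x ^ n * Real.exp (c * x)) ν := fun n =>
    integrable_pow_mul_exp_of_mem_interior_integrableExpSet hc n
  refine ⟨by fun_prop, ?_⟩
  rw [hasFiniteIntegral_iff_norm]
  -- Expand `e^(h x)` in powers of `h x`. All terms are nonnegative on `[0, ∞)`, so Tonelli
  -- exchanges sum and integral and the Taylor series of the transform reappears.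
  have h1 : ∫⁻ x, ENNReal.ofReal ‖Real.exp ((c + h) * id x)‖ ∂ν
      = ∫⁻ x, ∑' n : ℕ, ENNReal.ofReal (x ^ n * Real.exp (c * x) / n.factorial * h ^ n) ∂ν := by
    refine lintegral_congr_ae ?_
    filter_upwards [hν] with x hx
    have hsum : HasSum (fun n : ℕ => x ^ n * Real.exp (c * x) / n.factorial * h ^ n)
        (Real.exp ((c + h) * x)) := by
      have := (NormedSpace.expSeries_div_hasSum_exp (𝔸 := ℝ) (h * x)).mul_left (Real.exp (c * x))
      rw [← Real.exp_eq_exp_ℝ, ← Real.exp_add] at this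
      rw [add_mul]
      refine this.congr_fun fun n => ?_
      rw [mul_pow]; ring
    rw [← ENNReal.ofReal_tsum_of_nonneg (fun n => by positivity) hsum.summable, hsum.tsum_eq]
    simp
  rw [h1, lintegral_tsum (fun n => by fun_prop)]
  have h2 : ∀ n : ℕ, ∫⁻ x, ENNReal.ofReal (x ^ n * Real.exp (c * x) / n.factorial * h ^ n) ∂ν
      = ENNReal.ofReal ((∫ x, x ^ n * Real.exp (c * x) ∂ν) / n.factorial * h ^ n) := by
    intro n
    rw [← ofReal_integral_eq_lintegral_ofReal (((hmom n).div_const _).mul_const _)]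
    · rw [integral_mul_const, integral_div]
    · filter_upwards [hν] with x hx
      positivity
  simp_rw [h2]
  rw [← ENNReal.ofReal_tsum_of_nonneg (fun n => ?_) hs]
  · exact ENNReal.ofReal_lt_top
  · have : 0 ≤ ∫ x, x ^ n * Real.exp (c * x) ∂ν :=
      integral_nonneg_of_ae (by filter_upwards [hν] with x hx; positivity)
    positivity

/-- **Landau's theorem** on the abscissa of convergence of a Laplace transform. -/
theorem landau_mgf {ν : Measure ℝ} (hν : ∀ᵐ x ∂ν, 0 ≤ x) {F : ℝ → ℝ} {b t₁ : ℝ}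
    (ht₁ : t₁ ∈ integrableExpSet id ν) (hF : AnalyticOnNhd ℝ F (Iio b))
    (hEq : ∀ t < t₁, mgf id ν t = F t) : Iio b ⊆ integrableExpSet id ν := by
  by_contra hcon
  obtain ⟨t₀, ht₀b, ht₀⟩ := Set.not_subset.mp hcon
  set A := integrableExpSet id ν with hA
  have hub : ∀ t ∈ A, t ≤ t₀ := fun t ht => by
    by_contra! hlt
    exact ht₀ (mem_integrableExpSet_of_le hν ht hlt.le)
  have hbdd : BddAbove A := ⟨t₀, hub⟩
  -- `c₀` is the abscissa of convergence; the negation puts it strictly below `b`, where `F` is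
  -- still analytic.
  set c₀ := sSup A with hc₀
  have hc₀b : c₀ < b := lt_of_le_of_lt (csSup_le ⟨t₁, ht₁⟩ hub) ht₀b
  have ht₁c : t₁ ≤ c₀ := le_csSup hbdd ht₁
  have hsub : Iio c₀ ⊆ interior A := by
    refine interior_maximal (fun t ht => ?_) isOpen_Iio
    obtain ⟨t', ht', htt'⟩ := exists_lt_of_lt_csSup ⟨t₁, ht₁⟩ ht
    exact mem_integrableExpSet_of_le hν ht' htt'.le
  have hEqOn : EqOn (mgf id ν) F (Iio c₀) := by
    refine AnalyticOnNhd.eqOn_of_preconnected_of_eventuallyEq (z₀ := t₁ - 1)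
      (analyticOnNhd_mgf.mono hsub) (hF.mono (Iio_subset_Iio hc₀b.le)) isPreconnected_Iio ?_ ?_
    · simp only [mem_Iio]; linarith
    · filter_upwards [Iio_mem_nhds (show t₁ - 1 < t₁ by linarith)] with t ht using hEq t ht
  obtain ⟨p, r, hp⟩ := hF c₀ hc₀b
  obtain ⟨ρ, hρ0, hρr⟩ := ENNReal.lt_iff_exists_nnreal_btwn.mp hp.r_pos
  have hρ : (0 : ℝ) < ρ := by exact_mod_cast hρ0
  -- Recentre the expansion of `F` at `c₀ - ρ/4`, where the exponential moments exist. Its disc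
  -- still contains the displacement `ρ/2`, which reaches `c₀ + ρ/4`, beyond the abscissa.
  set y : ℝ := -(ρ / 4) with hy
  have hny : (‖y‖₊ : ENNReal) = ((ρ / 4 : NNReal) : ENNReal) := by
    rw [hy, nnnorm_neg]
    congr 1
    ext
    simp
  have hlt4 : ((ρ / 4 : NNReal) : ENNReal) < r := by
    refine lt_of_le_of_lt ?_ hρr
    exact_mod_cast (by
      rw [← NNReal.coe_le_coe]; push_cast; linarith : ρ / 4 ≤ ρ)
  have hq := hp.changeOrigin (y := y) (by rw [hny]; exact hlt4)
  have hcmem : c₀ + y ∈ interior A := hsub (by simp only [mem_Iio, hy]; linarith)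
  have hq' := hasFPowerSeriesAt_mgf hcmem
  -- By uniqueness of power series, the recentred series is the Taylor series of the moment
  -- generating function, whose coefficients are nonnegative.
  have heq : p.changeOrigin y = _ :=
    (hq.hasFPowerSeriesAt.congr (f := F) (g := mgf id ν) (by
      filter_upwards [Iio_mem_nhds (show c₀ + y < c₀ by rw [hy]; linarith)] with t ht
      exact (hEqOn ht).symm)).eq_formalMultilinearSeries hq'
  have hmem : (ρ / 2 : ℝ) ∈ Metric.eball (0 : ℝ) (r - ‖y‖₊) := by
    rw [Metric.mem_eball, edist_zero_right, hny]
    have h3 : (‖(ρ / 2 : ℝ)‖ₑ : ENNReal) = ((ρ / 2 : NNReal) : ENNReal) := by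
      rw [enorm_eq_nnnorm]
      congr 1
      ext
      simp
    rw [h3]
    refine lt_tsub_iff_right.mpr ?_
    · refine lt_of_le_of_lt ?_ hρr
      exact_mod_cast (by
        rw [← NNReal.coe_le_coe]; push_cast; linarith : ρ / 2 + ρ / 4 ≤ ρ)
  have hsum := hq.hasSum hmem
  rw [heq] at hsum
  have hin := add_mem_integrableExpSet_of_summable (h := ρ / 2) hν hcmem (by positivity) (by
    refine hsum.summable.congr fun n => ?_
    simp [div_pow, mul_comm])
  have := le_csSup hbdd hin
  rw [← hc₀, hy] at this
  linarith

end Landau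

/-! ### Laplace transforms with eventually nonnegative density -/

section Laplace

open MeasureTheory ProbabilityTheory Set

/-- The measure on `(0, ∞)` whose density is the positive part of `w`. -/
noncomputable def laplaceMeasure (w : ℝ → ℝ) : Measure ℝ :=
  (volume.restrict (Ioi 0)).withDensity fun t => ENNReal.ofReal (w t)

lemma laplaceMeasure_ae_nonneg {w : ℝ → ℝ} (hw : Measurable w) :
    ∀ᵐ t ∂laplaceMeasure w, 0 ≤ t := by
  rw [laplaceMeasure, ae_withDensity_iff (by fun_prop)]
  filter_upwards [ae_restrict_mem measurableSet_Ioi] with t ht _ using (mem_Ioi.mp ht).le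

lemma mem_integrableExpSet_laplaceMeasure {w : ℝ → ℝ} (hw : Measurable w) (τ : ℝ) :
    τ ∈ integrableExpSet id (laplaceMeasure w) ↔
      IntegrableOn (fun t => max (w t) 0 * Real.exp (τ * t)) (Ioi 0) := by
  simp only [integrableExpSet, mem_ofPred_eq, laplaceMeasure]
  rw [integrable_withDensity_iff (by fun_prop) (ae_of_all _ fun _ => ENNReal.ofReal_lt_top)]
  simp only [id, ENNReal.toReal_ofReal', IntegrableOn]
  refine integrable_congr (ae_of_all _ fun t => ?_)
  simp only [mul_comm]

lemma mgf_laplaceMeasure {w : ℝ → ℝ} (hw : Measurable w) (τ : ℝ) :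
    mgf id (laplaceMeasure w) τ = ∫ t in Ioi 0, max (w t) 0 * Real.exp (τ * t) := by
  simp only [mgf, laplaceMeasure]
  rw [integral_withDensity_eq_integral_toReal_smul (by fun_prop)
    (ae_of_all _ fun _ => ENNReal.ofReal_lt_top)]
  simp [ENNReal.toReal_ofReal']

lemma integrableOn_mul_exp_of_bound {w : ℝ → ℝ} (hw : Measurable w) {C K τ : ℝ}
    (hb : ∀ t > 0, |w t| ≤ C * Real.exp (K * t)) (hτ : K + τ < 0) :
    IntegrableOn (fun t => w t * Real.exp (τ * t)) (Ioi 0) := by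
  refine Integrable.mono' (g := fun t => C * Real.exp ((K + τ) * t))
    ((integrableOn_exp_mul_Ioi hτ 0).const_mul C) (by fun_prop) ?_
  filter_upwards [ae_restrict_mem measurableSet_Ioi] with t ht
  rw [Real.norm_eq_abs, abs_mul, Real.abs_exp, add_mul, Real.exp_add, ← mul_assoc]
  exact mul_le_mul_of_nonneg_right (hb t ht) (Real.exp_pos _).le

/-- Analytic continuation of a Laplace transform with eventually nonnegative density. -/
theorem landau_laplace {w : ℝ → ℝ} (hw : Measurable w) {C K : ℝ}
    (hb : ∀ t > 0, |w t| ≤ C * Real.exp (K * t)) (hpos : ∀ᶠ t in atTop, 0 ≤ w t)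
    {F : ℝ → ℝ} {β : ℝ} (hF : AnalyticOnNhd ℝ F (Ioi β))
    (hEq : ∀ s > K, ∫ t in Ioi 0, w t * Real.exp (-s * t) = F s) :
    ∃ G : ℂ → ℂ, AnalyticOnNhd ℂ G {s | β < s.re} ∧ ∀ s : ℝ, K < s → G s = F s := by
  have hw' : Measurable (fun t => -w t) := hw.neg
  set ν := laplaceMeasure w
  set ν' := laplaceMeasure (fun t => -w t)
  have hb1 : ∀ t > 0, |max (w t) 0| ≤ C * Real.exp (K * t) := fun t ht =>
    (by rw [abs_of_nonneg (le_max_right _ _)]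
        exact max_le (le_abs_self _) (abs_nonneg _) : |max (w t) 0| ≤ |w t|).trans (hb t ht)
  have hb2 : ∀ t > 0, |max (-w t) 0| ≤ C * Real.exp (K * t) := fun t ht =>
    (by rw [abs_of_nonneg (le_max_right _ _)]
        exact max_le (neg_le_abs _) (abs_nonneg _) : |max (-w t) 0| ≤ |w t|).trans (hb t ht)
  have hν : ∀ τ, τ < -K → τ ∈ integrableExpSet id ν := fun τ hτ => by
    rw [mem_integrableExpSet_laplaceMeasure hw]
    exact integrableOn_mul_exp_of_bound (by fun_prop) hb1 (by linarith)
  obtain ⟨t₀, ht₀⟩ := eventually_atTop.mp hpos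
  -- The negative part of `w` vanishes beyond `t₀`, so all its exponential moments are finite and
  -- its transform is entire.
  have hν' : ∀ τ, τ ∈ integrableExpSet id ν' := fun τ => by
    rw [mem_integrableExpSet_laplaceMeasure hw']
    have hg : IntegrableOn (fun t => C * Real.exp (K * t) * Real.exp (τ * t)) (Ioc 0 t₀) :=
      (Continuous.integrableOn_Icc (by fun_prop)).mono_set Ioc_subset_Icc_self
    refine Integrable.mono' (g := indicator (Ioc 0 t₀)
      (fun t => C * Real.exp (K * t) * Real.exp (τ * t)))
      ((integrable_indicator_iff measurableSet_Ioc).mpr hg).integrableOn (by fun_prop) ?_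
    filter_upwards [ae_restrict_mem measurableSet_Ioi] with t ht
    by_cases htt : t ≤ t₀
    · rw [indicator_of_mem (show t ∈ Ioc 0 t₀ from ⟨ht, htt⟩), norm_mul, Real.norm_eq_abs,
        Real.norm_eq_abs, Real.abs_exp]
      exact mul_le_mul_of_nonneg_right (hb2 t ht) (Real.exp_pos _).le
    · rw [indicator_of_notMem (fun h => htt h.2),
        max_eq_right (by linarith [ht₀ t (not_le.mp htt).le])]
      simp
  have hν'univ : integrableExpSet id ν' = univ := eq_univ_of_forall hν'
  have hdiff : ∀ s > K, mgf id ν (-s) - mgf id ν' (-s) = F s := fun s hs => by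
    rw [mgf_laplaceMeasure hw, mgf_laplaceMeasure hw', ← hEq s hs, ← integral_sub]
    · refine integral_congr_ae (ae_of_all _ fun t => ?_)
      simp only [← sub_mul]
      congr 1
      rcases le_total 0 (w t) with h | h
      · rw [max_eq_left h, max_eq_right (by linarith)]; ring
      · rw [max_eq_right h, max_eq_left (by linarith)]; ring
    · exact integrableOn_mul_exp_of_bound (by fun_prop) hb1 (by linarith)
    · exact integrableOn_mul_exp_of_bound (by fun_prop) hb2 (by linarith)
  -- In the variable `τ = -s`, the transform of the positive part is that of `w` plus an entire
  -- function, so it inherits the real analyticity of `F`.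
  have hL := landau_mgf (laplaceMeasure_ae_nonneg hw) (t₁ := -K - 1) (b := -β)
    (F := fun τ => F (-τ) + mgf id ν' τ) (hν _ (by linarith)) (fun τ hτ => ?_) (fun τ hτ => ?_)
  · refine ⟨fun s => complexMGF id ν (-s) - complexMGF id ν' (-s), fun s hs => ?_, fun s hs => ?_⟩
    · have hs' : β < s.re := hs
      refine AnalyticAt.sub ?_ ?_
      · refine AnalyticAt.fun_comp (analyticAt_complexMGF ?_) (by fun_prop)
        refine interior_maximal hL isOpen_Iio ?_
        simpa using hs'
      · refine AnalyticAt.fun_comp (analyticAt_complexMGF ?_) (by fun_prop)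
        rw [hν'univ, interior_univ]
        trivial
    · rw [← hdiff s hs]
      simp only [← Complex.ofReal_neg, complexMGF_ofReal, Complex.ofReal_sub]
  · refine AnalyticAt.add ?_ (analyticAt_mgf (by rw [hν'univ, interior_univ]; trivial))
    exact AnalyticAt.fun_comp (hF (-τ) (by simp only [mem_Ioi, mem_Iio] at hτ ⊢; linarith))
      (by fun_prop)
  · have := hdiff (-τ) (by linarith)
    rw [neg_neg] at this
    linarith

/-- The substitution `y = e ^ t` in a Mellin transform. -/
lemma integral_Ioi_one_eq_integral_exp (g : ℝ → ℝ) (s : ℝ) :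
    ∫ y in Ioi (1 : ℝ), g y * y ^ (-(s + 1)) = ∫ t in Ioi (0 : ℝ), g (Real.exp t) * Real.exp (-s * t) := by
  have himg : Real.exp '' Ioi 0 = Ioi 1 := by
    ext y
    simp only [mem_image, mem_Ioi]
    constructor
    · rintro ⟨t, ht, rfl⟩
      exact Real.one_lt_exp_iff.mpr ht
    · intro hy
      exact ⟨Real.log y, Real.log_pos hy, Real.exp_log (by linarith)⟩
  rw [← himg, integral_image_eq_integral_abs_deriv_smul measurableSet_Ioi
    (fun t _ => (Real.hasDerivAt_exp t).hasDerivWithinAt) Real.exp_injective.injOn]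
  refine integral_congr_ae (ae_of_all _ fun t => ?_)
  simp only [Real.abs_exp, smul_eq_mul]
  rw [← Real.exp_mul, mul_left_comm, ← Real.exp_add]
  ring_nf

end Laplace

/-! ### Positivity of `(s - 1) ζ(s)` and the Laplace transform of the prime power sum -/

section Zeta

open MeasureTheory ProbabilityTheory Set

/-- A Dirichlet series with nonnegative coefficients as a Laplace transform. -/
lemma LSeries_eq_mul_laplace (f : ℕ → ℝ) (hf : ∀ n, 0 ≤ f n) {r s : ℝ} (hr : 0 ≤ r) (hs : r < s)
    (hO : (fun n ↦ ∑ k ∈ Finset.Icc 1 n, f k) =O[atTop] fun n ↦ (n : ℝ) ^ r) :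
    LSeries (fun n ↦ (f n : ℂ)) s = ((s * ∫ t in Ioi (0 : ℝ),
      (∑ k ∈ Finset.Icc 1 ⌊Real.exp t⌋₊, f k) * Real.exp (-s * t) : ℝ) : ℂ) := by
  rw [LSeries_eq_mul_integral_of_nonneg f hr (by simpa using hs) hO hf,
    ← integral_Ioi_one_eq_integral_exp (fun y => ∑ k ∈ Finset.Icc 1 ⌊y⌋₊, f k)]
  push_cast
  congr 1
  rw [← integral_complex_ofReal]
  refine setIntegral_congr_fun measurableSet_Ioi fun t ht => ?_
  have ht' : (0 : ℝ) ≤ t := by linarith [mem_Ioi.mp ht]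
  simp only [Complex.ofReal_mul, Complex.ofReal_sum]
  congr 1
  rw [Complex.ofReal_cpow ht']
  push_cast
  rfl

lemma integral_exp_neg_mul_Ioi {s : ℝ} (hs : 0 < s) :
    ∫ t in Ioi (0 : ℝ), Real.exp (-s * t) = 1 / s := by
  rw [integral_exp_mul_Ioi (by linarith)]
  simp

/-- Partial summation of `∑ n^(-s)`, with `⌊e^t⌋ = e^t - {e^t}`. The integral of the fractional part
converges for all `s > 0`, so this form of `(s - 1) ζ(s)` can be continued to the left of 1. -/
lemma riemannZeta₁_re_eq_of_one_lt {s : ℝ} (hs : 1 < s) :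
    (riemannZeta₁ s).re =
      s * (1 - (s - 1) * ∫ t in Ioi (0 : ℝ), Int.fract (Real.exp t) * Real.exp (-s * t)) := by
  have h1 := LSeries_eq_mul_laplace (fun _ => 1) (fun _ => zero_le_one) (r := 1) zero_le_one hs
    (by simpa using Asymptotics.isBigO_refl _ _)
  have hz : riemannZeta s = ((s * ∫ t in Ioi (0 : ℝ),
      (⌊Real.exp t⌋₊ : ℝ) * Real.exp (-s * t) : ℝ) : ℂ) := by
    rw [← LSeries_one_eq_riemannZeta (by simpa using hs)]
    simp only [Complex.ofReal_one, Finset.sum_const, Nat.card_Icc, add_tsub_cancel_right,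
      nsmul_eq_mul, mul_one] at h1
    rw [← h1]
    rfl
  have hne : (s : ℂ) ≠ 1 := by exact_mod_cast hs.ne'
  have hz1 : riemannZeta₁ s = (s - 1) * riemannZeta s := by
    rw [riemannZeta_eq_inv_sub_mul hne, ← mul_assoc, mul_inv_cancel₀ (sub_ne_zero.mpr hne), one_mul]
  have hfr : ∀ t : ℝ, Int.fract (Real.exp t) * Real.exp (-s * t)
      = Real.exp (-(s - 1) * t) - (⌊Real.exp t⌋₊ : ℝ) * Real.exp (-s * t) := fun t => by
    rw [show -(s - 1) * t = t + -s * t by ring, Real.exp_add, ← sub_mul,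
      ← Int.self_sub_floor, natCast_floor_eq_intCast_floor (Real.exp_pos t).le]
  have hmeas : Measurable (fun t : ℝ => (⌊Real.exp t⌋₊ : ℝ)) := by fun_prop
  have hI : ∫ t in Ioi (0 : ℝ), Int.fract (Real.exp t) * Real.exp (-s * t)
      = 1 / (s - 1) - ∫ t in Ioi (0 : ℝ), (⌊Real.exp t⌋₊ : ℝ) * Real.exp (-s * t) := by
    simp_rw [hfr]
    rw [integral_sub, integral_exp_neg_mul_Ioi (by linarith)]
    · exact integrableOn_exp_mul_Ioi (by linarith) 0
    · refine integrableOn_mul_exp_of_bound hmeas (C := 1) (K := 1) (fun t _ => ?_) (by linarith)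
      rw [abs_of_nonneg (by positivity), one_mul, one_mul]
      exact Nat.floor_le (Real.exp_pos t).le
  rw [hI, hz1, hz, ← Complex.ofReal_one, ← Complex.ofReal_sub, ← Complex.ofReal_mul,
    Complex.ofReal_re]
  have : s - 1 ≠ 0 := by linarith
  field_simp
  ring

/-- `(s - 1) ζ(s)` is positive for real `s > 0`. -/
lemma riemannZeta₁_re_pos {s : ℝ} (hs : 0 < s) : 0 < (riemannZeta₁ s).re := by
  rcases lt_or_ge 1 s with h | h
  · have hne : (s : ℂ) ≠ 1 := by exact_mod_cast h.ne'
    have hz1 : riemannZeta₁ s = ((s - 1 : ℝ) : ℂ) * riemannZeta s := by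
      rw [riemannZeta_eq_inv_sub_mul hne, ← mul_assoc]
      push_cast
      rw [mul_inv_cancel₀ (sub_ne_zero.mpr hne), one_mul]
    rw [hz1, Complex.re_ofReal_mul]
    exact mul_pos (by linarith) (riemannZeta_re_pos_of_one_lt h)
  have hw : Measurable (fun t : ℝ => Int.fract (Real.exp t)) := by fun_prop
  set ν := laplaceMeasure (fun t : ℝ => Int.fract (Real.exp t))
  have hmgf : ∀ τ, mgf id ν τ = ∫ t in Ioi 0, Int.fract (Real.exp t) * Real.exp (τ * t) :=
    fun τ => by
      rw [mgf_laplaceMeasure hw]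
      simp only [max_eq_left (Int.fract_nonneg _)]
  have hset : Iio 0 ⊆ integrableExpSet id ν := fun τ hτ => by
    rw [mem_integrableExpSet_laplaceMeasure hw]
    refine integrableOn_mul_exp_of_bound (by fun_prop) (C := 1) (K := 0) (fun t _ => ?_)
      (by simpa using hτ)
    rw [max_eq_left (Int.fract_nonneg _), abs_of_nonneg (Int.fract_nonneg _)]
    simpa using (Int.fract_lt_one _).le
  have hset' : Iio 0 ⊆ interior (integrableExpSet id ν) := interior_maximal hset isOpen_Iio
  -- The identity theorem extends the formula from `s > 1` to `s > 0`. For `s ≤ 1` the factor `1 -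
  -- (s - 1) ∫` is then at least 1.
  have heq : EqOn (fun s : ℝ => (riemannZeta₁ s).re)
      (fun s : ℝ => s * (1 - (s - 1) * mgf id ν (-s))) (Ioi 0) := by
    refine AnalyticOnNhd.eqOn_of_preconnected_of_eventuallyEq (𝕜 := ℝ) (z₀ := 2) (fun s _ => ?_)
      (fun s hs => ?_) isPreconnected_Ioi (by simp) ?_
    · exact (differentiable_riemannZeta₁.analyticAt s).re_ofReal
    · have : AnalyticAt ℝ (fun s => mgf id ν (-s)) s :=
        AnalyticAt.fun_comp (analyticAt_mgf (hset' (by simpa using hs))) (by fun_prop)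
      fun_prop
    · filter_upwards [Ioi_mem_nhds (show (1 : ℝ) < 2 by norm_num)] with s hs
      rw [riemannZeta₁_re_eq_of_one_lt hs, hmgf]
  have hs' := heq hs
  simp only at hs'
  rw [hs']
  have : 0 ≤ mgf id ν (-s) := mgf_nonneg
  exact mul_pos hs (by nlinarith)

/-- `∑_{n ≤ y} Λ(n) / (n ^ a log n)`. -/
noncomputable def primePowSum (a y : ℝ) : ℝ :=
  ∑ n ∈ Finset.Icc 1 ⌊y⌋₊, ArithmeticFunction.vonMangoldt n / Real.log n * (n : ℝ) ^ (-a)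

lemma primePowCoeff_nonneg (a : ℝ) (n : ℕ) :
    0 ≤ ArithmeticFunction.vonMangoldt n / Real.log n * (n : ℝ) ^ (-a) :=
  mul_nonneg (div_nonneg ArithmeticFunction.vonMangoldt_nonneg (Real.log_natCast_nonneg n))
    (by positivity)

lemma primePowCoeff_le_one {a : ℝ} (ha : 0 ≤ a) (n : ℕ) :
    ArithmeticFunction.vonMangoldt n / Real.log n * (n : ℝ) ^ (-a) ≤ 1 := by
  rcases n.eq_zero_or_pos with rfl | hn
  · simp
  have h1 : (1 : ℝ) ≤ n := by exact_mod_cast hn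
  refine mul_le_one₀ ?_ (by positivity) (Real.rpow_le_one_of_one_le_of_nonpos h1 (by linarith))
  exact div_le_one_of_le₀ ArithmeticFunction.vonMangoldt_le_log (Real.log_natCast_nonneg n)

lemma primePowSum_nonneg (a y : ℝ) : 0 ≤ primePowSum a y :=
  Finset.sum_nonneg fun n _ => primePowCoeff_nonneg a n

lemma primePowSum_le {a y : ℝ} (ha : 0 ≤ a) (hy : 0 ≤ y) : primePowSum a y ≤ y := by
  refine (Finset.sum_le_card_nsmul _ _ 1 fun n _ => primePowCoeff_le_one ha n).trans ?_
  simpa using Nat.floor_le hy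

lemma measurable_primePowSum (a : ℝ) : Measurable (primePowSum a) := by
  have : primePowSum a = (fun n : ℕ => ∑ n ∈ Finset.Icc 1 n,
      ArithmeticFunction.vonMangoldt n / Real.log n * (n : ℝ) ^ (-a)) ∘ Nat.floor := rfl
  rw [this]
  exact (measurable_from_top).comp Nat.measurable_floor

/-- The Laplace transform of `primePowSum` is `log ζ`, up to a constant. -/
lemma exists_laplace_primePowSum {a : ℝ} (ha : 0 < a) : ∃ c₀ : ℝ, ∀ s > (1 : ℝ),
    s * ∫ t in Ioi (0 : ℝ), primePowSum a (Real.exp t) * Real.exp (-s * t)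
      = Real.log (riemannZeta ((s + a : ℝ) : ℂ)).re + c₀ := by
  set f : ℕ → ℝ := fun n => ArithmeticFunction.vonMangoldt n / Real.log n * (n : ℝ) ^ (-a) with hf
  set A : ℂ → ℂ := LSeries (fun n => (f n : ℂ)) with hA
  have hO : (fun n ↦ ∑ k ∈ Finset.Icc 1 n, f k) =O[atTop] fun n ↦ (n : ℝ) ^ (1 : ℝ) := by
    refine Asymptotics.IsBigO.of_bound 1 (Eventually.of_forall fun n => ?_)
    rw [Real.norm_eq_abs, abs_of_nonneg (Finset.sum_nonneg fun n _ => primePowCoeff_nonneg a n)]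
    simpa [primePowSum] using primePowSum_le (y := n) ha.le (by positivity)
  have hAeq : ∀ s : ℝ, 1 < s → A s = ((s * ∫ t in Ioi (0 : ℝ),
      primePowSum a (Real.exp t) * Real.exp (-s * t) : ℝ) : ℂ) := fun s hs =>
    LSeries_eq_mul_laplace f (primePowCoeff_nonneg a) zero_le_one hs hO
  have habs : LSeries.abscissaOfAbsConv (fun n => (f n : ℂ)) ≤ 1 := by
    refine LSeries.abscissaOfAbsConv_le_of_forall_lt_LSeriesSummable' fun s hs => ?_
    refine LSeriesSummable_of_sum_norm_bigO (r := 1) ?_ zero_le_one (by exact_mod_cast hs)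
    refine hO.congr_left fun n => Finset.sum_congr rfl fun k _ => ?_
    rw [Complex.norm_real, Real.norm_eq_abs, abs_of_nonneg (primePowCoeff_nonneg a k)]
  have hder : ∀ s : ℝ, 1 < s → HasDerivAt (fun t : ℝ => (A t).re)
      (deriv riemannZeta ((s + a : ℝ) : ℂ) / riemannZeta ((s + a : ℝ) : ℂ)).re s := by
    intro s hs
    have h1 := LSeries_hasDerivAt (f := fun n => (f n : ℂ)) (s := s)
      (lt_of_le_of_lt habs (by exact_mod_cast hs))
    -- Differentiating restores the factor `log n`, so `Λ(n) / log n` becomes `Λ(n)` and the series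
    -- is `-ζ'/ζ` at `s + a`.
    have h2 : LSeries (LSeries.logMul (fun n => (f n : ℂ))) s
        = LSeries (fun n => (ArithmeticFunction.vonMangoldt n : ℂ)) ((s + a : ℝ) : ℂ) := by
      refine tsum_congr fun n => ?_
      rcases n.eq_zero_or_pos with rfl | hn
      · simp [LSeries.term]
      rw [LSeries.term_of_ne_zero hn.ne', LSeries.term_of_ne_zero hn.ne']
      have hn0 : (n : ℂ) ≠ 0 := by exact_mod_cast hn.ne'
      have hlog : Complex.log n * (f n : ℂ)
          = (ArithmeticFunction.vonMangoldt n : ℂ) / (n : ℂ) ^ (a : ℂ) := by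
        rw [← Complex.natCast_log, ← Complex.ofReal_mul, hf]
        have hreal : Real.log n * (ArithmeticFunction.vonMangoldt n / Real.log n * (n : ℝ) ^ (-a))
            = ArithmeticFunction.vonMangoldt n / (n : ℝ) ^ a := by
          rw [Real.rpow_neg (by positivity)]
          -- This is the case `n = 1`, where the coefficient is `0 / 0 = 0`.
          by_cases hl : Real.log n = 0
          · have : ArithmeticFunction.vonMangoldt n = 0 := le_antisymm
              (by simpa [hl] using ArithmeticFunction.vonMangoldt_le_log (n := n))
              ArithmeticFunction.vonMangoldt_nonneg
            simp [this]
          · field_simp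
        rw [hreal, Complex.ofReal_div, Complex.ofReal_cpow (by positivity)]
        simp
      rw [LSeries.logMul, hlog, Complex.ofReal_add, Complex.cpow_add _ _ hn0]
      field_simp
    rw [h2, ArithmeticFunction.LSeries_vonMangoldt_eq_deriv_riemannZeta_div
      (by simp; linarith), neg_div, neg_neg] at h1
    exact h1.real_of_complex
  have hzeta : ∀ s : ℝ, 1 < s → HasDerivAt (fun t : ℝ => Real.log (riemannZeta ((t + a : ℝ) : ℂ)).re)
      (deriv riemannZeta ((s + a : ℝ) : ℂ) / riemannZeta ((s + a : ℝ) : ℂ)).re s := by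
    intro s hs
    have hsa : 1 < s + a := by linarith
    have hd : HasDerivAt riemannZeta (deriv riemannZeta ((s + a : ℝ) : ℂ)) ((s + a : ℝ) : ℂ) :=
      (differentiableAt_riemannZeta (by exact_mod_cast hsa.ne')).hasDerivAt
    have h1 := (hd.real_of_complex.comp_add_const s a).log (riemannZeta_re_pos_of_one_lt hsa).ne'
    convert! h1 using 1
    have hre : riemannZeta ((s + a : ℝ) : ℂ) = ((riemannZeta ((s + a : ℝ) : ℂ)).re : ℂ) :=
      Complex.ext (by simp) (by rw [riemannZeta_im_eq_zero_of_one_lt hsa, Complex.ofReal_im])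
    rw [hre, Complex.div_ofReal_re, Complex.ofReal_re]
  -- Equal derivatives leave an additive constant. Its value is immaterial: after exponentiation it
  -- is only a nonzero factor.
  obtain ⟨c₀, hc₀⟩ := isOpen_Ioi.exists_is_const_of_deriv_eq_zero
    (s := Ioi (1 : ℝ)) (f := fun t : ℝ => (A t).re - Real.log (riemannZeta ((t + a : ℝ) : ℂ)).re)
    isPreconnected_Ioi
    (fun s hs => ((hder s hs).sub (hzeta s hs)).differentiableAt.differentiableWithinAt)
    (fun s hs => by
      rw [((hder s hs).fun_sub (hzeta s hs)).deriv, sub_self]; rfl)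
  refine ⟨c₀, fun s hs => ?_⟩
  have := hc₀ s hs
  simp only [hAeq s hs, Complex.ofReal_re] at this
  linarith

end Zeta

/-! ### The function `(e^t - 1) / t`, its primitive and the Laplace transform of the primitive -/

section ExpQuot

open MeasureTheory Set

/-- The entire function `(e ^ t - 1) / t`. -/
noncomputable def expQuot (t : ℝ) : ℝ := ∫ r in (0 : ℝ)..1, Real.exp (r * t)

/-- The integral `∫_0^s (e ^ t - 1) / t dt`. -/
noncomputable def expQuotInt (s : ℝ) : ℝ := ∫ t in (0 : ℝ)..s, expQuot t

lemma continuous_expQuot : Continuous expQuot :=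
  intervalIntegral.continuous_parametric_intervalIntegral_of_continuous' (by fun_prop) 0 1

lemma expQuot_eq {t : ℝ} (ht : t ≠ 0) : expQuot t = (Real.exp t - 1) / t := by
  rw [expQuot, intervalIntegral.integral_comp_mul_right (fun x => Real.exp x) ht]
  simp [div_eq_inv_mul]

lemma mul_expQuot (t : ℝ) : t * expQuot t = Real.exp t - 1 := by
  rcases eq_or_ne t 0 with rfl | ht
  · simp
  · rw [expQuot_eq ht, mul_div_cancel₀ _ ht]

/-- Under the integral sign, `e^(r(s+h)) - e^(rs) ≤ r h e^(r(s+h))` by `1 - z ≤ e^(-z)`. -/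
lemma expQuot_sub_le {s h : ℝ} (hs : 0 ≤ s) (hh : 0 ≤ h) :
    expQuot (s + h) - expQuot s ≤ h * Real.exp (s + h) := by
  rw [expQuot, expQuot, ← intervalIntegral.integral_sub
    (Continuous.intervalIntegrable (by fun_prop) _ _)
    (Continuous.intervalIntegrable (by fun_prop) _ _)]
  have : h * Real.exp (s + h) = ∫ _ in (0 : ℝ)..1, h * Real.exp (s + h) := by simp
  rw [this]
  refine intervalIntegral.integral_mono_on zero_le_one
    (Continuous.intervalIntegrable (by fun_prop) _ _)
    (Continuous.intervalIntegrable (by fun_prop) _ _) fun r hr => ?_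
  have h1 : Real.exp (r * s) ≥ Real.exp (r * (s + h)) * (1 - r * h) := by
    have := Real.add_one_le_exp (-(r * h))
    calc Real.exp (r * (s + h)) * (1 - r * h) ≤ Real.exp (r * (s + h)) * Real.exp (-(r * h)) := by
          gcongr; linarith
      _ = Real.exp (r * s) := by rw [← Real.exp_add]; ring_nf
  calc Real.exp (r * (s + h)) - Real.exp (r * s) ≤ r * h * Real.exp (r * (s + h)) := by linarith
    _ ≤ 1 * h * Real.exp (1 * (s + h)) := by
        have := hr.1
        have := hr.2
        gcongr
    _ = h * Real.exp (s + h) := by ring_nf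

lemma monotone_expQuot : Monotone expQuot := fun s t hst =>
  intervalIntegral.integral_mono_on zero_le_one (Continuous.intervalIntegrable (by fun_prop) _ _)
    (Continuous.intervalIntegrable (by fun_prop) _ _) fun r hr =>
    Real.exp_le_exp.mpr (mul_le_mul_of_nonneg_left hst hr.1)

lemma expQuot_zero : expQuot 0 = 1 := by simp [expQuot]

lemma one_le_expQuot {s : ℝ} (hs : 0 ≤ s) : 1 ≤ expQuot s := expQuot_zero ▸ monotone_expQuot hs

lemma expQuot_pos (s : ℝ) : 0 < expQuot s :=
  intervalIntegral.intervalIntegral_pos_of_pos (Continuous.intervalIntegrable (by fun_prop) _ _)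
    (fun _ => Real.exp_pos _) one_pos

lemma hasDerivAt_expQuotInt (s : ℝ) : HasDerivAt expQuotInt (expQuot s) s :=
  intervalIntegral.integral_hasDerivAt_right (continuous_expQuot.intervalIntegrable _ _)
    (continuous_expQuot.stronglyMeasurableAtFilter _ _) continuous_expQuot.continuousAt

lemma continuous_expQuotInt : Continuous expQuotInt :=
  continuous_iff_continuousAt.mpr fun s => (hasDerivAt_expQuotInt s).continuousAt

lemma expQuotInt_zero : expQuotInt 0 = 0 := by simp [expQuotInt]

/-- Convexity of `expQuotInt`. -/
lemma mul_expQuot_le_expQuotInt_sub (s t : ℝ) :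
    (t - s) * expQuot s ≤ expQuotInt t - expQuotInt s := by
  rw [expQuotInt, expQuotInt, intervalIntegral.integral_interval_sub_left
    (continuous_expQuot.intervalIntegrable _ _) (continuous_expQuot.intervalIntegrable _ _)]
  have hc : ∀ a b : ℝ, ∫ _ in a..b, expQuot s = (b - a) * expQuot s := fun a b => by simp
  rw [← hc]
  rcases le_total s t with h | h
  · exact intervalIntegral.integral_mono_on h (by simp) (continuous_expQuot.intervalIntegrable _ _)
      fun r hr => monotone_expQuot hr.1
  · rw [intervalIntegral.integral_symm, intervalIntegral.integral_symm t s, neg_le_neg_iff]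
    exact intervalIntegral.integral_mono_on h (continuous_expQuot.intervalIntegrable _ _) (by simp)
      fun r hr => monotone_expQuot hr.2

lemma expQuotInt_nonneg {s : ℝ} (hs : 0 ≤ s) : 0 ≤ expQuotInt s := by
  have := mul_expQuot_le_expQuotInt_sub 0 s
  rw [expQuotInt_zero, expQuot_zero] at this
  linarith

/-- The tangent at `s`, evaluated at 0, gives `expQuotInt s ≤ s * expQuot s = e^s - 1`. -/
lemma expQuotInt_le (s : ℝ) : expQuotInt s ≤ Real.exp s := by
  have := mul_expQuot_le_expQuotInt_sub s 0
  rw [expQuotInt_zero, zero_sub, neg_mul, mul_expQuot] at this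
  linarith

lemma expQuotInt_mul_eq (b t : ℝ) : expQuotInt (b * t) = ∫ r in (0 : ℝ)..b, t * expQuot (r * t) := by
  rcases eq_or_ne t 0 with rfl | ht
  · simp [expQuotInt]
  · rw [intervalIntegral.integral_const_mul,
      intervalIntegral.integral_comp_mul_right (fun x => expQuot x) ht, expQuotInt]
    simp [ht]

/-- The integrand is a difference of two exponentials, since `t * expQuot (r t) = (e^(rt) - 1) / r`.
Integrating the result over `0 < r ≤ b` produces the logarithms in `laplace_expQuotInt`. -/
lemma integral_mul_expQuot_mul_exp {r s : ℝ} (hr : 0 < r) (hrs : r < s) :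
    ∫ t in Ioi (0 : ℝ), t * expQuot (r * t) * Real.exp (-s * t) = 1 / s * (1 / (s - r)) := by
  have h : ∀ t : ℝ, t * expQuot (r * t) * Real.exp (-s * t)
      = 1 / r * (Real.exp (-(s - r) * t) - Real.exp (-s * t)) := fun t => by
    have := mul_expQuot (r * t)
    rw [show -(s - r) * t = r * t + -s * t by ring, Real.exp_add]
    have h' : t * expQuot (r * t) = 1 / r * (Real.exp (r * t) - 1) := by
      rw [← this]
      field_simp
    rw [h']
    ring
  simp_rw [h]
  rw [integral_const_mul, integral_sub (integrableOn_exp_mul_Ioi (by linarith) 0)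
    (integrableOn_exp_mul_Ioi (by linarith) 0), integral_exp_neg_mul_Ioi (by linarith),
    integral_exp_neg_mul_Ioi (by linarith)]
  have : s - r ≠ 0 := by linarith
  have : s ≠ 0 := by linarith
  field_simp
  ring

/-- The Laplace transform of `t ↦ expQuotInt (b t)`. -/
lemma laplace_expQuotInt {b s : ℝ} (hb : 0 < b) (hbs : b < s) :
    ∫ t in Ioi (0 : ℝ), expQuotInt (b * t) * Real.exp (-s * t)
      = 1 / s * (Real.log s - Real.log (s - b)) := by
  have h1 : ∀ t : ℝ, expQuotInt (b * t) * Real.exp (-s * t)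
      = ∫ r in Ioc 0 b, t * expQuot (r * t) * Real.exp (-s * t) := fun t => by
    rw [expQuotInt_mul_eq, intervalIntegral.integral_of_le hb.le, integral_mul_const]
  simp_rw [h1]
  have hcont : Continuous (fun p : ℝ × ℝ => p.1 * expQuot (p.2 * p.1) * Real.exp (-s * p.1)) := by
    have := continuous_expQuot
    fun_prop
  rw [integral_integral_swap]
  · rw [setIntegral_congr_fun (g := fun r => 1 / s * (1 / (s - r))) measurableSet_Ioc
      (fun r hr => integral_mul_expQuot_mul_exp hr.1 (lt_of_le_of_lt hr.2 hbs)), integral_const_mul,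
      ← intervalIntegral.integral_of_le hb.le]
    rw [intervalIntegral.integral_comp_sub_left (fun x => 1 / x) s, sub_zero,
      integral_one_div_of_pos (by linarith) (by linarith),
      Real.log_div (by linarith) (by linarith)]
  · have hg : Integrable (fun t : ℝ => 1 / b * Real.exp ((b - s) * t)) (volume.restrict (Ioi 0)) :=
      (integrableOn_exp_mul_Ioi (by linarith) 0).const_mul _
    have hg2 : Integrable (fun _ : ℝ => (1 : ℝ)) (volume.restrict (Ioc 0 b)) := by simp
    refine (hg.mul_prod hg2).mono' hcont.aestronglyMeasurable ?_
    rw [Measure.prod_restrict]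
    filter_upwards [ae_restrict_mem (measurableSet_Ioi.prod measurableSet_Ioc)] with p hp
    have hp1 : 0 < p.1 := hp.1
    have hp2 : p.2 ≤ b := hp.2.2
    simp only [Function.uncurry]
    rw [Real.norm_eq_abs, abs_of_nonneg (by have := (expQuot_pos (p.2 * p.1)).le; positivity), mul_one]
    -- Domination uniform in `r ≤ b`: by monotonicity the kernel is at most its value at `r = b`,
    -- which is `(e^(bt) - 1) / b`.
    have h2 : p.1 * expQuot (p.2 * p.1) ≤ 1 / b * Real.exp (b * p.1) := by
      have := monotone_expQuot (mul_le_mul_of_nonneg_right hp2 hp1.le)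
      have h3 := mul_expQuot (b * p.1)
      rw [one_div, ← div_eq_inv_mul, le_div_iff₀ hb]
      nlinarith [mul_le_mul_of_nonneg_left this (mul_pos hb hp1).le]
    calc _ ≤ 1 / b * Real.exp (b * p.1) * Real.exp (-s * p.1) := by gcongr
      _ = _ := by rw [mul_assoc, ← Real.exp_add]; ring_nf

end ExpQuot

/-! ### Oscillation of the prime power sum from the zeros of zeta -/

section Oscillation

open MeasureTheory Set

lemma zetaTheta_le_one : zetaTheta ≤ 1 := by
  refine csSup_le ⟨-2, -2, ?_, by simp⟩ ?_
  · simpa using riemannZeta_neg_two_mul_nat_add_one 0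
  · rintro r ⟨s, hs, rfl⟩
    by_contra! h
    exact riemannZeta_ne_zero_of_one_le_re h.le hs

lemma exists_zero_of_lt_zetaTheta {r : ℝ} (hr : r < zetaTheta) :
    ∃ s : ℂ, riemannZeta s = 0 ∧ r < s.re := by
  have hne : {r : ℝ | ∃ s : ℂ, riemannZeta s = 0 ∧ s.re = r}.Nonempty :=
    ⟨-2, -2, by simpa using riemannZeta_neg_two_mul_nat_add_one 0, by simp⟩
  obtain ⟨_, ⟨s, hs, rfl⟩, h⟩ := exists_lt_of_lt_csSup hne hr
  exact ⟨s, hs, h⟩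

lemma riemannZeta₁_eq {s : ℂ} (hs : s ≠ 1) : riemannZeta₁ s = (s - 1) * riemannZeta s := by
  rw [riemannZeta_eq_inv_sub_mul hs, ← mul_assoc, mul_inv_cancel₀ (sub_ne_zero.mpr hs), one_mul]

lemma riemannZeta₁_ofReal_of_one_lt {s : ℝ} (hs : 1 < s) :
    riemannZeta₁ s = ((riemannZeta₁ s).re : ℂ) := by
  refine Complex.ext (by simp) ?_
  rw [riemannZeta₁_eq (by exact_mod_cast hs.ne'), ← Complex.ofReal_one, ← Complex.ofReal_sub,
    Complex.im_ofReal_mul, riemannZeta_im_eq_zero_of_one_lt hs, mul_zero, Complex.ofReal_im]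

/-- Two functions analytic on a half-plane which agree on a real half-line are equal. -/
lemma eqOn_halfPlane_of_eq_ofReal {f g : ℂ → ℂ} {β K : ℝ}
    (hf : AnalyticOnNhd ℂ f {s | β < s.re}) (hg : AnalyticOnNhd ℂ g {s | β < s.re})
    (h : ∀ s : ℝ, K < s → f s = g s) : EqOn f g {s | β < s.re} := by
  set z : ℝ := max β K + 1
  have hzβ : β < z := by have := le_max_left β K; simp only [z]; linarith
  have hzK : K < z := by have := le_max_right β K; simp only [z]; linarith
  refine hf.eqOn_of_preconnected_of_frequently_eq hg
    (convex_halfSpace_re_gt β).isPreconnected (z₀ := (z : ℂ)) (by simpa using hzβ) ?_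
  have ht : Tendsto (fun t : ℝ => (t : ℂ)) (𝓝[≠] z) (𝓝[≠] (z : ℂ)) :=
    tendsto_nhdsWithin_of_tendsto_nhds_of_eventually_within _
      ((Complex.continuous_ofReal.tendsto z).mono_left nhdsWithin_le_nhds)
      (by
        filter_upwards [self_mem_nhdsWithin] with t ht
        simpa using ht)
  refine ht.frequently (Eventually.frequently ?_)
  filter_upwards [nhdsWithin_le_nhds (Ioi_mem_nhds hzK)] with t ht using h t ht

/-- **Oscillation of the prime power sum**: the difference with the smooth approximation
exceeds `y ^ β` in either direction for every `β < Θ - a`. -/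
theorem frequently_rpow_le_primePowSum_sub {a β ε : ℝ} (ha : 0 < a) (ha1 : a < 1) (hβ : 0 < β)
    (hε0 : ε ≠ 0) (hΘ : a + β < zetaTheta) :
    ∃ᶠ y in atTop, y ^ β ≤ ε * (primePowSum a y - expQuotInt ((1 - a) * Real.log y)) := by
  intro hcon
  obtain ⟨c₀, hc₀⟩ := exists_laplace_primePowSum ha
  have hβ1 : β < 1 := by linarith [zetaTheta_le_one]
  -- If the claim fails, this function of `t = log y` is eventually positive. The sign of `ε`
  -- selects the direction of the oscillation.
  set w : ℝ → ℝ := fun t => Real.exp (β * t)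
    - ε * (primePowSum a (Real.exp t) - expQuotInt ((1 - a) * t)) with hw
  have hmS : Measurable (fun t => primePowSum a (Real.exp t)) :=
    (measurable_primePowSum a).comp Real.measurable_exp
  have hmI : Measurable (fun t => expQuotInt ((1 - a) * t)) :=
    (continuous_expQuotInt.comp (by fun_prop)).measurable
  have hwm : Measurable w := by fun_prop
  have hbS : ∀ t > 0, |primePowSum a (Real.exp t)| ≤ 1 * Real.exp (1 * t) := fun t ht => by
    rw [abs_of_nonneg (primePowSum_nonneg _ _), one_mul, one_mul]
    exact primePowSum_le ha.le (Real.exp_pos t).le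
  have hbI : ∀ t > 0, |expQuotInt ((1 - a) * t)| ≤ 1 * Real.exp (1 * t) := fun t ht => by
    rw [abs_of_nonneg (expQuotInt_nonneg (by nlinarith)), one_mul]
    refine (expQuotInt_le _).trans (Real.exp_le_exp.mpr ?_)
    nlinarith
  have hb : ∀ t > 0, |w t| ≤ (1 + |ε| * 2) * Real.exp (1 * t) := fun t ht => by
    have h1 := hbS t ht
    have h2 := hbI t ht
    have h3 : Real.exp (β * t) ≤ Real.exp (1 * t) := Real.exp_le_exp.mpr (by nlinarith)
    calc |w t| ≤ |Real.exp (β * t)| + |ε * (primePowSum a (Real.exp t) - expQuotInt ((1 - a) * t))| :=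
          abs_sub _ _
      _ ≤ Real.exp (1 * t) + |ε| * (2 * Real.exp (1 * t)) := by
          rw [Real.abs_exp, abs_mul]
          refine add_le_add h3 (mul_le_mul_of_nonneg_left ?_ (abs_nonneg _))
          exact (abs_sub _ _).trans (by linarith)
      _ = _ := by ring
  have hpos : ∀ᶠ t in atTop, 0 ≤ w t := by
    filter_upwards [Real.tendsto_exp_atTop.eventually hcon] with t ht
    rw [not_le, Real.log_exp, ← Real.exp_mul, mul_comm t β] at ht
    simp only [hw]
    linarith
  -- The terms `-log (s + a - 1)` from `log ζ(s + a)` and from the transform of `expQuotInt` cancel,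
  -- leaving `riemannZeta₁`. Hence there is no singularity at `s = 1 - a`.
  set F : ℝ → ℝ := fun s => 1 / (s - β)
    - ε * (1 / s * (Real.log (riemannZeta₁ ((s + a : ℝ) : ℂ)).re - Real.log s + c₀)) with hFdef
  have hF : AnalyticOnNhd ℝ F (Ioi β) := fun s hs => by
    have hs' : β < s := hs
    have hs0 : 0 < s := hβ.trans hs'
    have h1 : AnalyticAt ℝ (fun s : ℝ => (riemannZeta₁ ((s + a : ℝ) : ℂ)).re) s :=
      AnalyticAt.fun_comp (g := fun s : ℝ => (riemannZeta₁ (s : ℂ)).re)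
        (differentiable_riemannZeta₁.analyticAt _).re_ofReal (by fun_prop)
    have h2 := h1.log (riemannZeta₁_re_pos (by linarith : 0 < s + a))
    have h3 := analyticAt_log hs0
    have h4 : s - β ≠ 0 := by linarith
    have h5 : AnalyticAt ℝ (fun s : ℝ => 1 / (s - β)) s := by fun_prop (disch := assumption)
    have h6 : AnalyticAt ℝ (fun s : ℝ => 1 / s) s := by fun_prop (disch := exact hs0.ne')
    exact h5.sub (analyticAt_const.mul (h6.mul ((h2.sub h3).add analyticAt_const)))
  have hEq : ∀ s > 1, ∫ t in Ioi 0, w t * Real.exp (-s * t) = F s := fun s hs => by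
    have hsplit : ∀ t, w t * Real.exp (-s * t) = Real.exp (-(s - β) * t)
        - ε * (primePowSum a (Real.exp t) * Real.exp (-s * t)
          - expQuotInt ((1 - a) * t) * Real.exp (-s * t)) := fun t => by
      rw [show -(s - β) * t = β * t + -s * t by ring, Real.exp_add]
      simp only [hw]
      ring
    have i1 := integrableOn_mul_exp_of_bound hmS hbS (by linarith : 1 + -s < 0)
    have i2 := integrableOn_mul_exp_of_bound hmI hbI (by linarith : 1 + -s < 0)
    have i3 : Integrable (fun t => ε * (primePowSum a (Real.exp t) * Real.exp (-s * t)
        - expQuotInt ((1 - a) * t) * Real.exp (-s * t))) (volume.restrict (Ioi 0)) :=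
      (Integrable.sub i1 i2).const_mul ε
    simp_rw [hsplit]
    rw [integral_sub (integrableOn_exp_mul_Ioi (by linarith) 0) i3,
      integral_const_mul, integral_sub i1 i2, integral_exp_neg_mul_Ioi (by linarith),
      laplace_expQuotInt (by linarith) (by linarith)]
    have hA := hc₀ s hs
    have hlog := log_riemannZeta_eq_neg_log_sub_add_ofReal (show s + a > 1 by linarith)
    rw [hlog] at hA
    have hs0 : s ≠ 0 := by linarith
    have hA' : ∫ t in Ioi (0 : ℝ), primePowSum a (Real.exp t) * Real.exp (-s * t) = 1 / s *
        (-Real.log (s + a - 1) + Real.log (riemannZeta₁ ((s + a : ℝ) : ℂ)).re + c₀) := by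
      rw [← hA]
      field_simp
    rw [hA', show s - (1 - a) = s + a - 1 by ring]
    simp only [hFdef]
    ring
  obtain ⟨G, hG, hGF⟩ := landau_laplace hwm hb hpos hF hEq
  -- Solving `F = G` for the logarithm and exponentiating avoids choosing a complex branch: both
  -- sides are analytic on `Re s > β` and agree for real `s > 1`.
  have hEqOn := eqOn_halfPlane_of_eq_ofReal (f := fun s => riemannZeta₁ (s + a))
    (g := fun s => s * Complex.exp (s / ε * (1 / (s - β) - G s) - c₀)) (β := β) (K := 1)
    (fun s _ => by
      exact AnalyticAt.fun_comp (differentiable_riemannZeta₁.analyticAt _) (by fun_prop))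
    (fun s hs => by
      have hs' : β < s.re := hs
      have h1 := hG s hs
      have h4 : s - β ≠ 0 := fun h => by
        rw [sub_eq_zero] at h
        rw [h, Complex.ofReal_re] at hs'
        exact lt_irrefl _ hs'
      have h5 : AnalyticAt ℂ (fun s : ℂ => 1 / (s - β)) s := by fun_prop (disch := assumption)
      have h6 : AnalyticAt ℂ (fun s : ℂ => s / ε) s := analyticAt_id.div_const
      exact analyticAt_id.mul (((h6.mul (h5.sub h1)).sub analyticAt_const).cexp))
    (fun s hs => by
      have hs0 : 0 < s := by linarith
      have hsa : 1 < s + a := by linarith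
      rw [hGF s hs, ← Complex.ofReal_add, riemannZeta₁_ofReal_of_one_lt hsa]
      norm_cast
      have hD : s / ε * (1 / (s - β) - F s) - c₀
          = Real.log (riemannZeta₁ ((s + a : ℝ) : ℂ)).re - Real.log s := by
        simp only [hFdef]
        field_simp
        ring
      rw [hD, Real.exp_sub, Real.exp_log (riemannZeta₁_re_pos (by linarith)), Real.exp_log hs0]
      field_simp)
  -- At `s = z - a` the left side vanishes, while the right side is `s` times an exponential, with
  -- `Re s > β > 0`.
  obtain ⟨z, hz, hzre⟩ := exists_zero_of_lt_zetaTheta hΘ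
  have hz1 : z ≠ 1 := fun h => riemannZeta_one_ne_zero (h ▸ hz)
  have hzmem : β < (z - a).re := by
    rw [Complex.sub_re, Complex.ofReal_re]; linarith
  have := hEqOn hzmem
  simp only [sub_add_cancel] at this
  rw [riemannZeta₁_eq hz1, hz, mul_zero, eq_comm, mul_eq_zero] at this
  rcases this with h | h
  · rw [h, Complex.zero_re] at hzmem
    linarith
  · exact Complex.exp_ne_zero _ h

end Oscillation

/-! ### The Dickman function and its Laplace transform -/

section Dickman

open MeasureTheory ProbabilityTheory Set

/-- Integrated forms of the delay equation are proved by differentiating on `t > 1`, where `ρ`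
satisfies it, and comparing values at `t = 1`. -/
lemma eq_left_of_hasDerivAt_zero {g : ℝ → ℝ} {a : ℝ} (hc : ContinuousOn g (Ici a))
    (hd : ∀ t > a, HasDerivAt g 0 t) {t : ℝ} (ht : a ≤ t) : g t = g a := by
  have hdo : DifferentiableOn ℝ g (interior (Ici a)) := fun x hx => by
    rw [interior_Ici] at hx
    exact (hd x hx).differentiableAt.differentiableWithinAt
  refine le_antisymm ?_ ?_
  · refine antitoneOn_of_deriv_nonpos (convex_Ici a) hc hdo (fun x hx => ?_) self_mem_Ici ht ht
    rw [interior_Ici] at hx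
    rw [(hd x hx).deriv]
  · refine monotoneOn_of_deriv_nonneg (convex_Ici a) hc hdo (fun x hx => ?_) self_mem_Ici ht ht
    rw [interior_Ici] at hx
    rw [(hd x hx).deriv]

lemma hasDerivAt_integral_of_continuous {f : ℝ → ℝ} (hf : Continuous f) (a t : ℝ) :
    HasDerivAt (fun x => ∫ s in a..x, f s) (f t) t :=
  intervalIntegral.integral_hasDerivAt_right (hf.intervalIntegrable _ _)
    (hf.stronglyMeasurableAtFilter _ _) hf.continuousAt

/-- The integral form `t ρ(t) = ∫_{t-1}^t ρ` of the delay equation. -/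
lemma mul_dickman_eq_integral {t : ℝ} (ht : 1 ≤ t) :
    t * dickman t = ∫ s in (t - 1)..t, dickman s := by
  have hc := continuous_dickman
  have hmom : ∀ a b : ℝ, IntervalIntegrable dickman volume a b := hc.intervalIntegrable
  have hP : Continuous (fun x => ∫ s in (0 : ℝ)..x, dickman s) :=
    intervalIntegral.continuous_primitive hmom 0
  have hg := eq_left_of_hasDerivAt_zero (a := 1) (t := t)
    (g := fun t => t * dickman t
      - ((∫ s in (0 : ℝ)..t, dickman s) - ∫ s in (0 : ℝ)..(t - 1), dickman s))
    (by fun_prop)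
    (fun t ht => by
      have h1 := (hasDerivAt_id t).mul (hasDerivAt_dickman ht)
      have h2 := hasDerivAt_integral_of_continuous hc 0 t
      have h3 := (hasDerivAt_integral_of_continuous hc 0 (t - 1)).comp_sub_const t 1
      refine (h1.sub (h2.sub h3)).congr_deriv ?_
      have : t ≠ 0 := by linarith
      simp only [id]
      field_simp
      ring) ht
  have h1 : ∫ s in (0 : ℝ)..1, dickman s = 1 := by
    rw [intervalIntegral.integral_congr (g := fun _ => (1 : ℝ))]
    · simp
    · intro s hs
      rw [uIcc_of_le zero_le_one] at hs
      exact dickman_of_le_one hs.2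
  simp only [sub_self, intervalIntegral.integral_same, h1, dickman_of_le_one le_rfl] at hg
  rw [intervalIntegral.integral_interval_sub_left (hmom _ _) (hmom _ _)] at hg
  linarith

/-- At a first point `t₀` with `ρ(t₀) ≤ 0`, the quantity `t₀ ρ(t₀)` would be the integral of a
positive function over `(t₀ - 1, t₀)`. -/
lemma dickman_pos (t : ℝ) : 0 < dickman t := by
  by_contra hcon
  set A := {t : ℝ | dickman t ≤ 0}
  have hA : IsClosed A := isClosed_le continuous_dickman continuous_const
  have hne : A.Nonempty := ⟨t, not_lt.mp hcon⟩
  have hlb : ∀ x ∈ A, 1 < x := fun x hx => by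
    by_contra! h
    have : dickman x ≤ 0 := hx
    rw [dickman_of_le_one h] at this
    linarith
  have hbdd : BddBelow A := ⟨1, fun x hx => (hlb x hx).le⟩
  have hmem := hA.csInf_mem hne hbdd
  set t₀ := sInf A
  have ht₀ := hlb t₀ hmem
  have hpos : 0 < ∫ s in (t₀ - 1)..t₀, dickman s := by
    refine intervalIntegral.intervalIntegral_pos_of_pos_on
      (continuous_dickman.intervalIntegrable _ _) (fun s hs => ?_) (by linarith)
    by_contra! h
    exact absurd (csInf_le hbdd h) (not_le.mpr hs.2)
  rw [← mul_dickman_eq_integral ht₀.le] at hpos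
  have h2 : dickman t₀ ≤ 0 := hmem
  nlinarith

lemma antitone_dickman : Antitone dickman := by
  have h1 : AntitoneOn dickman (Ici 1) := by
    refine antitoneOn_of_deriv_nonpos (convex_Ici 1) continuous_dickman.continuousOn ?_ ?_
    · intro x hx
      rw [interior_Ici] at hx
      exact (hasDerivAt_dickman hx).differentiableAt.differentiableWithinAt
    · intro x hx
      rw [interior_Ici] at hx
      have hx' : 1 < x := hx
      rw [(hasDerivAt_dickman hx).deriv]
      exact div_nonpos_of_nonpos_of_nonneg (by linarith [dickman_pos (x - 1)]) (by linarith)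
  intro a b hab
  rcases le_total b 1 with hb | hb
  · rw [dickman_of_le_one hb, dickman_of_le_one (hab.trans hb)]
  · rcases le_total a 1 with ha | ha
    · rw [dickman_of_le_one ha, ← dickman_of_le_one le_rfl]
      exact h1 self_mem_Ici hb hb
    · exact h1 ha hb hab

lemma dickman_le_one (t : ℝ) : dickman t ≤ 1 := by
  have := antitone_dickman (min_le_left t 1)
  rwa [dickman_of_le_one (min_le_right t 1)] at this

/-- `ρ` decays faster than every exponential. -/
lemma exists_dickman_mul_exp_le (A : ℝ) : ∃ C, ∀ t ≥ 0, dickman t * Real.exp (A * t) ≤ C := by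
  wlog hA : 0 ≤ A generalizing A
  · obtain ⟨C, hC⟩ := this 0 le_rfl
    refine ⟨C, fun t ht => le_trans ?_ (hC t ht)⟩
    have := (dickman_pos t).le
    gcongr
    exact (not_le.mp hA).le
  -- For `t ≥ T` one delay step gives `ρ(t) ≤ ρ(t - 1) / T`, which exactly compensates the growth of
  -- `e^(At)` over a unit interval.
  set T := Real.exp A with hT
  have hT1 : 1 ≤ T := Real.one_le_exp hA
  have key : ∀ n : ℕ, ∀ t ≥ 0, t ≤ T + n → dickman t * Real.exp (A * t) ≤ Real.exp (A * T) := by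
    intro n
    induction n with
    | zero =>
      intro t ht htT
      calc dickman t * Real.exp (A * t) ≤ 1 * Real.exp (A * T) := by
            have := dickman_le_one t
            gcongr
            simpa using htT
        _ = _ := one_mul _
    | succ n ih =>
      intro t ht htn
      rcases le_total t T with h | h
      · exact ih t ht (h.trans (by simp))
      have h1 : 1 ≤ t := hT1.trans h
      refine le_trans ?_ (ih (t - 1) (by linarith) (by push_cast at htn; linarith))
      have h2 : T * dickman t ≤ dickman (t - 1) := by
        calc T * dickman t ≤ t * dickman t := by
              have := (dickman_pos t).le
              gcongr
          _ = ∫ s in (t - 1)..t, dickman s := mul_dickman_eq_integral h1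
          _ ≤ ∫ _ in (t - 1)..t, dickman (t - 1) :=
              intervalIntegral.integral_mono_on (by linarith)
                (continuous_dickman.intervalIntegrable _ _) (by simp)
                fun s hs => antitone_dickman hs.1
          _ = dickman (t - 1) := by simp
      calc dickman t * Real.exp (A * t) = T * dickman t * Real.exp (A * (t - 1)) := by
            rw [show A * t = A + A * (t - 1) by ring, Real.exp_add, ← hT]; ring
        _ ≤ _ := by gcongr
  refine ⟨Real.exp (A * T), fun t ht => ?_⟩
  obtain ⟨n, hn⟩ := exists_nat_gt t
  exact key n t ht (by linarith)

/-- The Laplace transform `∫_0^∞ ρ(v) e ^ (s v) dv`. -/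
noncomputable def dickmanLaplace (s : ℝ) : ℝ := ∫ v in Ioi (0 : ℝ), dickman v * Real.exp (s * v)

lemma integrableOn_dickman_mul_exp (s : ℝ) :
    IntegrableOn (fun v => dickman v * Real.exp (s * v)) (Ioi 0) := by
  obtain ⟨C, hC⟩ := exists_dickman_mul_exp_le (s + 1)
  refine integrableOn_mul_exp_of_bound continuous_dickman.measurable (C := C) (K := -(s + 1))
    (fun t ht => ?_) (by linarith)
  rw [abs_of_pos (dickman_pos t), neg_mul, Real.exp_neg, ← div_eq_mul_inv,
    le_div_iff₀ (Real.exp_pos _)]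
  exact hC t ht.le

lemma dickmanLaplace_pos (s : ℝ) : 0 < dickmanLaplace s := by
  rw [dickmanLaplace, setIntegral_pos_iff_support_of_nonneg_ae]
  · have : (Function.support fun v => dickman v * Real.exp (s * v)) = univ :=
      eq_univ_of_forall fun v => (mul_pos (dickman_pos v) (Real.exp_pos _)).ne'
    rw [this, univ_inter]
    simp
  · exact ae_of_all _ fun v => (mul_pos (dickman_pos v) (Real.exp_pos _)).le
  · exact integrableOn_dickman_mul_exp s

/-- Since `ρ` has finite exponential moments of every order, its transform is a moment generating
function that can be differentiated under the integral everywhere. -/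
lemma hasDerivAt_dickmanLaplace (s : ℝ) :
    HasDerivAt dickmanLaplace (∫ v in Ioi (0 : ℝ), v * (dickman v * Real.exp (s * v))) s ∧
      IntegrableOn (fun v => v * (dickman v * Real.exp (s * v))) (Ioi 0) := by
  have hm := continuous_dickman.measurable
  have hmax : ∀ v, max (dickman v) 0 = dickman v := fun v => max_eq_left (dickman_pos v).le
  have huniv : integrableExpSet id (laplaceMeasure dickman) = univ := eq_univ_of_forall fun τ => by
    rw [mem_integrableExpSet_laplaceMeasure hm]
    simpa only [hmax] using integrableOn_dickman_mul_exp τ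
  have hL : dickmanLaplace = mgf id (laplaceMeasure dickman) := by
    funext τ
    rw [mgf_laplaceMeasure hm, dickmanLaplace]
    simp only [hmax]
  have hs : s ∈ interior (integrableExpSet id (laplaceMeasure dickman)) := by
    rw [huniv, interior_univ]; trivial
  have h := hasDerivAt_mgf hs
  have hi := integrable_pow_mul_exp_of_mem_interior_integrableExpSet hs 1
  rw [← hL] at h
  simp only [laplaceMeasure, id, pow_one] at h hi
  rw [integral_withDensity_eq_integral_toReal_smul (by fun_prop)
    (ae_of_all _ fun _ => ENNReal.ofReal_lt_top)] at h
  rw [integrable_withDensity_iff (by fun_prop)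
    (ae_of_all _ fun _ => ENNReal.ofReal_lt_top)] at hi
  simp only [ENNReal.toReal_ofReal', hmax, smul_eq_mul] at h hi
  refine ⟨h.congr_deriv ?_, hi.congr ?_⟩
  · refine integral_congr_ae (ae_of_all _ fun v => ?_)
    simp only; ring
  · refine ae_of_all _ fun v => ?_
    simp only; ring

/-- Integration by parts for the truncated transform. -/
lemma mul_integral_mul_dickman (s : ℝ) {U : ℝ} (hU : 1 ≤ U) :
    s * ∫ v in (0 : ℝ)..U, v * (dickman v * Real.exp (s * v))
      = U * dickman U * Real.exp (s * U) - (∫ v in (0 : ℝ)..U, dickman v * Real.exp (s * v))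
        + Real.exp s * ∫ v in (0 : ℝ)..(U - 1), dickman v * Real.exp (s * v) := by
  have hc := continuous_dickman
  have hc1 : Continuous (fun v => dickman v * Real.exp (s * v)) := by fun_prop
  have hc2 : Continuous (fun v => v * (dickman v * Real.exp (s * v))) := by fun_prop
  have hP1 : Continuous (fun x => ∫ v in (0 : ℝ)..x, dickman v * Real.exp (s * v)) :=
    intervalIntegral.continuous_primitive hc1.intervalIntegrable 0
  have hP2 : Continuous (fun x => ∫ v in (0 : ℝ)..x, v * (dickman v * Real.exp (s * v))) :=
    intervalIntegral.continuous_primitive hc2.intervalIntegrable 0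
  have hg := eq_left_of_hasDerivAt_zero (a := 1) (t := U)
    (g := fun U => s * (∫ v in (0 : ℝ)..U, v * (dickman v * Real.exp (s * v)))
      - U * dickman U * Real.exp (s * U) + (∫ v in (0 : ℝ)..U, dickman v * Real.exp (s * v))
        - Real.exp s * ∫ v in (0 : ℝ)..(U - 1), dickman v * Real.exp (s * v))
    (by fun_prop)
    (fun t ht => by
      have h1 := (hasDerivAt_integral_of_continuous hc2 0 t).const_mul s
      have he : HasDerivAt (fun t => Real.exp (s * t)) (Real.exp (s * t) * (s * 1)) t :=
        ((hasDerivAt_id t).const_mul s).exp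
      have h2 := ((hasDerivAt_id t).mul (hasDerivAt_dickman ht)).mul he
      have h3 := hasDerivAt_integral_of_continuous hc1 0 t
      have h4 := ((hasDerivAt_integral_of_continuous hc1 0 (t - 1)).comp_sub_const t 1).const_mul
        (Real.exp s)
      refine (((h1.sub h2).add h3).sub h4).congr_deriv ?_
      have : t ≠ 0 := by linarith
      have h5 : Real.exp (s * t) = Real.exp s * Real.exp (s * (t - 1)) := by
        rw [← Real.exp_add]; ring_nf
      simp only [id, Pi.mul_apply]
      rw [h5]
      field_simp
      ring) hU
  have h1 : s * (∫ v in (0 : ℝ)..1, v * (dickman v * Real.exp (s * v)))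
      - 1 * dickman 1 * Real.exp (s * 1)
      + (∫ v in (0 : ℝ)..1, dickman v * Real.exp (s * v)) = 0 := by
    have h2 : ∫ v in (0 : ℝ)..1, (s * (v * (dickman v * Real.exp (s * v)))
        + dickman v * Real.exp (s * v)) = Real.exp s := by
      rw [intervalIntegral.integral_congr (g := fun v => 1 * Real.exp (s * v)
        + v * (Real.exp (s * v) * (s * 1)))]
      · rw [intervalIntegral.integral_eq_sub_of_hasDerivAt
          (f := fun v => v * Real.exp (s * v))]
        · simp
        · intro v _
          exact (hasDerivAt_id v).mul ((hasDerivAt_id v).const_mul s).exp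
        · exact Continuous.intervalIntegrable (by fun_prop) _ _
      · intro v hv
        rw [uIcc_of_le zero_le_one] at hv
        simp only [dickman_of_le_one hv.2]
        ring
    rw [intervalIntegral.integral_add ((hc2.intervalIntegrable _ _).const_mul s)
      (hc1.intervalIntegrable _ _), intervalIntegral.integral_const_mul] at h2
    rw [dickman_of_le_one le_rfl]
    simp only [mul_one]
    linarith
  simp only [sub_self, intervalIntegral.integral_same, mul_zero, sub_zero] at hg
  rw [h1] at hg
  linarith

/-- This is the differential equation `s L'(s) = (e^s - 1) L(s)`, the limit of the truncated
integration by parts as the boundary term tends to 0. -/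
lemma mul_integral_Ioi_mul_dickman (s : ℝ) :
    s * ∫ v in Ioi (0 : ℝ), v * (dickman v * Real.exp (s * v))
      = (Real.exp s - 1) * dickmanLaplace s := by
  have hL := intervalIntegral_tendsto_integral_Ioi 0 (integrableOn_dickman_mul_exp s) tendsto_id
  have hL1 := intervalIntegral_tendsto_integral_Ioi 0 (integrableOn_dickman_mul_exp s)
    (tendsto_atTop_add_const_right atTop (-1 : ℝ) tendsto_id)
  have hL' := intervalIntegral_tendsto_integral_Ioi 0 (hasDerivAt_dickmanLaplace s).2 tendsto_id
  have hz : Tendsto (fun U => U * dickman U * Real.exp (s * U)) atTop (𝓝 0) := by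
    obtain ⟨C, hC⟩ := exists_dickman_mul_exp_le (s + 1)
    have ht : Tendsto (fun U : ℝ => C * (U ^ 1 * Real.exp (-U))) atTop (𝓝 (C * 0)) :=
      (Real.tendsto_pow_mul_exp_neg_atTop_nhds_zero 1).const_mul C
    rw [mul_zero] at ht
    refine tendsto_of_tendsto_of_tendsto_of_le_of_le' tendsto_const_nhds ht ?_ ?_
    · filter_upwards [eventually_ge_atTop 0] with U hU
      have := dickman_pos U
      positivity
    · filter_upwards [eventually_ge_atTop 0] with U hU
      have h1 := hC U hU
      rw [add_mul, one_mul, Real.exp_add, ← mul_assoc] at h1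
      have h2 : dickman U * Real.exp (s * U) ≤ C * Real.exp (-U) := by
        rw [Real.exp_neg, ← div_eq_mul_inv, le_div_iff₀ (Real.exp_pos _)]
        exact h1
      calc U * dickman U * Real.exp (s * U) = U * (dickman U * Real.exp (s * U)) := by ring
        _ ≤ U * (C * Real.exp (-U)) := by gcongr
        _ = _ := by ring
  have h1 := hL'.const_mul s
  have h2 := (hz.sub hL).add (hL1.const_mul (Real.exp s))
  have h3 := tendsto_nhds_unique (h1.congr' ?_) h2
  · rw [h3, dickmanLaplace]
    ring
  · filter_upwards [eventually_ge_atTop 1] with U hU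
    simpa [sub_eq_add_neg] using mul_integral_mul_dickman s hU

/-- The Laplace transform of `ρ` is `L(0) exp (∫_0^s (e ^ t - 1) / t dt)`. -/
lemma dickmanLaplace_eq {s : ℝ} (hs : 0 ≤ s) :
    dickmanLaplace s = dickmanLaplace 0 * Real.exp (expQuotInt s) := by
  have hd : ∀ s, HasDerivAt (fun s => dickmanLaplace s * Real.exp (-expQuotInt s)) _ s := fun s =>
    (hasDerivAt_dickmanLaplace s).1.mul (hasDerivAt_expQuotInt s).neg.exp
  have h := eq_left_of_hasDerivAt_zero (a := 0) (t := s)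
    (g := fun s => dickmanLaplace s * Real.exp (-expQuotInt s))
    (fun s _ => (hd s).continuousAt.continuousWithinAt)
    (fun t ht => by
      refine (hd t).congr_deriv ?_
      have h1 := mul_integral_Ioi_mul_dickman t
      rw [← mul_expQuot, mul_assoc] at h1
      rw [mul_left_cancel₀ (ne_of_gt ht) h1, Pi.neg_apply]
      ring) hs
  simp only [expQuotInt_zero, neg_zero, Real.exp_zero, mul_one] at h
  rw [← h, mul_assoc, ← Real.exp_add, neg_add_cancel, Real.exp_zero, mul_one]

end Dickman

/-! ### Upper and lower saddle point bounds for the Dickman function -/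

section DickmanBounds

open MeasureTheory Set

/-- As `ρ` decreases, its transform over the unit interval `(u - 1, u]` alone already exceeds `ρ(u)
e^(s(u - 1))`. No relation between `u` and `s` is needed. -/
lemma dickman_mul_exp_le {u s : ℝ} (hu : 1 ≤ u) (hs : 0 ≤ s) :
    dickman u * Real.exp (s * (u - 1)) ≤ dickmanLaplace 0 * Real.exp (expQuotInt s) := by
  rw [← dickmanLaplace_eq hs, dickmanLaplace]
  have hsub : Ioc (u - 1) u ⊆ Ioi (0 : ℝ) := fun v hv => lt_of_le_of_lt (by linarith) hv.1
  calc dickman u * Real.exp (s * (u - 1))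
      = ∫ _ in Ioc (u - 1) u, dickman u * Real.exp (s * (u - 1)) := by
        simp
    _ ≤ ∫ v in Ioc (u - 1) u, dickman v * Real.exp (s * v) := by
        refine setIntegral_mono_on
          (continuous_const.integrableOn_Icc.mono_set Ioc_subset_Icc_self) ((integrableOn_dickman_mul_exp s).mono_set hsub)
          measurableSet_Ioc fun v hv => ?_
        have := dickman_pos v
        have := antitone_dickman hv.2
        have := hv.1.le
        gcongr
    _ ≤ _ := setIntegral_mono_set (integrableOn_dickman_mul_exp s)
        (ae_of_all _ fun v => (mul_pos (dickman_pos v) (Real.exp_pos _)).le) hsub.eventuallyLE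

/-- One step of the delay equation for `ρ(v) e ^ (s v)`. -/
lemma mul_dickman_mul_exp_le {s v K : ℝ} (hv : 1 ≤ v)
    (hK : ∀ w, v - 1 ≤ w → w ≤ v - 1 / 2 → dickman w * Real.exp (s * w) ≤ K) :
    v * (dickman v * Real.exp (s * v)) ≤ (expQuot s + Real.exp (s / 2)) * K := by
  have hK0 : 0 ≤ K := le_trans (mul_pos (dickman_pos _) (Real.exp_pos _)).le
    (hK (v - 1) le_rfl (by linarith))
  have hmom : ∀ a b : ℝ, IntervalIntegrable dickman volume a b :=
    continuous_dickman.intervalIntegrable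
  -- Splitting at `v - 1/2` keeps every sampled argument at distance at least `1/2` below `v`, which
  -- makes an induction possible. The upper half is estimated by monotonicity at the cost of
  -- `e^(s/2)`, which is small against `expQuot s` for large `s`.
  have h1 : v * dickman v = (∫ w in (v - 1)..(v - 1 / 2), dickman w)
      + ∫ w in (v - 1 / 2)..v, dickman w := by
    rw [mul_dickman_eq_integral hv, intervalIntegral.integral_add_adjacent_intervals
      (hmom _ _) (hmom _ _)]
  have h2 : ∫ w in (v - 1 / 2)..v, dickman w ≤ dickman (v - 1 / 2) := by
    calc ∫ w in (v - 1 / 2)..v, dickman w ≤ ∫ _ in (v - 1 / 2)..v, dickman (v - 1 / 2) :=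
          intervalIntegral.integral_mono_on (by linarith) (hmom _ _) (by simp)
            fun w hw => antitone_dickman hw.1
      _ = 1 / 2 * dickman (v - 1 / 2) := by simp
      _ ≤ _ := by linarith [dickman_pos (v - 1 / 2)]
  have h3 : dickman (v - 1 / 2) * Real.exp (s * v) ≤ Real.exp (s / 2) * K := by
    calc dickman (v - 1 / 2) * Real.exp (s * v)
        = Real.exp (s / 2) * (dickman (v - 1 / 2) * Real.exp (s * (v - 1 / 2))) := by
          rw [show s * v = s / 2 + s * (v - 1 / 2) by ring, Real.exp_add]; ring
      _ ≤ _ := by gcongr; exact hK _ (by linarith) le_rfl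
  have h4 : (∫ w in (v - 1)..(v - 1 / 2), dickman w) * Real.exp (s * v) ≤ expQuot s * K := by
    rw [← intervalIntegral.integral_mul_const]
    calc ∫ w in (v - 1)..(v - 1 / 2), dickman w * Real.exp (s * v)
        ≤ ∫ w in (v - 1)..(v - 1 / 2), K * Real.exp ((v - w) * s) := by
          refine intervalIntegral.integral_mono_on (by linarith) ((hmom _ _).mul_const _)
            (Continuous.intervalIntegrable (by fun_prop) _ _) fun w hw => ?_
          rw [show s * v = s * w + (v - w) * s by ring, Real.exp_add, ← mul_assoc]
          gcongr
          exact hK w hw.1 hw.2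
      _ = K * ∫ r in (1 / 2 : ℝ)..1, Real.exp (r * s) := by
          rw [intervalIntegral.integral_const_mul, intervalIntegral.integral_comp_sub_left
            (fun r => Real.exp (r * s)) v]
          congr 2 <;> ring
      _ ≤ K * expQuot s := by
          refine mul_le_mul_of_nonneg_left ?_ hK0
          rw [expQuot]
          refine intervalIntegral.integral_mono_interval (by norm_num) (by norm_num) le_rfl
            (ae_of_all _ fun r => (Real.exp_pos _).le)
            (Continuous.intervalIntegrable (by fun_prop) _ _)
      _ = expQuot s * K := mul_comm _ _
  have h5 := mul_le_mul_of_nonneg_right h2 (Real.exp_pos (s * v)).le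
  calc v * (dickman v * Real.exp (s * v)) = (v * dickman v) * Real.exp (s * v) := by ring
    _ = (∫ w in (v - 1)..(v - 1 / 2), dickman w) * Real.exp (s * v)
        + (∫ w in (v - 1 / 2)..v, dickman w) * Real.exp (s * v) := by rw [h1]; ring
    _ ≤ _ := by linarith

/-- Monotonicity of `ρ` alone would lose an exponential in the length of the window. Each half step
of the delay equation loses only the ratio raised to the power `j`, which is close to 1 when `u` is
near `expQuot s`. -/
lemma dickman_mul_exp_le_pow {s u : ℝ} (hs : 0 ≤ s) (hu : 1 ≤ u) (hus : u ≤ expQuot s) (j : ℕ) :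
    ∀ v, u ≤ v → v ≤ u + 1 + j / 2 → dickman v * Real.exp (s * v)
      ≤ ((expQuot s + Real.exp (s / 2)) / u) ^ j * (dickman u * Real.exp (s * (u + 1))) := by
  have hu0 : 0 < u := by linarith
  have hr : 1 ≤ (expQuot s + Real.exp (s / 2)) / u := by
    rw [le_div_iff₀ hu0]; linarith [Real.exp_pos (s / 2)]
  set r := (expQuot s + Real.exp (s / 2)) / u with hrdef
  have hK : 0 < dickman u * Real.exp (s * (u + 1)) := mul_pos (dickman_pos _) (Real.exp_pos _)
  induction j with
  | zero =>
    intro v hv hv'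
    have := antitone_dickman hv
    have := dickman_pos u
    simp only [Nat.cast_zero, zero_div, add_zero] at hv'
    rw [pow_zero, one_mul]
    gcongr
  | succ j ih =>
    intro v hv hv'
    push_cast at hv'
    rcases le_total v (u + 1 + j / 2) with h | h
    · refine (ih v hv h).trans (mul_le_mul_of_nonneg_right ?_ hK.le)
      exact pow_le_pow_right₀ hr (Nat.le_succ j)
    · have hj : (0 : ℝ) ≤ j / 2 := by positivity
      have h1 := mul_dickman_mul_exp_le (by linarith : 1 ≤ v) (K := r ^ j *
        (dickman u * Real.exp (s * (u + 1)))) (fun w hw hw' => ih w (by linarith) (by linarith))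
      have h2 : u * (dickman v * Real.exp (s * v)) ≤ v * (dickman v * Real.exp (s * v)) :=
        mul_le_mul_of_nonneg_right hv (mul_pos (dickman_pos _) (Real.exp_pos _)).le
      have h3 : dickman v * Real.exp (s * v) ≤ (expQuot s + Real.exp (s / 2)) *
          (r ^ j * (dickman u * Real.exp (s * (u + 1)))) / u := by
        rw [le_div_iff₀ hu0]; linarith
      refine h3.trans (le_of_eq ?_)
      rw [pow_succ, hrdef]
      ring

/-- A lower bound for `ρ` at the saddle point, with free parameters. -/
lemma dickmanLaplace_mul_exp_le {s δ : ℝ} {j : ℕ} (hs : 0 ≤ s) (hδ : 0 < δ)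
    (h1 : 2 ≤ δ / 2 * (expQuot (s + δ / 2) - expQuot s))
    (h2 : expQuot (s + 2 * δ) + 2 / δ ≤ expQuot s + 1 + j / 2) :
    1 / 2 * dickmanLaplace 0 * Real.exp (expQuotInt s - expQuot s * s) ≤
      (1 + j / 2) * ((expQuot (s + δ) + Real.exp ((s + δ) / 2)) / expQuot s) ^ j
        * Real.exp (s + δ) * dickman (expQuot s) := by
  set u := expQuot s with hu
  have hu1 : 1 ≤ u := one_le_expQuot hs
  set V := u + 1 + (j : ℝ) / 2 with hV
  have hj : (0 : ℝ) ≤ j / 2 := by positivity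
  have hI := integrableOn_dickman_mul_exp (s + δ)
  have hpos : ∀ t v : ℝ, 0 < dickman v * Real.exp (t * v) := fun t v =>
    mul_pos (dickman_pos _) (Real.exp_pos _)
  set L₀ := dickmanLaplace 0 with hL₀
  have hL₀pos : 0 < L₀ := dickmanLaplace_pos 0
  have he2 : Real.exp (-2) ≤ 1 / 4 := by
    rw [Real.exp_neg, inv_le_comm₀ (Real.exp_pos _) (by norm_num)]
    have := Real.add_one_le_exp (1 : ℝ)
    rw [show (2 : ℝ) = 1 + 1 by norm_num, Real.exp_add]
    nlinarith
  have hLs : dickmanLaplace (s + δ) = L₀ * Real.exp (expQuotInt (s + δ)) :=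
    dickmanLaplace_eq (by linarith)
  -- Chernoff bound with the smaller exponent `s + δ/2`; convexity of `expQuotInt` and `h1` make the
  -- loss at least `e^2 > 4`.
  have htail1 : ∫ v in Ioc 0 u, dickman v * Real.exp ((s + δ) * v)
      ≤ 1 / 4 * dickmanLaplace (s + δ) := by
    have hIβ := integrableOn_dickman_mul_exp (s + δ / 2)
    calc ∫ v in Ioc 0 u, dickman v * Real.exp ((s + δ) * v)
        ≤ ∫ v in Ioc 0 u, Real.exp (δ / 2 * u) * (dickman v * Real.exp ((s + δ / 2) * v)) := by
          refine setIntegral_mono_on (hI.mono_set Ioc_subset_Ioi_self)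
            ((hIβ.mono_set Ioc_subset_Ioi_self).const_mul _) measurableSet_Ioc fun v hv => ?_
          rw [show (s + δ) * v = δ / 2 * v + (s + δ / 2) * v by ring, Real.exp_add, mul_left_comm]
          have := (hpos (s + δ / 2) v).le
          have := hv.2
          gcongr
      _ ≤ Real.exp (δ / 2 * u) * dickmanLaplace (s + δ / 2) := by
          rw [integral_const_mul]
          refine mul_le_mul_of_nonneg_left ?_ (Real.exp_pos _).le
          exact setIntegral_mono_set hIβ (ae_of_all _ fun v => (hpos _ v).le)
            Ioc_subset_Ioi_self.eventuallyLE
      _ = L₀ * Real.exp (δ / 2 * u + expQuotInt (s + δ / 2)) := by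
          rw [dickmanLaplace_eq (by linarith), Real.exp_add]; ring
      _ ≤ L₀ * Real.exp (-2 + expQuotInt (s + δ)) := by
          have := mul_expQuot_le_expQuotInt_sub (s + δ / 2) (s + δ)
          rw [show s + δ - (s + δ / 2) = δ / 2 by ring] at this
          exact mul_le_mul_of_nonneg_left (Real.exp_le_exp.mpr (by linarith)) hL₀pos.le
      _ ≤ 1 / 4 * dickmanLaplace (s + δ) := by
          rw [hLs, Real.exp_add]
          have := Real.exp_pos (expQuotInt (s + δ))
          nlinarith [mul_pos hL₀pos this]
  -- Chernoff bound with the larger exponent `s + 2δ`; `h2` says that `V` exceeds the mean at that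
  -- exponent by at least `2/δ`.
  have htail2 : ∫ v in Ioi V, dickman v * Real.exp ((s + δ) * v)
      ≤ 1 / 4 * dickmanLaplace (s + δ) := by
    have hIβ := integrableOn_dickman_mul_exp (s + 2 * δ)
    have hsub : Ioi V ⊆ Ioi 0 := Ioi_subset_Ioi (by linarith)
    calc ∫ v in Ioi V, dickman v * Real.exp ((s + δ) * v)
        ≤ ∫ v in Ioi V, Real.exp (-(δ * V)) * (dickman v * Real.exp ((s + 2 * δ) * v)) := by
          refine setIntegral_mono_on (hI.mono_set hsub)
            ((hIβ.mono_set hsub).const_mul _) measurableSet_Ioi fun v hv => ?_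
          rw [show (s + δ) * v = -(δ * v) + (s + 2 * δ) * v by ring, Real.exp_add, mul_left_comm]
          have := (hpos (s + 2 * δ) v).le
          have : V ≤ v := (mem_Ioi.mp hv).le
          gcongr
      _ ≤ Real.exp (-(δ * V)) * dickmanLaplace (s + 2 * δ) := by
          rw [integral_const_mul]
          refine mul_le_mul_of_nonneg_left ?_ (Real.exp_pos _).le
          exact setIntegral_mono_set hIβ (ae_of_all _ fun v => (hpos _ v).le)
            hsub.eventuallyLE
      _ = L₀ * Real.exp (-(δ * V) + expQuotInt (s + 2 * δ)) := by
          rw [dickmanLaplace_eq (by linarith), Real.exp_add]; ring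
      _ ≤ L₀ * Real.exp (-2 + expQuotInt (s + δ)) := by
          have h3 := mul_expQuot_le_expQuotInt_sub (s + 2 * δ) (s + δ)
          have h4 : δ * (expQuot (s + 2 * δ) + 2 / δ) ≤ δ * V := by gcongr
          rw [mul_add, mul_div_cancel₀ _ hδ.ne'] at h4
          rw [show s + δ - (s + 2 * δ) = -δ by ring] at h3
          exact mul_le_mul_of_nonneg_left (Real.exp_le_exp.mpr (by linarith)) hL₀pos.le
      _ ≤ 1 / 4 * dickmanLaplace (s + δ) := by
          rw [hLs, Real.exp_add]
          have := Real.exp_pos (expQuotInt (s + δ))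
          nlinarith [mul_pos hL₀pos this]
  have hsplit : dickmanLaplace (s + δ) = (∫ v in Ioc 0 u, dickman v * Real.exp ((s + δ) * v))
      + (∫ v in Ioc u V, dickman v * Real.exp ((s + δ) * v))
      + ∫ v in Ioi V, dickman v * Real.exp ((s + δ) * v) := by
    have e1 : Ioi (0 : ℝ) = Ioc 0 V ∪ Ioi V := (Ioc_union_Ioi_eq_Ioi (by linarith)).symm
    have e2 : Ioc (0 : ℝ) V = Ioc 0 u ∪ Ioc u V :=
      (Ioc_union_Ioc_eq_Ioc (by linarith) (by linarith)).symm
    rw [dickmanLaplace, e1, setIntegral_union Ioc_disjoint_Ioi_same measurableSet_Ioi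
      (hI.mono_set Ioc_subset_Ioi_self) (hI.mono_set (Ioi_subset_Ioi (by linarith))), e2,
      setIntegral_union (Ioc_disjoint_Ioc_of_le le_rfl) measurableSet_Ioc
      (hI.mono_set Ioc_subset_Ioi_self)
      (hI.mono_set (Ioc_subset_Ioi_self.trans (Ioi_subset_Ioi (by linarith))))]
  set r := (expQuot (s + δ) + Real.exp ((s + δ) / 2)) / u with hr
  -- Half of the mass remains in `(u, V]`, and all of it is controlled by the value of `ρ` at the
  -- left end `u`.
  have hmid : ∫ v in Ioc u V, dickman v * Real.exp ((s + δ) * v)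
      ≤ (1 + j / 2) * (r ^ j * (dickman u * Real.exp ((s + δ) * (u + 1)))) := by
    calc _ ≤ ∫ _ in Ioc u V, r ^ j * (dickman u * Real.exp ((s + δ) * (u + 1))) := by
          refine setIntegral_mono_on
            (hI.mono_set (Ioc_subset_Ioi_self.trans (Ioi_subset_Ioi (by linarith))))
            (continuous_const.integrableOn_Icc.mono_set Ioc_subset_Icc_self)
            measurableSet_Ioc fun v hv => ?_
          exact dickman_mul_exp_le_pow (by linarith) hu1 (monotone_expQuot (by linarith)) j v
            hv.1.le hv.2
      _ = _ := by
          simp only [integral_const, smul_eq_mul, measureReal_restrict_apply, MeasurableSet.univ,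
            univ_inter, Real.volume_real_Ioc]
          rw [max_eq_left (by linarith)]
          congr 1
          rw [hV]; ring
  have hconv := mul_expQuot_le_expQuotInt_sub s (s + δ)
  have hfin : 1 / 2 * (L₀ * Real.exp (expQuotInt (s + δ)))
      ≤ (1 + j / 2) * (r ^ j * (dickman u * Real.exp ((s + δ) * (u + 1)))) := by
    rw [← hLs]; linarith
  have hexp : Real.exp (expQuotInt s - u * s) ≤
      Real.exp (expQuotInt (s + δ)) * Real.exp (-((s + δ) * u)) := by
    rw [← Real.exp_add]
    refine Real.exp_le_exp.mpr ?_
    rw [← hu] at hconv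
    nlinarith
  calc 1 / 2 * L₀ * Real.exp (expQuotInt s - u * s)
      ≤ 1 / 2 * L₀ * (Real.exp (expQuotInt (s + δ)) * Real.exp (-((s + δ) * u))) := by gcongr
    _ = 1 / 2 * (L₀ * Real.exp (expQuotInt (s + δ))) * Real.exp (-((s + δ) * u)) := by ring
    _ ≤ (1 + j / 2) * (r ^ j * (dickman u * Real.exp ((s + δ) * (u + 1))))
        * Real.exp (-((s + δ) * u)) := by gcongr
    _ = (1 + j / 2) * r ^ j * (Real.exp ((s + δ) * (u + 1)) * Real.exp (-((s + δ) * u)))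
        * dickman u := by ring
    _ = (1 + j / 2) * r ^ j * Real.exp (s + δ) * dickman u := by
        rw [← Real.exp_add]; ring_nf

lemma eventually_const_mul_le_exp (C : ℝ) {c : ℝ} (hc : 0 < c) :
    ∀ᶠ s : ℝ in atTop, C * s ≤ Real.exp (c * s) := by
  have h := (isLittleO_pow_exp_pos_mul_atTop 1 hc).bound (c := 1 / (|C| + 1)) (by positivity)
  filter_upwards [h, eventually_ge_atTop 0] with s hs hs0
  rw [pow_one, Real.norm_eq_abs, Real.norm_eq_abs, Real.abs_exp, abs_of_nonneg hs0, one_div,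
    inv_mul_eq_div, le_div_iff₀ (by positivity)] at hs
  nlinarith [le_abs_self C, abs_nonneg C]

lemma eventually_const_le_exp (C : ℝ) {c : ℝ} (hc : 0 < c) :
    ∀ᶠ s : ℝ in atTop, C ≤ Real.exp (c * s) := by
  filter_upwards [eventually_const_mul_le_exp |C| hc, eventually_ge_atTop 1] with s hs hs1
  nlinarith [le_abs_self C, abs_nonneg C]

/-- The derivative of `(e^t - 1) / t` has order `e^t / t`; the product formula `t * expQuot t = e^t
- 1` gives this without differentiating. -/
lemma le_expQuot_sub {s h : ℝ} (hs : 6 ≤ s) (hh : 0 ≤ h) (hh1 : h ≤ 1) :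
    h * Real.exp s / (2 * s) ≤ expQuot (s + h) - expQuot s := by
  have h1 := mul_expQuot s
  have h2 := mul_expQuot (s + h)
  have he := Real.exp_pos s
  have h3 : Real.exp s * (1 + h) ≤ Real.exp (s + h) := by
    rw [Real.exp_add]
    gcongr
    linarith [Real.add_one_le_exp h]
  have h4 : Real.exp (s + h) ≤ 3 * Real.exp s := by
    rw [Real.exp_add, mul_comm]
    gcongr
    exact (Real.exp_le_exp.mpr hh1).trans Real.exp_one_lt_three.le
  have h5 : expQuot (s + h) ≤ Real.exp s / 2 := by
    have h6 : 6 * expQuot (s + h) ≤ (s + h) * expQuot (s + h) :=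
      mul_le_mul_of_nonneg_right (by linarith) (expQuot_pos _).le
    linarith
  rw [div_le_iff₀ (by linarith)]
  nlinarith

/-- Lower bound for `ρ` at the saddle point `u = (e ^ s - 1) / s`. -/
theorem eventually_exp_le_dickman {η : ℝ} (hη : 0 < η) : ∀ᶠ s in atTop,
    Real.exp (expQuotInt s - expQuot s * s - Real.exp (η * s)) ≤ dickman (expQuot s) := by
  set L₀ := dickmanLaplace 0 with hL₀
  have hL₀pos : 0 < L₀ := dickmanLaplace_pos 0
  -- The bound `θ ≤ η/8` makes the final loss `e^(8θs)` at most `e^(ηs)`; `θ ≤ 1/8` keeps `δ` small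
  -- and the window shorter than a multiple of `e^s`.
  set θ := min (η / 8) (1 / 8) with hθ
  have hθ0 : 0 < θ := by positivity
  have hθη : 8 * θ ≤ η := by linarith [min_le_left (η / 8) (1 / 8)]
  have hθ1 : θ ≤ 1 / 8 := min_le_right _ _
  filter_upwards [eventually_ge_atTop 6,
    eventually_const_mul_le_exp 16 (show 0 < 2 * θ by linarith),
    eventually_const_le_exp 2 (show (0 : ℝ) < 1 / 4 by norm_num),
    eventually_const_mul_le_exp 204 (show 0 < 2 * θ by linarith),
    eventually_const_mul_le_exp (2 / 1) (show 0 < 4 * θ by linarith),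
    eventually_const_le_exp (Real.log (2 / L₀) + 4) (show 0 < 4 * θ by linarith),
    eventually_const_le_exp 3 (show 0 < 4 * θ by linarith)] with s hs6 he1 he2 he3 he4 he5 he6
  have hts0 : 0 ≤ θ * s := by positivity
  have hts1 : θ * s ≤ 1 / 8 * s := by gcongr
  have hts2 : 8 * θ * s ≤ η * s := by gcongr
  -- The tilted law of `v` has spread about `e^(s/2)` up to powers of `s`. A tilt `δ = X / e^s`
  -- moves its mean by about `X/s`, which dominates that spread; `X` is also the order of the window
  -- length.
  set X := Real.exp ((1 / 2 + θ) * s) with hX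
  have hX1 : 1 ≤ X := Real.one_le_exp (by positivity)
  set δ := Real.exp (-((1 / 2 - θ) * s)) with hδ
  have hδ0 : 0 < δ := Real.exp_pos _
  have hδX : δ * Real.exp s = X := by rw [hδ, hX, ← Real.exp_add]; ring_nf
  have hδhalf : δ ≤ 1 / 2 := by
    rw [hδ, Real.exp_neg, one_div]
    refine inv_anti₀ (by norm_num) (he2.trans (Real.exp_le_exp.mpr ?_))
    linarith
  have hδinv : 1 / δ ≤ X := by
    rw [hδ, Real.exp_neg, one_div, inv_inv]
    exact Real.exp_le_exp.mpr (by linarith)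
  have hes := Real.exp_pos s
  have he3' : Real.exp 1 ≤ 3 := Real.exp_one_lt_three.le
  have hexp : ∀ h ≤ 1, Real.exp (s + h) ≤ 3 * Real.exp s := fun h hh => by
    rw [Real.exp_add, mul_comm]
    gcongr
    exact (Real.exp_le_exp.mpr hh).trans he3'
  have h1 : 2 ≤ δ / 2 * (expQuot (s + δ / 2) - expQuot s) := by
    have h := le_expQuot_sub hs6 (by positivity : 0 ≤ δ / 2) (by linarith)
    refine le_trans ?_ (mul_le_mul_of_nonneg_left h (by positivity))
    have hδ2 : δ * X = Real.exp (2 * θ * s) := by rw [hδ, hX, ← Real.exp_add]; ring_nf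
    have : δ / 2 * (δ / 2 * Real.exp s / (2 * s)) = Real.exp (2 * θ * s) / (8 * s) := by
      rw [← hδ2, ← hδX]; field_simp; norm_num
    rw [this, le_div_iff₀ (by linarith)]
    linarith
  set T := expQuot (s + 2 * δ) - expQuot s + 2 / δ with hT
  have hT8 : T ≤ 8 * X := by
    have h := expQuot_sub_le (by linarith : 0 ≤ s) (by linarith : 0 ≤ 2 * δ)
    have h' := hexp (2 * δ) (by linarith)
    have h'' : 2 * δ * Real.exp (s + 2 * δ) ≤ 2 * δ * (3 * Real.exp s) := by gcongr
    have : 2 / δ ≤ 2 * X := by rw [← mul_one_div]; linarith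
    have : 2 * δ * (3 * Real.exp s) = 6 * X := by rw [← hδX]; ring
    linarith
  have hT0 : 0 ≤ T := by
    have := monotone_expQuot (by linarith : s ≤ s + 2 * δ)
    have : 0 ≤ 2 / δ := by positivity
    simp only [hT]; linarith
  set j := ⌈2 * T⌉₊ with hj
  have hj1 : 2 * T ≤ j := Nat.le_ceil _
  have hj2 : (j : ℝ) ≤ 17 * X := by
    have := (Nat.ceil_lt_add_one (by linarith : 0 ≤ 2 * T)).le
    linarith
  have hmain := dickmanLaplace_mul_exp_le (j := j) (by linarith) hδ0 h1 (by
    simp only [hT] at hj1; linarith)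
  set u := expQuot s with hu
  have hu1 : 1 ≤ u := one_le_expQuot (by linarith)
  have hulow : Real.exp s / (2 * s) ≤ u := by
    have := mul_expQuot s
    rw [← hu] at this
    rw [div_le_iff₀ (by linarith)]
    have : 2 ≤ Real.exp s := by linarith [Real.add_one_le_exp s]
    linarith
  set r := (expQuot (s + δ) + Real.exp ((s + δ) / 2)) / u with hr
  -- The numerator exceeds `u` by at most `6X`, and `u` is at least `e^s / (2s)`.
  have hr1 : r - 1 ≤ 12 * s * X / Real.exp s := by
    have h := expQuot_sub_le (by linarith : 0 ≤ s) hδ0.le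
    have h' : δ * Real.exp (s + δ) ≤ δ * (3 * Real.exp s) := by
      gcongr; exact hexp δ (by linarith)
    have h'' : Real.exp ((s + δ) / 2) ≤ 3 * X := by
      have e : Real.exp ((s + δ) / 2) ≤ Real.exp (1 + (1 / 2 + θ) * s) :=
        Real.exp_le_exp.mpr (by linarith)
      rw [Real.exp_add] at e
      exact e.trans (mul_le_mul_of_nonneg_right he3' (by linarith))
    have hnum : expQuot (s + δ) + Real.exp ((s + δ) / 2) - u ≤ 6 * X := by
      have : δ * (3 * Real.exp s) = 3 * X := by rw [← hδX]; ring
      linarith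
    have hu0 : 0 < u := by linarith
    have : r - 1 = (expQuot (s + δ) + Real.exp ((s + δ) / 2) - u) / u := by
      rw [hr]; field_simp
    rw [this, div_le_div_iff₀ hu0 hes]
    rw [div_le_iff₀ (by linarith)] at hulow
    calc _ ≤ 6 * X * Real.exp s := by gcongr
      _ ≤ 6 * X * (u * (2 * s)) := by gcongr
      _ = _ := by ring
  have hr0 : 0 ≤ r := by
    have := (expQuot_pos (s + δ)).le
    have := Real.exp_pos ((s + δ) / 2)
    positivity
  -- The exponent is at most `j (r - 1)`, and `17 X * 12 s X / e^s = 204 s e^(2θs)`, which one more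
  -- factor `e^(2θs)` absorbs.
  have hjr : r ^ j ≤ Real.exp (Real.exp (4 * θ * s)) := by
    have : r ≤ Real.exp (12 * s * X / Real.exp s) := by
      linarith [Real.add_one_le_exp (12 * s * X / Real.exp s)]
    calc r ^ j ≤ Real.exp (12 * s * X / Real.exp s) ^ j := by gcongr
      _ = Real.exp (j * (12 * s * X / Real.exp s)) := by rw [← Real.exp_nat_mul]
      _ ≤ Real.exp (Real.exp (4 * θ * s)) := by
          refine Real.exp_le_exp.mpr ?_
          have hXX : X * X / Real.exp s = Real.exp (2 * θ * s) := by
            rw [hX, ← Real.exp_add, ← Real.exp_sub]; ring_nf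
          calc (j : ℝ) * (12 * s * X / Real.exp s) ≤ 17 * X * (12 * s * X / Real.exp s) := by
                gcongr
            _ = 204 * s * (X * X / Real.exp s) := by ring
            _ ≤ Real.exp (2 * θ * s) * Real.exp (2 * θ * s) := by rw [hXX]; gcongr
            _ = _ := by rw [← Real.exp_add]; ring_nf
  have hjX : 1 + (j : ℝ) / 2 ≤ Real.exp (s + 3) := by
    have hXs : X ≤ Real.exp s := Real.exp_le_exp.mpr (by linarith)
    have e : (10 : ℝ) ≤ Real.exp 3 := by
      have h27 := Real.exp_one_gt_d9
      rw [show (3 : ℝ) = 1 + 1 + 1 by norm_num, Real.exp_add, Real.exp_add]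
      have h7 : (2.7 : ℝ) ≤ Real.exp 1 := by linarith
      calc (10 : ℝ) ≤ 2.7 * 2.7 * 2.7 := by norm_num
        _ ≤ _ := by gcongr
    rw [Real.exp_add]
    calc 1 + (j : ℝ) / 2 ≤ Real.exp s * 10 := by linarith
      _ ≤ _ := by gcongr
  set Y := Real.exp (4 * θ * s) with hY
  have hYη : Y * Y ≤ Real.exp (η * s) := by
    rw [hY, ← Real.exp_add]
    exact Real.exp_le_exp.mpr (by linarith)
  have hfin : 1 / 2 * L₀ * Real.exp (expQuotInt s - u * s)
      ≤ Real.exp (s + 3) * Real.exp Y * Real.exp (s + 1) * dickman u := by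
    refine hmain.trans ?_
    have := (dickman_pos u).le
    have : Real.exp (s + δ) ≤ Real.exp (s + 1) := Real.exp_le_exp.mpr (by linarith)
    gcongr
  have hlog : Real.exp (Real.log (2 / L₀)) = 2 / L₀ := Real.exp_log (by positivity)
  calc Real.exp (expQuotInt s - u * s - Real.exp (η * s))
      = Real.exp (expQuotInt s - u * s) * Real.exp (-Real.exp (η * s)) := by
        rw [← Real.exp_add]; ring_nf
    _ = 1 / 2 * L₀ * Real.exp (expQuotInt s - u * s)
        * (Real.exp (Real.log (2 / L₀)) * Real.exp (-Real.exp (η * s))) := by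
        rw [hlog]; field_simp
    _ ≤ Real.exp (s + 3) * Real.exp Y * Real.exp (s + 1) * dickman u
        * (Real.exp (Real.log (2 / L₀)) * Real.exp (-Real.exp (η * s))) := by gcongr
    _ = Real.exp ((s + 3) + Y + (s + 1) + (Real.log (2 / L₀) + -Real.exp (η * s)))
        * dickman u := by
        simp only [Real.exp_add]; ring
    _ ≤ Real.exp 0 * dickman u := by
        have := (dickman_pos u).le
        have : 3 * Y ≤ Y * Y := by gcongr
        gcongr
        linarith
    _ = dickman u := by rw [Real.exp_zero, one_mul]

end DickmanBounds

/-! ### Friable integers: the saddle point equation, Rankin's bound and a lower bound for the count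
-/

section Friable

open Set

/-- The primes `≤ y`. -/
noncomputable def primesUpTo (y : ℝ) : Finset ℕ := Nat.primesBelow (⌊y⌋₊ + 1)

lemma mem_primesUpTo {y : ℝ} {p : ℕ} (hy : 0 ≤ y) : p ∈ primesUpTo y ↔ p.Prime ∧ (p : ℝ) ≤ y := by
  rw [primesUpTo, Nat.mem_primesBelow, Nat.lt_succ_iff, Nat.le_floor_iff hy, and_comm]

lemma prime_of_mem_primesUpTo {y : ℝ} {p : ℕ} (hp : p ∈ primesUpTo y) : p.Prime :=
  (Nat.mem_primesBelow.mp hp).2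

/-- `-(ζ'/ζ)(s, y) = ∑_{p ≤ y} log p / (p ^ s - 1)`. -/
noncomputable def meanLog (s y : ℝ) : ℝ :=
  ∑ p ∈ primesUpTo y, Real.log p / ((p : ℝ) ^ s - 1)

/-- `log ζ(s, y)` as a sum over primes. -/
noncomputable def logPartialZeta (s y : ℝ) : ℝ :=
  ∑ p ∈ primesUpTo y, -Real.log (1 - (p : ℝ) ^ (-s))

lemma one_lt_prime_rpow {p : ℕ} (hp : p.Prime) {s : ℝ} (hs : 0 < s) : 1 < (p : ℝ) ^ s :=
  Real.one_lt_rpow (by exact_mod_cast hp.one_lt) hs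

lemma prime_rpow_neg_lt_one {p : ℕ} (hp : p.Prime) {s : ℝ} (hs : 0 < s) : (p : ℝ) ^ (-s) < 1 :=
  Real.rpow_lt_one_of_one_lt_of_neg (by exact_mod_cast hp.one_lt) (by linarith)

lemma log_partialZeta {s : ℝ} (hs : 0 < s) (y : ℝ) :
    partialZeta s y = Real.exp (logPartialZeta s y) := by
  rw [partialZeta, logPartialZeta, Real.exp_sum, primesUpTo]
  refine Finset.prod_congr rfl fun p hp => ?_
  have := prime_rpow_neg_lt_one (prime_of_mem_primesUpTo hp) hs
  rw [Real.exp_neg, Real.exp_log (by linarith)]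

/-- Convexity of `s ↦ log ζ(s, y)`. -/
lemma logPartialZeta_sub_le {s t : ℝ} (hs : 0 < s) (ht : 0 < t) (y : ℝ) :
    logPartialZeta s y - logPartialZeta t y ≤ (t - s) * meanLog s y := by
  rw [logPartialZeta, logPartialZeta, meanLog, ← Finset.sum_sub_distrib, Finset.mul_sum]
  refine Finset.sum_le_sum fun p hp => ?_
  have hp' := prime_of_mem_primesUpTo hp
  have hp0 : (0 : ℝ) < p := by exact_mod_cast hp'.pos
  have h1 := prime_rpow_neg_lt_one hp' hs
  have h2 := prime_rpow_neg_lt_one hp' ht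
  have h3 := one_lt_prime_rpow hp' hs
  have hlog := Real.log_le_sub_one_of_pos (x := (1 - (p : ℝ) ^ (-t)) / (1 - (p : ℝ) ^ (-s)))
    (div_pos (by linarith) (by linarith))
  rw [Real.log_div (by linarith) (by linarith)] at hlog
  have hmul : (p : ℝ) ^ s * (p : ℝ) ^ (-s) = 1 := by
    rw [← Real.rpow_add hp0, add_neg_cancel, Real.rpow_zero]
  have hts : (p : ℝ) ^ (-t) = (p : ℝ) ^ (-s) * (p : ℝ) ^ (-(t - s)) := by
    rw [← Real.rpow_add hp0]; ring_nf
  have heq : (1 - (p : ℝ) ^ (-t)) / (1 - (p : ℝ) ^ (-s)) - 1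
      = (1 - (p : ℝ) ^ (-(t - s))) / ((p : ℝ) ^ s - 1) := by
    have e1 : 1 - (p : ℝ) ^ (-s) ≠ 0 := by linarith
    have e2 : (p : ℝ) ^ s - 1 ≠ 0 := by linarith
    rw [hts]
    field_simp
    linear_combination (1 - (p : ℝ) ^ (-(t - s))) * hmul
  have hexp : 1 - (p : ℝ) ^ (-(t - s)) ≤ (t - s) * Real.log p := by
    rw [Real.rpow_def_of_pos hp0]
    linarith [Real.add_one_le_exp (Real.log p * -(t - s))]
  calc _ ≤ (1 - (p : ℝ) ^ (-(t - s))) / ((p : ℝ) ^ s - 1) := by linarith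
    _ ≤ (t - s) * Real.log p / ((p : ℝ) ^ s - 1) := by
        gcongr
    _ = _ := by ring

lemma partialZeta_mul_rpow {s x : ℝ} (hs : 0 < s) (hx : 0 < x) (y : ℝ) :
    partialZeta s y * x ^ s = Real.exp (logPartialZeta s y + s * Real.log x) := by
  rw [log_partialZeta hs, Real.rpow_def_of_pos hx, ← Real.exp_add, mul_comm s]

lemma continuousAt_meanLog {s : ℝ} (hs : 0 < s) (y : ℝ) :
    ContinuousAt (fun s => meanLog s y) s := by
  unfold meanLog
  refine tendsto_finsetSum _ fun p hp => ?_
  have hp' := prime_of_mem_primesUpTo hp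
  have hp0 : (p : ℝ) ≠ 0 := by exact_mod_cast hp'.ne_zero
  refine ContinuousAt.div continuousAt_const ?_ (by linarith [one_lt_prime_rpow hp' hs])
  exact (Real.continuousAt_const_rpow hp0).sub continuousAt_const

/-- The saddle point equation. -/
lemma isSaddlePoint_iff {x y a : ℝ} (hx : 0 < x) (ha : 0 < a) :
    IsSaddlePoint x y a ↔ Real.log x = meanLog a y := by
  have hmin : IsSaddlePoint x y a ↔ ∀ t > 0, logPartialZeta a y + a * Real.log x
      ≤ logPartialZeta t y + t * Real.log x := by
    simp only [IsSaddlePoint, ha, true_and, isMinOn_iff, mem_Ioi]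
    refine forall₂_congr fun t ht => ?_
    rw [partialZeta_mul_rpow ha hx, partialZeta_mul_rpow ht hx, Real.exp_le_exp]
  rw [hmin]
  constructor
  · intro h
    have hc := continuousAt_meanLog ha y
    -- Minimality at `a` combined with the tangent at `t`. Dividing by `a - t`, whose sign depends
    -- on the side, and letting `t → a` from both sides gives equality.
    have key : ∀ t > 0, (a - t) * Real.log x ≤ (a - t) * meanLog t y := fun t ht => by
      have h1 := h t ht
      have h2 := logPartialZeta_sub_le ht ha y
      linarith
    refine le_antisymm ?_ ?_
    · refine ge_of_tendsto (hc.mono_left (nhdsWithin_le_nhds (s := Iio a))) ?_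
      filter_upwards [self_mem_nhdsWithin, nhdsWithin_le_nhds (Ioi_mem_nhds ha)] with t ht ht0
      exact le_of_mul_le_mul_left (key t ht0) (by linarith [mem_Iio.mp ht])
    · refine le_of_tendsto (hc.mono_left (nhdsWithin_le_nhds (s := Ioi a))) ?_
      filter_upwards [self_mem_nhdsWithin, nhdsWithin_le_nhds (Ioi_mem_nhds ha)] with t ht ht0
      have := key t ht0
      have ht' : a < t := ht
      nlinarith
  · intro h t ht
    have := logPartialZeta_sub_le ha ht y
    rw [h]
    linarith

/-- `n ↦ n ^ (-s)` as a monoid homomorphism. -/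
noncomputable def rpowNegHom (s : ℝ) : ℕ →* ℝ where
  toFun n := (n : ℝ) ^ (-s)
  map_one' := by simp
  map_mul' m n := by
    push_cast
    exact Real.mul_rpow (by positivity) (by positivity)

/-- The Euler product for `ζ(s, y)`. -/
lemma hasSum_smooth {s : ℝ} (hs : 0 < s) (y : ℝ) :
    HasSum (indicator (Nat.smoothNumbers (⌊y⌋₊ + 1)) fun n : ℕ => (n : ℝ) ^ (-s))
      (partialZeta s y) := by
  have h := (EulerProduct.summable_and_hasSum_smoothNumbers_prod_primesBelow_geometric
    (f := rpowNegHom s) (fun {p} hp => by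
      have h1 := prime_rpow_neg_lt_one hp hs
      simp only [rpowNegHom, MonoidHom.coe_mk, OneHom.coe_mk, Real.norm_eq_abs]
      rwa [abs_of_nonneg (by positivity)]) (⌊y⌋₊ + 1)).2
  rw [← hasSum_subtype_iff_indicator]
  exact h

/-- The `y`-friable integers in `(lo, x]`. -/
noncomputable def friableWindow (lo x y : ℝ) : Finset ℕ :=
  (Nat.smoothNumbersUpTo ⌊x⌋₊ (⌊y⌋₊ + 1)).filter fun n : ℕ => lo < n

lemma mem_friableWindow {lo x y : ℝ} (hx : 0 ≤ x) {n : ℕ} : n ∈ friableWindow lo x y ↔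
    n ∈ Nat.smoothNumbers (⌊y⌋₊ + 1) ∧ lo < n ∧ (n : ℝ) ≤ x := by
  rw [friableWindow, Finset.mem_filter, Nat.mem_smoothNumbersUpTo, Nat.le_floor_iff hx]
  tauto

/-- Rankin's bound. -/
lemma friableCount_le {s x : ℝ} (hs : 0 < s) (hx : 0 < x) (y : ℝ) :
    (friableCount x y : ℝ) ≤ x ^ s * partialZeta s y := by
  have hsum := hasSum_smooth hs y
  have h1 : ∑ n ∈ Nat.smoothNumbersUpTo ⌊x⌋₊ (⌊y⌋₊ + 1),
      indicator (Nat.smoothNumbers (⌊y⌋₊ + 1)) (fun n : ℕ => (n : ℝ) ^ (-s)) n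
      ≤ partialZeta s y :=
    sum_le_hasSum _ (fun n _ => indicator_nonneg (fun n _ => by positivity) n) hsum
  have h2 : (friableCount x y : ℝ) * x ^ (-s) ≤ ∑ n ∈ Nat.smoothNumbersUpTo ⌊x⌋₊ (⌊y⌋₊ + 1),
      indicator (Nat.smoothNumbers (⌊y⌋₊ + 1)) (fun n : ℕ => (n : ℝ) ^ (-s)) n := by
    rw [friableCount, ← nsmul_eq_mul]
    refine Finset.card_nsmul_le_sum _ _ _ fun n hn => ?_
    rw [Nat.mem_smoothNumbersUpTo, Nat.le_floor_iff hx.le] at hn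
    rw [indicator_of_mem hn.2]
    have hn0 : (0 : ℝ) < n := by
      exact_mod_cast Nat.pos_of_ne_zero (Nat.ne_zero_of_mem_smoothNumbers hn.2)
    exact Real.rpow_le_rpow_of_nonpos hn0 hn.1 (by linarith)
  have h3 := h2.trans h1
  rw [Real.rpow_neg hx.le, ← div_eq_mul_inv, div_le_iff₀ (by positivity)] at h3
  linarith

/-- The weight `∑ n ^ (-s)` over the friable integers in `(lo, x]`. -/
noncomputable def windowSum (s lo x y : ℝ) : ℝ :=
  ∑ n ∈ friableWindow lo x y, (n : ℝ) ^ (-s)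

lemma windowSum_nonneg (s lo x y : ℝ) : 0 ≤ windowSum s lo x y :=
  Finset.sum_nonneg fun n _ => by positivity

lemma windowSum_le {s lo x y : ℝ} (hs : 0 ≤ s) (hlo : 0 < lo) :
    windowSum s lo x y ≤ friableCount x y * lo ^ (-s) := by
  have h1 : windowSum s lo x y ≤ (friableWindow lo x y).card • lo ^ (-s) := by
    refine Finset.sum_le_card_nsmul _ _ _ fun n hn => ?_
    exact Real.rpow_le_rpow_of_nonpos hlo (Finset.mem_filter.mp hn).2.le (by linarith)
  rw [nsmul_eq_mul] at h1
  refine h1.trans (mul_le_mul_of_nonneg_right ?_ (by positivity))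
  exact_mod_cast Finset.card_le_card (Finset.filter_subset _ _)

/-- Rankin's bound for both tails. -/
lemma partialZeta_le_windowSum_add {b δ₁ δ₂ lo x y : ℝ} (hb : 0 < b - δ₁) (hδ₁ : 0 ≤ δ₁)
    (hδ₂ : 0 ≤ δ₂) (hlo : 0 < lo) (hx : 0 < x) :
    partialZeta b y ≤ windowSum b lo x y + x ^ (-δ₁) * partialZeta (b - δ₁) y
      + lo ^ δ₂ * partialZeta (b + δ₂) y := by
  have h0 := hasSum_smooth (by linarith : 0 < b) y
  have h1 := (hasSum_smooth hb y).mul_left (x ^ (-δ₁))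
  have h2 := (hasSum_smooth (by linarith : 0 < b + δ₂) y).mul_left (lo ^ δ₂)
  have hW : HasSum (fun n : ℕ => if n ∈ friableWindow lo x y then (n : ℝ) ^ (-b) else 0)
      (windowSum b lo x y) := by
    have := hasSum_sum_of_ne_finset_zero (L := SummationFilter.unconditional ℕ) (s := friableWindow lo x y)
      (f := fun n : ℕ => if n ∈ friableWindow lo x y then (n : ℝ) ^ (-b) else 0)
      (fun n hn => if_neg hn)
    rwa [Finset.sum_congr rfl (fun n hn => if_pos hn)] at this
  refine hasSum_le (fun n => ?_) h0 ((hW.add h1).add h2)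
  have hite : 0 ≤ (if n ∈ friableWindow lo x y then (n : ℝ) ^ (-b) else 0) := by
    split_ifs <;> positivity
  have hnn : ∀ s : ℝ, 0 ≤ (Nat.smoothNumbers (⌊y⌋₊ + 1)).indicator
      (fun n : ℕ => (n : ℝ) ^ (-s)) n := fun s => indicator_nonneg (fun n _ => by positivity) n
  have hp1 := mul_nonneg (by positivity : 0 ≤ x ^ (-δ₁)) (hnn (b - δ₁))
  have hp2 := mul_nonneg (by positivity : 0 ≤ lo ^ δ₂) (hnn (b + δ₂))
  by_cases hn : n ∈ Nat.smoothNumbers (⌊y⌋₊ + 1)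
  swap
  · rw [indicator_of_notMem hn]
    linarith
  have hn0 : (0 : ℝ) < n := by
    exact_mod_cast Nat.pos_of_ne_zero (Nat.ne_zero_of_mem_smoothNumbers hn)
  simp only [indicator_of_mem hn] at hp1 hp2 ⊢
  by_cases hnx : (n : ℝ) ≤ x
  · by_cases hnl : lo < n
    · rw [if_pos ((mem_friableWindow hx.le).mpr ⟨hn, hnl, hnx⟩)]
      linarith
    · have : (n : ℝ) ^ (-b) ≤ lo ^ δ₂ * (n : ℝ) ^ (-(b + δ₂)) := by
        have e : (n : ℝ) ^ (-b) = (n : ℝ) ^ δ₂ * (n : ℝ) ^ (-(b + δ₂)) := by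
          rw [← Real.rpow_add hn0]; ring_nf
        rw [e]
        gcongr
        exact not_lt.mp hnl
      linarith
  · have : (n : ℝ) ^ (-b) ≤ x ^ (-δ₁) * (n : ℝ) ^ (-(b - δ₁)) := by
      have e : (n : ℝ) ^ (-b) = (n : ℝ) ^ (-δ₁) * (n : ℝ) ^ (-(b - δ₁)) := by
        rw [← Real.rpow_add hn0]; ring_nf
      rw [e]
      refine mul_le_mul_of_nonneg_right ?_ (by positivity)
      exact Real.rpow_le_rpow_of_nonpos hx (not_le.mp hnx).le (by linarith)
    linarith

/-- The left side keeps only prime divisors in `log m = ∑_{d ∣ m} Λ(d)`. -/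
lemma sum_log_prime_dvd_le (Q : Finset ℕ) (hQ : ∀ p ∈ Q, p.Prime) {m : ℕ} (hm : m ≠ 0) :
    ∑ p ∈ Q with p ∣ m, Real.log p ≤ Real.log m := by
  rw [← ArithmeticFunction.vonMangoldt_sum]
  have h1 : ∑ p ∈ Q with p ∣ m, Real.log p
      = ∑ p ∈ Q with p ∣ m, ArithmeticFunction.vonMangoldt p :=
    Finset.sum_congr rfl fun p hp =>
      (ArithmeticFunction.vonMangoldt_apply_prime (hQ p (Finset.mem_filter.mp hp).1)).symm
  rw [h1]
  refine Finset.sum_le_sum_of_subset_of_nonneg (fun p hp => ?_)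
    fun _ _ _ => ArithmeticFunction.vonMangoldt_nonneg
  rw [Nat.mem_divisors]
  exact ⟨(Finset.mem_filter.mp hp).2, hm⟩

/-- Multiplying the friable integers in `(lo, x / y]` by the primes in `(z, y]`. -/
lemma mul_windowSum_le {s lo x y z : ℝ} (hx : 1 ≤ x) (hy : 0 < y) (hz : 0 < z)
    (Q : Finset ℕ) (hQ : ∀ p ∈ Q, p.Prime ∧ z < p ∧ (p : ℝ) ≤ y) :
    (∑ p ∈ Q, Real.log p * (p : ℝ) ^ (-s)) * windowSum s lo (x / y) y
      ≤ Real.log x * windowSum s (lo * z) x y := by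
  have hx0 : 0 ≤ x := by linarith
  have hxy : 0 ≤ x / y := by positivity
  have hstep : ∀ p ∈ Q, Real.log p * (p : ℝ) ^ (-s) * windowSum s lo (x / y) y
      ≤ ∑ m ∈ friableWindow (lo * z) x y with p ∣ m, Real.log p * (m : ℝ) ^ (-s) := by
    intro p hp
    obtain ⟨hpp, hzp, hpy⟩ := hQ p hp
    have hp0 : (0 : ℝ) < p := by exact_mod_cast hpp.pos
    rw [windowSum, Finset.mul_sum]
    -- For fixed `p` the map `n ↦ p n` is injective. Multiplicities over different `p` are paid for
    -- afterwards by the weights `log p`, whose sum over `p ∣ m` is at most `log x`.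
    have himg : ∑ n ∈ friableWindow lo (x / y) y, Real.log p * (p : ℝ) ^ (-s) * (n : ℝ) ^ (-s)
        = ∑ m ∈ (friableWindow lo (x / y) y).image (fun n => p * n),
          Real.log p * (m : ℝ) ^ (-s) := by
      rw [Finset.sum_image fun n _ n' _ h => Nat.eq_of_mul_eq_mul_left hpp.pos h]
      refine Finset.sum_congr rfl fun n _ => ?_
      push_cast
      rw [Real.mul_rpow hp0.le (by positivity), mul_assoc]
    rw [himg]
    refine Finset.sum_le_sum_of_subset_of_nonneg (fun m hm => ?_) fun m _ _ =>
      mul_nonneg (Real.log_natCast_nonneg p) (by positivity)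
    obtain ⟨n, hn, rfl⟩ := Finset.mem_image.mp hm
    rw [mem_friableWindow hxy] at hn
    rw [Finset.mem_filter, mem_friableWindow hx0]
    refine ⟨⟨Nat.mul_mem_smoothNumbers ?_ hn.1, ?_, ?_⟩, dvd_mul_right p n⟩
    · refine Nat.mem_smoothNumbers_of_lt hpp.pos ?_
      rw [Nat.lt_succ_iff]
      exact Nat.le_floor hpy
    · push_cast
      nlinarith [hn.2.1]
    · push_cast
      calc (p : ℝ) * n ≤ y * (x / y) := by
            have := hn.2.2
            gcongr
        _ = x := by field_simp
  rw [Finset.sum_mul]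
  refine (Finset.sum_le_sum hstep).trans ?_
  simp_rw [Finset.sum_filter]
  rw [Finset.sum_comm, windowSum, Finset.mul_sum]
  refine Finset.sum_le_sum fun m hm => ?_
  rw [mem_friableWindow hx0] at hm
  have hm0 : m ≠ 0 := Nat.ne_zero_of_mem_smoothNumbers hm.1
  rw [← Finset.sum_filter, ← Finset.sum_mul]
  refine mul_le_mul_of_nonneg_right ?_ (by positivity)
  refine (sum_log_prime_dvd_le Q (fun p hp => (hQ p hp).1) hm0).trans ?_
  exact Real.log_le_log (by exact_mod_cast Nat.pos_of_ne_zero hm0) hm.2.2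

/-- Multiplication by the primes of `Q` raises the lower end of the window by a factor `z` and loses
only `r`. Whatever already lies in `(x / y, x]` is set aside at each of the `j` steps, whence the
factor `j + 1`. -/
lemma windowSum_le_pow {s x y z r : ℝ} (hx : 1 ≤ x) (hy : 0 < y) (hz : 0 < z)
    (Q : Finset ℕ) (hQ : ∀ p ∈ Q, p.Prime ∧ z < p ∧ (p : ℝ) ≤ y)
    (hB : 0 < ∑ p ∈ Q, Real.log p * (p : ℝ) ^ (-s)) (hr : 1 ≤ r)
    (hrB : Real.log x ≤ r * ∑ p ∈ Q, Real.log p * (p : ℝ) ^ (-s)) (j : ℕ) :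
    windowSum s (x / (y * z ^ j)) x y ≤ (j + 1) * r ^ j * windowSum s (x / y) x y := by
  have hx0 : 0 ≤ x := by linarith
  set B := ∑ p ∈ Q, Real.log p * (p : ℝ) ^ (-s)
  induction j with
  | zero => simp
  | succ j ih =>
    set lo := x / (y * z ^ (j + 1)) with hlo
    have hloz : lo * z = x / (y * z ^ j) := by
      rw [hlo, pow_succ]; field_simp
    have h1 := mul_windowSum_le (s := s) (lo := lo) hx hy hz Q hQ
    rw [hloz] at h1
    have h2 : windowSum s lo (x / y) y ≤ r * windowSum s (x / (y * z ^ j)) x y := by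
      have h3 : Real.log x * windowSum s (x / (y * z ^ j)) x y
          ≤ r * B * windowSum s (x / (y * z ^ j)) x y :=
        mul_le_mul_of_nonneg_right hrB (windowSum_nonneg _ _ _ _)
      refine le_of_mul_le_mul_left ?_ hB
      calc _ ≤ _ := h1
        _ ≤ _ := h3
        _ = _ := by ring
    have h4 : windowSum s lo x y ≤ windowSum s lo (x / y) y + windowSum s (x / y) x y := by
      classical
      rw [windowSum, windowSum, windowSum]
      refine (Finset.sum_le_sum_of_subset_of_nonneg (t := friableWindow lo (x / y) y ∪
        friableWindow (x / y) x y) (fun n hn => ?_) fun n _ _ => by positivity).trans ?_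
      · rw [Finset.mem_union, mem_friableWindow hx0, mem_friableWindow (by positivity)]
        rw [mem_friableWindow hx0] at hn
        rcases le_or_gt (n : ℝ) (x / y) with h | h
        · exact Or.inl ⟨hn.1, hn.2.1, h⟩
        · exact Or.inr ⟨hn.1, h, hn.2.2⟩
      · rw [← Finset.sum_union_inter]
        exact le_add_of_nonneg_right (Finset.sum_nonneg fun n _ => by positivity)
    have h0 := windowSum_nonneg s (x / y) x y
    have hrj : 1 ≤ r ^ (j + 1) := one_le_pow₀ hr
    calc windowSum s lo x y ≤ r * ((j + 1) * r ^ j * windowSum s (x / y) x y)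
          + 1 * windowSum s (x / y) x y := by
          have := mul_le_mul_of_nonneg_left ih (by linarith : 0 ≤ r)
          linarith
      _ ≤ r * ((j + 1) * r ^ j * windowSum s (x / y) x y)
          + r ^ (j + 1) * windowSum s (x / y) x y := by gcongr
      _ = _ := by push_cast; ring

/-- A lower bound for `Ψ` at the saddle point, with free parameters. -/
lemma partialZeta_mul_rpow_le_friableCount {a δ x y z r : ℝ} {j : ℕ} (ha : 0 < a) (hδ : 0 < δ)
    (hx : 1 ≤ x) (hy : 0 < y) (hz : 0 < z) (hsaddle : Real.log x = meanLog a y)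
    (h1 : 2 ≤ δ / 2 * (meanLog a y - meanLog (a + δ / 2) y))
    (h2 : meanLog a y - Real.log y - j * Real.log z ≤ meanLog (a + 2 * δ) y - 2 / δ)
    (Q : Finset ℕ) (hQ : ∀ p ∈ Q, p.Prime ∧ z < p ∧ (p : ℝ) ≤ y)
    (hB : 0 < ∑ p ∈ Q, Real.log p * (p : ℝ) ^ (-(a + δ))) (hr : 1 ≤ r)
    (hrB : Real.log x ≤ r * ∑ p ∈ Q, Real.log p * (p : ℝ) ^ (-(a + δ))) :
    1 / 2 * (partialZeta a y * x ^ a) ≤ (j + 1) * r ^ j * y ^ (a + δ) * friableCount x y := by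
  have hx0 : 0 < x := by linarith
  set lo := x / (y * z ^ j) with hlo
  have hlo0 : 0 < lo := by positivity
  have hloglo : Real.log lo = meanLog a y - Real.log y - j * Real.log z := by
    rw [hlo, Real.log_div hx0.ne' (by positivity), Real.log_mul hy.ne' (by positivity),
      Real.log_pow, hsaddle]
    ring
  have he2 : Real.exp (-2) ≤ 1 / 4 := by
    rw [Real.exp_neg, inv_le_comm₀ (Real.exp_pos _) (by norm_num)]
    have := Real.add_one_le_exp (1 : ℝ)
    rw [show (2 : ℝ) = 1 + 1 by norm_num, Real.exp_add]
    nlinarith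
  have htail := partialZeta_le_windowSum_add (b := a + δ) (δ₁ := δ / 2) (δ₂ := δ) (y := y)
    (by linarith) (by linarith) hδ.le hlo0 hx0
  rw [show a + δ - δ / 2 = a + δ / 2 by ring, show a + δ + δ = a + 2 * δ by ring] at htail
  set Z := partialZeta (a + δ) y with hZ
  have hZe : Z = Real.exp (logPartialZeta (a + δ) y) := log_partialZeta (by linarith) y
  have hZ0 : 0 < Z := hZe ▸ Real.exp_pos _
  -- At exponent `a + δ` the mean of `log n` lies below `log x`, so the integers `n > x` carry at
  -- most a quarter of the mass; the estimate of those with `n ≤ lo` is parallel, using exponent `a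
  -- + 2δ`.
  have ht1 : x ^ (-(δ / 2)) * partialZeta (a + δ / 2) y ≤ 1 / 4 * Z := by
    have h3 := logPartialZeta_sub_le (by linarith : 0 < a + δ / 2) (by linarith : 0 < a + δ) y
    calc x ^ (-(δ / 2)) * partialZeta (a + δ / 2) y
        = Real.exp (Real.log x * -(δ / 2) + logPartialZeta (a + δ / 2) y) := by
          rw [log_partialZeta (by linarith), Real.rpow_def_of_pos hx0, Real.exp_add]
      _ ≤ Real.exp (-2 + logPartialZeta (a + δ) y) := by
          rw [show a + δ - (a + δ / 2) = δ / 2 by ring] at h3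
          refine Real.exp_le_exp.mpr ?_
          rw [hsaddle]
          linarith
      _ = Real.exp (-2) * Z := by rw [Real.exp_add, hZe]
      _ ≤ 1 / 4 * Z := by gcongr
  have ht2 : lo ^ δ * partialZeta (a + 2 * δ) y ≤ 1 / 4 * Z := by
    have h3 := logPartialZeta_sub_le (by linarith : 0 < a + 2 * δ) (by linarith : 0 < a + δ) y
    calc lo ^ δ * partialZeta (a + 2 * δ) y
        = Real.exp (Real.log lo * δ + logPartialZeta (a + 2 * δ) y) := by
          rw [log_partialZeta (by linarith), Real.rpow_def_of_pos hlo0, Real.exp_add]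
      _ ≤ Real.exp (-2 + logPartialZeta (a + δ) y) := by
          rw [show a + δ - (a + 2 * δ) = -δ by ring] at h3
          refine Real.exp_le_exp.mpr ?_
          rw [← hloglo] at h2
          have h4 := mul_le_mul_of_nonneg_right h2 hδ.le
          rw [sub_mul, div_mul_cancel₀ _ hδ.ne'] at h4
          linarith
      _ = Real.exp (-2) * Z := by rw [Real.exp_add, hZe]
      _ ≤ 1 / 4 * Z := by gcongr
  have hwin := windowSum_le_pow hx hy hz Q hQ hB hr hrB j
  have hw0 := windowSum_le (s := a + δ) (lo := x / y) (x := x) (y := y) (by linarith)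
    (by positivity)
  -- The saddle point is the minimum, so passing to the exponent `a + δ` only increases the main
  -- term.
  have hmin : partialZeta a y * x ^ a ≤ Z * x ^ (a + δ) := by
    rw [hZ, partialZeta_mul_rpow ha hx0, partialZeta_mul_rpow (by linarith) hx0, hsaddle]
    refine Real.exp_le_exp.mpr ?_
    have := logPartialZeta_sub_le ha (by linarith : 0 < a + δ) y
    linarith
  have hhalf : 1 / 2 * Z ≤ (j + 1) * r ^ j * (friableCount x y * (x / y) ^ (-(a + δ))) := by
    refine le_trans ?_ (mul_le_mul_of_nonneg_left hw0 (by positivity))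
    linarith
  have hxy : (x / y) ^ (-(a + δ)) * x ^ (a + δ) = y ^ (a + δ) := by
    rw [Real.rpow_neg (by positivity), Real.div_rpow hx0.le hy.le]
    have := Real.rpow_pos_of_pos hx0 (a + δ)
    field_simp
  calc 1 / 2 * (partialZeta a y * x ^ a) ≤ 1 / 2 * (Z * x ^ (a + δ)) := by gcongr
    _ = 1 / 2 * Z * x ^ (a + δ) := by ring
    _ ≤ (j + 1) * r ^ j * (friableCount x y * (x / y) ^ (-(a + δ))) * x ^ (a + δ) := by gcongr
    _ = (j + 1) * r ^ j * ((x / y) ^ (-(a + δ)) * x ^ (a + δ)) * friableCount x y := by ring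
    _ = _ := by rw [hxy]

end Friable

/-! ### Sums over primes from Chebyshev's bound -/

section PrimeSums

open Set

/-- The primes in `(√y, y]`. -/
noncomputable def largePrimes (y : ℝ) : Finset ℕ :=
  (primesUpTo y).filter fun p : ℕ => √y < p

lemma eventually_log_le_const_mul_rpow {c b : ℝ} (hc : 0 < c) (hb : 0 < b) :
    ∀ᶠ y : ℝ in atTop, Real.log y ≤ c * y ^ b := by
  filter_upwards [(isLittleO_log_rpow_atTop hb).bound hc, eventually_ge_atTop 1] with y hy hy1
  rwa [Real.norm_eq_abs, Real.norm_eq_abs, abs_of_nonneg (Real.log_nonneg hy1),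
    abs_of_nonneg (by positivity)] at hy

lemma eventually_const_mul_log_pow_le_rpow (C : ℝ) (k : ℕ) {b : ℝ} (hb : 0 < b) :
    ∀ᶠ y : ℝ in atTop, C * (1 + Real.log y) ^ k ≤ y ^ b := by
  have h := (isLittleO_log_rpow_rpow_atTop (s := b) (k : ℝ) hb).bound
    (c := 1 / ((|C| + 1) * 2 ^ k)) (by positivity)
  filter_upwards [h, eventually_ge_atTop (Real.exp 1)] with y hy hy1
  have hl : 1 ≤ Real.log y := (Real.le_log_iff_exp_le ((Real.exp_pos 1).trans_le hy1)).mpr hy1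
  have hy0 : 0 ≤ y := ((Real.exp_pos 1).trans_le hy1).le
  have hl0 : 0 ≤ Real.log y := by linarith
  have hlk : 0 ≤ Real.log y ^ k := by positivity
  have hyb : 0 ≤ y ^ b := by positivity
  rw [Real.rpow_natCast, Real.norm_eq_abs, Real.norm_eq_abs, abs_of_nonneg hlk,
    abs_of_nonneg hyb, one_div, inv_mul_eq_div, le_div_iff₀ (by positivity)] at hy
  calc C * (1 + Real.log y) ^ k ≤ (|C| + 1) * (2 * Real.log y) ^ k := by
        have := le_abs_self C
        gcongr
        · linarith
        · linarith
    _ = Real.log y ^ k * ((|C| + 1) * 2 ^ k) := by rw [mul_pow]; ring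
    _ ≤ _ := hy

/-- Chebyshev's lower bound for the primes in `(√y, y]`. -/
lemma eventually_half_le_sum_log_largePrimes :
    ∀ᶠ y : ℝ in atTop, y / 2 ≤ ∑ p ∈ largePrimes y, Real.log p := by
  filter_upwards [eventually_ge_atTop 1, eventually_log_le_const_mul_rpow (b := 1 / 4)
    (show (0 : ℝ) < 1 / 100 by norm_num) (by norm_num), eventually_ge_atTop 10000]
    with y hy1 hlog hy4
  have hy0 : 0 ≤ y := by linarith
  have hth : Chebyshev.theta y = ∑ p ∈ primesUpTo y, Real.log p := by
    rw [Chebyshev.theta]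
    refine Finset.sum_congr ?_ fun _ _ => rfl
    ext p
    rw [mem_primesUpTo hy0, Finset.mem_filter, Finset.mem_Ioc, Nat.le_floor_iff hy0]
    exact ⟨fun h => ⟨h.2, h.1.2⟩, fun h => ⟨⟨h.1.pos, h.2⟩, h.1⟩⟩
  -- The primes up to `√y` contribute only `O(√y)` to `θ(y)`, and `log 2 > 0.69` leaves room above
  -- `1/2` for the error terms.
  have hsplit := Finset.sum_filter_add_sum_filter_not (primesUpTo y) (fun p : ℕ => √y < p)
    (fun p => Real.log p)
  have hsmall : ∑ p ∈ primesUpTo y with ¬ √y < (p : ℕ), Real.log p ≤ Real.log 4 * √y := by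
    refine le_trans ?_ (Chebyshev.theta_le_log4_mul_x (Real.sqrt_nonneg y))
    rw [Chebyshev.theta]
    refine Finset.sum_le_sum_of_subset_of_nonneg (fun p hp => ?_)
      fun p _ _ => Real.log_natCast_nonneg p
    rw [Finset.mem_filter, mem_primesUpTo hy0] at hp
    rw [Finset.mem_filter, Finset.mem_Ioc, Nat.le_floor_iff (Real.sqrt_nonneg y)]
    exact ⟨⟨hp.1.1.pos, not_lt.mp hp.2⟩, hp.1.1⟩
  have hge := Chebyshev.theta_ge' hy1
  rw [hth, ← hsplit] at hge
  set q := √y with hq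
  have hqq : q * q = y := Real.mul_self_sqrt hy0
  have hq100 : 100 ≤ q := by
    rw [hq]; exact Real.le_sqrt_of_sq_le (by linarith)
  have hl4 : Real.log 4 ≤ 3 / 2 := by
    rw [show (4 : ℝ) = 2 ^ 2 by norm_num, Real.log_pow]
    push_cast
    linarith [Real.log_two_lt_d9]
  have hl2 := Real.log_two_gt_d9
  have hlog' : Real.log y ≤ 1 / 100 * √q := by
    rw [hq, Real.sqrt_eq_rpow, Real.sqrt_eq_rpow, ← Real.rpow_mul hy0]
    norm_num at hlog ⊢
    exact hlog
  have hsq : √q * √q = q := Real.mul_self_sqrt (by linarith)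
  have hsq10 : 10 ≤ √q := Real.le_sqrt_of_sq_le (by linarith)
  have hly2 : Real.log (y + 2) ≤ 1 + Real.log y := by
    have : y + 2 ≤ Real.exp 1 * y := by nlinarith [Real.add_one_le_exp (1 : ℝ)]
    calc Real.log (y + 2) ≤ Real.log (Real.exp 1 * y) := Real.log_le_log (by linarith) this
      _ = _ := by rw [Real.log_mul (Real.exp_pos 1).ne' (by linarith), Real.log_exp]
  have hqs : q * √q ≤ y / 10 := by nlinarith
  have hqlog : q * Real.log y ≤ q * (1 / 100 * √q) := by gcongr
  have hq1 : q ≤ y / 100 := by nlinarith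
  have hlogq : Real.log y ≤ q := by nlinarith
  have hl4q : Real.log 4 * q ≤ 3 / 2 * q := by gcongr
  have hylog2 : (y - 1) * 0.69 ≤ (y - 1) * Real.log 2 := by gcongr; linarith
  change y / 2 ≤ ∑ p ∈ primesUpTo y with √y < (p : ℕ), Real.log p
  rw [← hq]
  linarith

/-- Compare `p^(-b) = p^(1-b) / p` with the harmonic sum. The lost logarithm is harmless, since
every later use allows a small power of `y`. -/
lemma sum_primes_rpow_le {z : ℝ} (hz : 1 ≤ z) (b : ℝ) :
    ∑ p ∈ primesUpTo z, (p : ℝ) ^ (-b) ≤ z ^ max (1 - b) 0 * (1 + Real.log z) := by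
  have hz0 : 0 ≤ z := by linarith
  calc ∑ p ∈ primesUpTo z, (p : ℝ) ^ (-b)
      ≤ ∑ p ∈ primesUpTo z, z ^ max (1 - b) 0 * (p : ℝ)⁻¹ := by
        refine Finset.sum_le_sum fun p hp => ?_
        rw [mem_primesUpTo hz0] at hp
        have hp1 : (1 : ℝ) ≤ p := by exact_mod_cast hp.1.one_le
        have e : (p : ℝ) ^ (-b) = (p : ℝ) ^ (1 - b) * (p : ℝ)⁻¹ := by
          rw [← Real.rpow_neg_one, ← Real.rpow_add (by linarith)]; ring_nf
        rw [e]
        gcongr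
        calc (p : ℝ) ^ (1 - b) ≤ (p : ℝ) ^ max (1 - b) 0 :=
              Real.rpow_le_rpow_of_exponent_le hp1 (le_max_left _ _)
          _ ≤ _ := Real.rpow_le_rpow (by linarith) hp.2 (le_max_right _ _)
    _ = z ^ max (1 - b) 0 * ∑ p ∈ primesUpTo z, (p : ℝ)⁻¹ := by rw [Finset.mul_sum]
    _ ≤ z ^ max (1 - b) 0 * (1 + Real.log z) := by
        refine mul_le_mul_of_nonneg_left ?_ (by positivity)
        refine le_trans ?_ (harmonic_floor_le_one_add_log z hz)
        rw [harmonic_eq_sum_Icc]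
        push_cast
        refine Finset.sum_le_sum_of_subset_of_nonneg (fun p hp => ?_) fun p _ _ => by positivity
        rw [mem_primesUpTo hz0] at hp
        rw [Finset.mem_Icc]
        exact ⟨hp.1.one_le, Nat.le_floor hp.2⟩

lemma mem_largePrimes {y : ℝ} (hy : 0 ≤ y) {p : ℕ} :
    p ∈ largePrimes y ↔ p.Prime ∧ √y < p ∧ (p : ℝ) ≤ y := by
  rw [largePrimes, Finset.mem_filter, mem_primesUpTo hy]
  tauto

lemma rpow_mul_le_sum_largePrimes {y b : ℝ} (hy : 1 ≤ y) (hb : 0 ≤ b)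
    (h : y / 2 ≤ ∑ p ∈ largePrimes y, Real.log p) :
    y ^ (1 - b) / 2 ≤ ∑ p ∈ largePrimes y, Real.log p * (p : ℝ) ^ (-b) := by
  have hy0 : 0 < y := by linarith
  calc y ^ (1 - b) / 2 = y / 2 * y ^ (-b) := by
        rw [sub_eq_add_neg, Real.rpow_add hy0, Real.rpow_one]; ring
    _ ≤ (∑ p ∈ largePrimes y, Real.log p) * y ^ (-b) := by gcongr
    _ ≤ _ := by
        rw [Finset.sum_mul]
        refine Finset.sum_le_sum fun p hp => ?_
        rw [mem_largePrimes hy0.le] at hp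
        refine mul_le_mul_of_nonneg_left ?_ (Real.log_natCast_nonneg p)
        exact Real.rpow_le_rpow_of_nonpos (by exact_mod_cast hp.1.pos) hp.2.2 (by linarith)

/-- Per-prime comparison of the saddle point sums at two exponents. -/
lemma le_log_div_sub {p : ℕ} (hp : p.Prime) {a h : ℝ} (ha : 0 < a) (hh : 0 ≤ h) :
    h * (Real.log p) ^ 2 * (p : ℝ) ^ (-(a + h))
      ≤ Real.log p / ((p : ℝ) ^ a - 1) - Real.log p / ((p : ℝ) ^ (a + h) - 1) := by
  have hp0 : (0 : ℝ) < p := by exact_mod_cast hp.pos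
  have hA := one_lt_prime_rpow hp ha
  have hB := one_lt_prime_rpow hp (by linarith : 0 < a + h)
  have hl : 0 ≤ Real.log p := Real.log_natCast_nonneg p
  set A := (p : ℝ) ^ a with hAdef
  set B := (p : ℝ) ^ (a + h) with hBdef
  have hAB : A ≤ B := Real.rpow_le_rpow_of_exponent_le (by exact_mod_cast hp.one_le) (by linarith)
  have e1 : (p : ℝ) ^ (-(a + h)) = B⁻¹ := Real.rpow_neg hp0.le _
  have e2 : B = A * (p : ℝ) ^ h := Real.rpow_add hp0 _ _
  have e3 : 1 + h * Real.log p ≤ (p : ℝ) ^ h := by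
    rw [Real.rpow_def_of_pos hp0]
    linarith [Real.add_one_le_exp (Real.log p * h)]
  have h1 : h * Real.log p * B⁻¹ ≤ A⁻¹ - B⁻¹ := by
    have : A⁻¹ - B⁻¹ = ((p : ℝ) ^ h - 1) * B⁻¹ := by
      rw [e2]
      have : (p : ℝ) ^ h ≠ 0 := by positivity
      field_simp
    rw [this]
    gcongr
    linarith
  have h2 : A⁻¹ - B⁻¹ ≤ 1 / (A - 1) - 1 / (B - 1) := by
    rw [inv_sub_inv (by linarith) (by linarith), div_sub_div _ _ (by linarith) (by linarith),
      div_le_div_iff₀ (by positivity) (mul_pos (by linarith) (by linarith))]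
    nlinarith [mul_nonneg (sub_nonneg.mpr hAB) (by linarith : 0 ≤ A + B - 1)]
  calc h * (Real.log p) ^ 2 * (p : ℝ) ^ (-(a + h)) = Real.log p * (h * Real.log p * B⁻¹) := by
        rw [e1]; ring
    _ ≤ Real.log p * (1 / (A - 1) - 1 / (B - 1)) := by gcongr; linarith
    _ = _ := by ring

/-- As `p^(-b) ≤ 2^(-a)`, the denominators `p^b - 1` may be replaced by `p^b` at a cost depending
only on `a`. -/
lemma one_sub_rpow_neg_mul_le {p : ℕ} (hp : p.Prime) {a b : ℝ} (ha : 0 < a) (hab : a ≤ b) :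
    (1 - 2 ^ (-a)) * (p : ℝ) ^ b ≤ (p : ℝ) ^ b - 1 := by
  have hp0 : (0 : ℝ) < p := by exact_mod_cast hp.pos
  have h2p : (2 : ℝ) ≤ p := by exact_mod_cast hp.two_le
  have h1 : (1 : ℝ) ≤ 2 ^ (-a) * (p : ℝ) ^ b := by
    rw [Real.rpow_neg (by norm_num), inv_mul_eq_div, le_div_iff₀ (by positivity), one_mul]
    calc (2 : ℝ) ^ a ≤ (p : ℝ) ^ a := Real.rpow_le_rpow (by norm_num) h2p ha.le
      _ ≤ _ := Real.rpow_le_rpow_of_exponent_le (by linarith) hab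
  linarith

lemma log_div_sub_le {p : ℕ} (hp : p.Prime) {a h κ : ℝ} (ha : 0 < a) (hh : 0 ≤ h)
    (hκ : κ = 1 - 2 ^ (-a)) (hκ0 : 0 < κ) :
    Real.log p / ((p : ℝ) ^ a - 1) - Real.log p / ((p : ℝ) ^ (a + h) - 1)
      ≤ κ⁻¹ ^ 2 * h * (Real.log p) ^ 2 * (p : ℝ) ^ (-a) := by
  have hp0 : (0 : ℝ) < p := by exact_mod_cast hp.pos
  have hA := one_lt_prime_rpow hp ha
  have hB := one_lt_prime_rpow hp (by linarith : 0 < a + h)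
  have hl : 0 ≤ Real.log p := Real.log_natCast_nonneg p
  have kA := one_sub_rpow_neg_mul_le hp ha le_rfl
  have kB := one_sub_rpow_neg_mul_le hp ha (by linarith : a ≤ a + h)
  rw [← hκ] at kA kB
  set A := (p : ℝ) ^ a with hAdef
  set B := (p : ℝ) ^ (a + h) with hBdef
  have hAB : A ≤ B := Real.rpow_le_rpow_of_exponent_le (by exact_mod_cast hp.one_le) (by linarith)
  have e1 : (p : ℝ) ^ (-a) = A⁻¹ := Real.rpow_neg hp0.le _
  have e3 : A / B ≥ 1 - h * Real.log p := by
    have : A / B = (p : ℝ) ^ (-h) := by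
      rw [hAdef, hBdef, ← Real.rpow_sub hp0]; ring_nf
    rw [this, Real.rpow_def_of_pos hp0]
    linarith [Real.add_one_le_exp (Real.log p * -h)]
  have h1 : 1 / (A - 1) - 1 / (B - 1) ≤ κ⁻¹ ^ 2 * (h * Real.log p) * A⁻¹ := by
    calc 1 / (A - 1) - 1 / (B - 1) = (B - A) / ((A - 1) * (B - 1)) := by
          have : A - 1 ≠ 0 := by linarith
          have : B - 1 ≠ 0 := by linarith
          field_simp
          ring
      _ ≤ (B - A) / ((κ * A) * (κ * B)) := by
          have : 0 ≤ B - A := by linarith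
          gcongr
      _ = κ⁻¹ ^ 2 * (1 - A / B) * A⁻¹ := by
          have : A ≠ 0 := by linarith
          have : B ≠ 0 := by linarith
          field_simp
      _ ≤ _ := by
          gcongr
          linarith
  calc _ = Real.log p * (1 / (A - 1) - 1 / (B - 1)) := by ring
    _ ≤ Real.log p * (κ⁻¹ ^ 2 * (h * Real.log p) * A⁻¹) := by gcongr
    _ = _ := by rw [e1]; ring

end PrimeSums

/-! ### The mean of `log n` under the weight `n^(-s)` and its variation in `s` -/

section SaddlePointSum

open Set

lemma one_sub_two_rpow_neg_pos {a : ℝ} (ha : 0 < a) : 0 < 1 - (2 : ℝ) ^ (-a) := by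
  have : (2 : ℝ) ^ (-a) < 1 := Real.rpow_lt_one_of_one_lt_of_neg (by norm_num) (by linarith)
  linarith

lemma largePrimes_subset (y : ℝ) : largePrimes y ⊆ primesUpTo y := Finset.filter_subset _ _

/-- The primes in `(√y, y]` suffice: there `log p ≥ (log y) / 2`, and Chebyshev's bound supplies
their total weight. This is a lower bound for the variance of `log n`. -/
lemma le_meanLog_sub {a h y : ℝ} (ha : 0 < a) (hh : 0 ≤ h) (hy : 1 ≤ y)
    (hQ : y / 2 ≤ ∑ p ∈ largePrimes y, Real.log p) :
    h * (Real.log y / 2) * (y ^ (1 - (a + h)) / 2) ≤ meanLog a y - meanLog (a + h) y := by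
  have hy0 : 0 < y := by linarith
  have hly := Real.log_nonneg hy
  calc h * (Real.log y / 2) * (y ^ (1 - (a + h)) / 2)
      ≤ h * (Real.log y / 2) * ∑ p ∈ largePrimes y, Real.log p * (p : ℝ) ^ (-(a + h)) := by
        gcongr
        exact rpow_mul_le_sum_largePrimes hy (by linarith) hQ
    _ ≤ ∑ p ∈ largePrimes y, h * (Real.log p) ^ 2 * (p : ℝ) ^ (-(a + h)) := by
        rw [Finset.mul_sum]
        refine Finset.sum_le_sum fun p hp => ?_
        rw [mem_largePrimes hy0.le] at hp
        have hl : Real.log y / 2 ≤ Real.log p := by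
          rw [← Real.log_sqrt hy0.le]
          exact Real.log_le_log (Real.sqrt_pos.mpr hy0) hp.2.1.le
        have hp0 := Real.log_natCast_nonneg p
        calc h * (Real.log y / 2) * (Real.log p * (p : ℝ) ^ (-(a + h)))
            ≤ h * Real.log p * (Real.log p * (p : ℝ) ^ (-(a + h))) := by gcongr
          _ = _ := by ring
    _ ≤ ∑ p ∈ primesUpTo y, h * (Real.log p) ^ 2 * (p : ℝ) ^ (-(a + h)) :=
        Finset.sum_le_sum_of_subset_of_nonneg (largePrimes_subset y) fun p _ _ => by positivity
    _ ≤ meanLog a y - meanLog (a + h) y := by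
        rw [meanLog, meanLog, ← Finset.sum_sub_distrib]
        exact Finset.sum_le_sum fun p hp => le_log_div_sub (prime_of_mem_primesUpTo hp) ha hh

lemma meanLog_sub_le {a h y κ : ℝ} (ha : 0 < a) (ha1 : a < 1) (hh : 0 ≤ h) (hy : 1 ≤ y)
    (hκ : κ = 1 - 2 ^ (-a)) :
    meanLog a y - meanLog (a + h) y ≤ κ⁻¹ ^ 2 * h * (1 + Real.log y) ^ 3 * y ^ (1 - a) := by
  have hκ0 : 0 < κ := hκ ▸ one_sub_two_rpow_neg_pos ha
  have hy0 : 0 ≤ y := by linarith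
  have hly := Real.log_nonneg hy
  have hs := sum_primes_rpow_le hy a
  rw [max_eq_left (by linarith)] at hs
  calc meanLog a y - meanLog (a + h) y
      ≤ ∑ p ∈ primesUpTo y, κ⁻¹ ^ 2 * h * (1 + Real.log y) ^ 2 * (p : ℝ) ^ (-a) := by
        rw [meanLog, meanLog, ← Finset.sum_sub_distrib]
        refine Finset.sum_le_sum fun p hp => ?_
        have hp' := (mem_primesUpTo hy0).mp hp
        refine (log_div_sub_le hp'.1 ha hh hκ hκ0).trans ?_
        have hl : Real.log p ≤ 1 + Real.log y := by
          have := Real.log_le_log (by exact_mod_cast hp'.1.pos) hp'.2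
          linarith
        have := Real.log_natCast_nonneg p
        gcongr
    _ = κ⁻¹ ^ 2 * h * (1 + Real.log y) ^ 2 * ∑ p ∈ primesUpTo y, (p : ℝ) ^ (-a) := by
        rw [Finset.mul_sum]
    _ ≤ κ⁻¹ ^ 2 * h * (1 + Real.log y) ^ 2 * (y ^ (1 - a) * (1 + Real.log y)) := by gcongr
    _ = _ := by ring

/-- The error has two sources: the primes up to `√y` give `y^((1-a)/2)`, and replacing `p^b - 1` by
`p^b` for the larger ones costs a sum of `p^(-2a)`. Thus the primes in `(√y, y]` almost exhaust the
mean. -/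
lemma meanLog_le_sum_largePrimes_add {a h y κ : ℝ} (ha : 0 < a) (ha1 : a < 1) (hh : 0 ≤ h)
    (hy : 1 ≤ y) (hκ : κ = 1 - 2 ^ (-a)) :
    meanLog (a + h) y ≤ ∑ p ∈ largePrimes y, Real.log p * (p : ℝ) ^ (-(a + h))
      + κ⁻¹ * (1 + Real.log y) ^ 2 * (y ^ ((1 - a) / 2) + y ^ max (1 - 2 * a) 0) := by
  have hκ0 : 0 < κ := hκ ▸ one_sub_two_rpow_neg_pos ha
  have hy0 : 0 ≤ y := by linarith
  have hly := Real.log_nonneg hy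
  have hsq1 : 1 ≤ √y := Real.one_le_sqrt.mpr hy
  have hsq0 : 0 ≤ √y := by linarith
  have hsqy : √y ≤ y := by
    rw [Real.sqrt_le_left (by linarith)]; nlinarith
  have hs1 : ∑ p ∈ primesUpTo (√y), (p : ℝ) ^ (-a) ≤ y ^ ((1 - a) / 2) * (1 + Real.log y) := by
    have h := sum_primes_rpow_le hsq1 a
    rw [max_eq_left (by linarith), Real.sqrt_eq_rpow, ← Real.rpow_mul hy0,
      ← Real.sqrt_eq_rpow, show 1 / 2 * (1 - a) = (1 - a) / 2 by ring] at h
    refine h.trans ?_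
    gcongr
  have hs2 := sum_primes_rpow_le hy (2 * a)
  have hlarge : ∑ p ∈ largePrimes y, Real.log p / ((p : ℝ) ^ (a + h) - 1)
      ≤ ∑ p ∈ largePrimes y, Real.log p * (p : ℝ) ^ (-(a + h))
        + κ⁻¹ * Real.log y * ∑ p ∈ primesUpTo y, (p : ℝ) ^ (-(2 * a)) := by
    have : ∑ p ∈ largePrimes y, (p : ℝ) ^ (-(2 * a)) ≤ ∑ p ∈ primesUpTo y, (p : ℝ) ^ (-(2 * a)) :=
      Finset.sum_le_sum_of_subset_of_nonneg (largePrimes_subset y) fun p _ _ => by positivity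
    refine le_trans ?_ (add_le_add_right (mul_le_mul_of_nonneg_left this (by positivity)) _)
    rw [Finset.mul_sum, ← Finset.sum_add_distrib]
    refine Finset.sum_le_sum fun p hp => ?_
    rw [mem_largePrimes hy0] at hp
    have hp0 : (0 : ℝ) < p := by exact_mod_cast hp.1.pos
    have hp1 : (1 : ℝ) ≤ p := by exact_mod_cast hp.1.one_le
    have hl0 := Real.log_natCast_nonneg p
    have hl : Real.log p ≤ Real.log y := Real.log_le_log hp0 hp.2.2
    have hk := one_sub_rpow_neg_mul_le hp.1 ha (by linarith : a ≤ a + h)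
    rw [← hκ] at hk
    have hA : (p : ℝ) ^ a ≤ (p : ℝ) ^ (a + h) :=
      Real.rpow_le_rpow_of_exponent_le hp1 (by linarith)
    have hB1 := one_lt_prime_rpow hp.1 (by linarith : 0 < a + h)
    have hA0 : 0 < (p : ℝ) ^ a := by positivity
    rw [Real.rpow_neg hp0.le, Real.rpow_neg hp0.le, show 2 * a = a + a by ring,
      Real.rpow_add hp0 a a]
    set A := (p : ℝ) ^ a
    set B := (p : ℝ) ^ (a + h)
    -- Uses `1 / (B - 1) = 1 / B + 1 / (B (B - 1))`, with `B - 1 ≥ κ A` and `B ≥ A`.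
    have e : 1 / (B - 1) ≤ B⁻¹ + κ⁻¹ * (A * A)⁻¹ := by
      have e1 : 1 / (B - 1) = B⁻¹ + 1 / ((B - 1) * B) := by
        have : B - 1 ≠ 0 := by linarith
        have : B ≠ 0 := by linarith
        field_simp
        ring
      have e2 : 1 / ((B - 1) * B) ≤ 1 / (κ * A * A) := by
        have : κ * A ≤ B - 1 := le_trans (by gcongr) hk
        gcongr
      have e3 : 1 / (κ * A * A) = κ⁻¹ * (A * A)⁻¹ := by field_simp
      linarith
    calc Real.log p / (B - 1) = Real.log p * (1 / (B - 1)) := by ring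
      _ ≤ Real.log p * (B⁻¹ + κ⁻¹ * (A * A)⁻¹) := by gcongr
      _ = Real.log p * B⁻¹ + κ⁻¹ * Real.log p * (A * A)⁻¹ := by ring
      _ ≤ _ := by gcongr
  have hsmall : ∑ p ∈ primesUpTo y with ¬ √y < (p : ℕ), Real.log p / ((p : ℝ) ^ (a + h) - 1)
      ≤ κ⁻¹ * Real.log y * ∑ p ∈ primesUpTo (√y), (p : ℝ) ^ (-a) := by
    have hset : (primesUpTo y).filter (fun p : ℕ => ¬ √y < p) = primesUpTo (√y) := by
      ext p
      rw [Finset.mem_filter, mem_primesUpTo hy0, mem_primesUpTo hsq0, not_lt]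
      exact ⟨fun h => ⟨h.1.1, h.2⟩, fun h => ⟨⟨h.1, h.2.trans hsqy⟩, h.2⟩⟩
    rw [hset, Finset.mul_sum]
    refine Finset.sum_le_sum fun p hp => ?_
    rw [mem_primesUpTo hsq0] at hp
    have hp0 : (0 : ℝ) < p := by exact_mod_cast hp.1.pos
    have hp1 : (1 : ℝ) ≤ p := by exact_mod_cast hp.1.one_le
    have hl0 := Real.log_natCast_nonneg p
    have hl : Real.log p ≤ Real.log y := Real.log_le_log hp0 (hp.2.trans hsqy)
    have hk := one_sub_rpow_neg_mul_le hp.1 ha (by linarith : a ≤ a + h)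
    rw [← hκ] at hk
    have hA : (p : ℝ) ^ a ≤ (p : ℝ) ^ (a + h) :=
      Real.rpow_le_rpow_of_exponent_le hp1 (by linarith)
    rw [Real.rpow_neg hp0.le]
    have : κ * (p : ℝ) ^ a ≤ (p : ℝ) ^ (a + h) - 1 := le_trans (by gcongr) hk
    calc Real.log p / ((p : ℝ) ^ (a + h) - 1) ≤ Real.log y / (κ * (p : ℝ) ^ a) := by gcongr
      _ = _ := by field_simp
  have hsplit := Finset.sum_filter_add_sum_filter_not (primesUpTo y) (fun p : ℕ => √y < p)
    (fun p : ℕ => Real.log p / ((p : ℝ) ^ (a + h) - 1))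
  rw [meanLog, ← hsplit]
  change ∑ p ∈ largePrimes y, _ + _ ≤ _
  have hc : κ⁻¹ * Real.log y * ∑ p ∈ primesUpTo (√y), (p : ℝ) ^ (-a)
      ≤ κ⁻¹ * (1 + Real.log y) * (y ^ ((1 - a) / 2) * (1 + Real.log y)) := by
    gcongr
    · linarith
  have hd : κ⁻¹ * Real.log y * ∑ p ∈ primesUpTo y, (p : ℝ) ^ (-(2 * a))
      ≤ κ⁻¹ * (1 + Real.log y) * (y ^ max (1 - 2 * a) 0 * (1 + Real.log y)) := by
    gcongr
    · linarith
  linear_combination hlarge + hsmall + hc + hd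

lemma meanLog_nonneg {a : ℝ} (ha : 0 < a) (y : ℝ) : 0 ≤ meanLog a y :=
  Finset.sum_nonneg fun p hp => div_nonneg (Real.log_natCast_nonneg p)
    (by linarith [one_lt_prime_rpow (prime_of_mem_primesUpTo hp) ha])

lemma sum_largePrimes_le_meanLog {a y : ℝ} (ha : 0 < a) :
    ∑ p ∈ largePrimes y, Real.log p * (p : ℝ) ^ (-a) ≤ meanLog a y := by
  refine le_trans (Finset.sum_le_sum_of_subset_of_nonneg (largePrimes_subset y)
    fun p _ _ => mul_nonneg (Real.log_natCast_nonneg p) (by positivity)) ?_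
  refine Finset.sum_le_sum fun p hp => ?_
  have hB := one_lt_prime_rpow (prime_of_mem_primesUpTo hp) ha
  rw [Real.rpow_neg (by positivity), ← div_eq_mul_inv]
  have := Real.log_natCast_nonneg p
  have h1 : 0 < (p : ℝ) ^ a - 1 := by linarith
  gcongr
  linarith

end SaddlePointSum

/-! ### The saddle point lower bound for `Ψ`: choice of parameters -/

section SaddlePointLowerBound

open Set

-- Up to logarithms, `log x` has order `P²` and `log n` has standard deviation `P`, so the tilt is
-- `δ = ω / P`. The window then takes about `ω P` steps, each with relative loss about `(ω P + N) /
-- P²`, for a total loss of `exp(ω² + ω N / P)` up to logarithms. The parameter `ω` is a small power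
-- of `y` that swallows logarithms and constants.
set_option maxHeartbeats 1000000 in
lemma partialZeta_mul_rpow_le_exp_mul_friableCount {a x y κ ω P N : ℝ} (ha : 0 < a) (ha1 : a < 1)
    (hκ : κ = 1 - 2 ^ (-a)) (hP : P = y ^ ((1 - a) / 2)) (hN : N = y ^ max (1 - 2 * a) 0)
    (hQ : y / 2 ≤ ∑ p ∈ largePrimes y, Real.log p) (hlog : 2 ≤ Real.log y)
    (hω : 60 * (κ⁻¹ ^ 2 * (1 + Real.log y) ^ 3) ^ 2 ≤ ω) (hδ : ω / P * Real.log y ≤ 1 / 2)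
    (hy : 1 ≤ y) (hx : 0 < x) (hsaddle : Real.log x = meanLog a y) :
    partialZeta a y * x ^ a ≤ Real.exp (ω ^ 4 * (1 + N / P)) * friableCount x y := by
  have hκ0 : 0 < κ := hκ ▸ one_sub_two_rpow_neg_pos ha
  have hκ1 : κ ≤ 1 := by
    have : 0 < (2 : ℝ) ^ (-a) := by positivity
    linarith
  have hκi : 1 ≤ κ⁻¹ := (one_le_inv₀ hκ0).mpr hκ1
  have hy0 : 0 < y := by linarith
  have hP1 : 1 ≤ P := hP ▸ Real.one_le_rpow hy (by linarith)
  have hPy : P ≤ y := by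
    rw [hP]; conv_rhs => rw [← Real.rpow_one y]
    exact Real.rpow_le_rpow_of_exponent_le hy (by linarith)
  have hN1 : 1 ≤ N := hN ▸ Real.one_le_rpow hy (le_max_right _ _)
  have hPP : y ^ (1 - a) = P * P := by rw [hP, ← Real.rpow_add hy0]; ring_nf
  set L := 1 + Real.log y with hL
  set K := κ⁻¹ ^ 2 * L ^ 3 with hK
  have hLK : L ≤ K := by
    have h1 : 1 ≤ κ⁻¹ ^ 2 := one_le_pow₀ hκi
    have h2 : L ≤ L ^ 3 := le_self_pow₀ (by linarith) (by norm_num)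
    calc L ≤ 1 * L ^ 3 := by linarith
      _ ≤ K := by rw [hK]; gcongr
  have hK1 : 1 ≤ K := by linarith
  have hKK : K ≤ K ^ 2 := le_self_pow₀ hK1 (by norm_num)
  have hω60 : 60 ≤ ω := by linarith
  have hP0 : 0 < P := by linarith
  have hωω60 : 60 * 60 ≤ ω * ω := mul_le_mul hω60 hω60 (by norm_num) (by linarith)
  have hPω : P ≤ ω * P := le_mul_of_one_le_left hP0.le (by linarith)
  set δ := ω / P with hδdef
  have hδ0 : 0 < δ := by positivity
  have hδP : δ * (P * P) = ω * P := by rw [hδdef]; field_simp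
  have hδδP : δ * δ * (P * P) = ω * ω := by rw [hδdef]; field_simp
  have hδinv : 1 / δ ≤ P := by
    rw [hδdef, one_div_div, div_le_iff₀ (by linarith)]
    linarith
  have hyδ : y ^ δ ≤ 2 := by
    rw [Real.rpow_def_of_pos hy0, mul_comm]
    refine (Real.exp_le_exp.mpr hδ).trans ?_
    have h1 : Real.exp (1 / 2) * Real.exp (1 / 2) = Real.exp 1 := by
      rw [← Real.exp_add]; norm_num
    have h2 := Real.exp_one_lt_d9
    nlinarith [Real.exp_pos (1 / 2 : ℝ)]
  have hypow : ∀ h, 0 ≤ h → h ≤ δ → P * P / 2 ≤ y ^ (1 - (a + h)) := by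
    intro h h0 h1
    have e : y ^ (1 - a) = y ^ (1 - (a + h)) * y ^ h := by
      rw [← Real.rpow_add hy0]; ring_nf
    have e2 : y ^ h ≤ 2 := (Real.rpow_le_rpow_of_exponent_le hy h1).trans hyδ
    have e3 : 0 < y ^ (1 - (a + h)) := by positivity
    rw [← hPP, e, div_le_iff₀ two_pos]
    gcongr
  set B := ∑ p ∈ largePrimes y, Real.log p * (p : ℝ) ^ (-(a + δ)) with hB
  have hBge : P * P / 4 ≤ B := by
    have h1 := rpow_mul_le_sum_largePrimes hy (by linarith : 0 ≤ a + δ) hQ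
    have h2 := hypow δ hδ0.le le_rfl
    linarith
  have hx1 : 1 ≤ x := (Real.log_nonneg_iff hx).mp (hsaddle ▸ meanLog_nonneg ha y)
  have h1 : 2 ≤ δ / 2 * (meanLog a y - meanLog (a + δ / 2) y) := by
    have h2 := le_meanLog_sub ha (by positivity : 0 ≤ δ / 2) hy hQ
    have h3 := hypow (δ / 2) (by positivity) (by linarith)
    calc (2 : ℝ) ≤ ω * ω / 16 := by linarith
      _ = δ / 2 * (δ / 2 * (2 / 2) * (P * P / 2 / 2)) := by linear_combination (-1 / 16) * hδδP
      _ ≤ δ / 2 * (δ / 2 * (Real.log y / 2) * (y ^ (1 - (a + δ / 2)) / 2)) := by gcongr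
      _ ≤ _ := by gcongr
  -- `T` is the logarithmic length that the window must have. As `log √y ≥ 1`, taking `⌈T⌉` steps of
  -- ratio `√y` is enough.
  set T := meanLog a y - meanLog (a + 2 * δ) y + 2 / δ with hT
  have hT0 : 0 ≤ T := by
    have h2 := le_meanLog_sub ha (by positivity : 0 ≤ 2 * δ) hy hQ
    have h3 : 0 ≤ 2 * δ * (Real.log y / 2) * (y ^ (1 - (a + 2 * δ)) / 2) := by positivity
    have h4 : 0 ≤ 2 / δ := by positivity
    linarith
  have hTle : T ≤ 4 * K * (ω * P) := by
    have h2 := meanLog_sub_le ha ha1 (by positivity : 0 ≤ 2 * δ) hy hκ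
    rw [hPP, ← hL] at h2
    have e1 : κ⁻¹ ^ 2 * (2 * δ) * L ^ 3 * (P * P) = 2 * K * (ω * P) := by
      rw [hK]; linear_combination 2 * κ⁻¹ ^ 2 * L ^ 3 * hδP
    have e2 : 2 / δ ≤ 2 * P := by rw [show 2 / δ = 2 * (1 / δ) by ring]; gcongr
    have e3 : P ≤ K * (ω * P) := hPω.trans (le_mul_of_one_le_left (by positivity) hK1)
    linarith
  set j := ⌈T⌉₊ with hj
  have hjT : T ≤ j := Nat.le_ceil T
  have hY1 : 1 ≤ K * (ω * P) :=
    (hP1.trans hPω).trans (le_mul_of_one_le_left (by positivity) hK1)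
  have hjle : (j : ℝ) ≤ 5 * K * (ω * P) := by
    have := Nat.ceil_lt_add_one hT0
    linarith
  have hz : Real.log (√y) = Real.log y / 2 := Real.log_sqrt hy0.le
  have h2 : meanLog a y - Real.log y - j * Real.log (√y) ≤ meanLog (a + 2 * δ) y - 2 / δ := by
    rw [hz]
    have : (j : ℝ) * 1 ≤ j * (Real.log y / 2) := by gcongr; linarith
    linarith
  -- The difference `log x - B` is at most `2 K (ω P + N)`, while `B ≥ P² / 4`; the quotient is `r -
  -- 1`.
  set r := 1 + 8 * K * (ω * P + N) / (P * P) with hr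
  have hr1 : 1 ≤ r := by
    have : 0 ≤ 8 * K * (ω * P + N) / (P * P) := by positivity
    linarith
  have hrB : Real.log x ≤ r * B := by
    have e1 := meanLog_sub_le ha ha1 hδ0.le hy hκ
    have e2 := meanLog_le_sum_largePrimes_add ha ha1 hδ0.le hy hκ
    rw [hPP, ← hL] at e1
    rw [← hP, ← hN, ← hB, ← hL] at e2
    have e3 : κ⁻¹ ^ 2 * δ * L ^ 3 * (P * P) = K * (ω * P) := by
      rw [hK]; linear_combination κ⁻¹ ^ 2 * L ^ 3 * hδP
    have e4 : κ⁻¹ * L ^ 2 * (P + N) ≤ K * (ω * P + N) := by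
      have f1 : κ⁻¹ ≤ κ⁻¹ ^ 2 := le_self_pow₀ hκi (by norm_num)
      have f2 : L ^ 2 ≤ L ^ 3 := pow_le_pow_right₀ (by linarith) (by norm_num)
      rw [hK]
      gcongr
    have e5 : 2 * K * (ω * P + N) = 8 * K * (ω * P + N) / (P * P) * (P * P / 4) := by
      field_simp; ring
    have e6 : 8 * K * (ω * P + N) / (P * P) * (P * P / 4)
        ≤ 8 * K * (ω * P + N) / (P * P) * B := by gcongr
    have e7 : 0 ≤ K * N := by positivity
    have e8 : r * B = B + 8 * K * (ω * P + N) / (P * P) * B := by rw [hr]; ring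
    have e9 : K * (ω * P + N) = K * (ω * P) + K * N := by ring
    rw [hsaddle, e8]
    linarith
  have hmain := partialZeta_mul_rpow_le_friableCount (z := √y) (j := j) ha hδ0 hx1 hy0
    (Real.sqrt_pos.mpr hy0) hsaddle h1 h2 (largePrimes y)
    (fun p hp => (mem_largePrimes hy0.le).mp hp) (lt_of_lt_of_le (by positivity) hBge) hr1 hrB
  have hrj : r ^ j ≤ Real.exp (ω ^ 3 * (1 + N / P)) := by
    have e1 : r ≤ Real.exp (8 * K * (ω * P + N) / (P * P)) := by
      rw [hr, add_comm]; exact Real.add_one_le_exp _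
    calc r ^ j ≤ Real.exp (8 * K * (ω * P + N) / (P * P)) ^ j :=
          pow_le_pow_left₀ (by linarith) e1 j
      _ = Real.exp (j * (8 * K * (ω * P + N) / (P * P))) := (Real.exp_nat_mul _ _).symm
      _ ≤ _ := by
        refine Real.exp_le_exp.mpr ?_
        calc (j : ℝ) * (8 * K * (ω * P + N) / (P * P))
            ≤ (5 * K * (ω * P)) * (8 * K * (ω * P + N) / (P * P)) := by gcongr
          _ = (40 * K ^ 2) * ω * (ω + N / P) := by field_simp; ring
          _ ≤ ω * ω * (ω * 1 + ω * (N / P)) := by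
              have : 0 ≤ N / P := by positivity
              have h40 : 40 * K ^ 2 ≤ ω := by linarith [sq_nonneg K]
              have hNP : N / P ≤ ω * (N / P) := le_mul_of_one_le_left this (by linarith)
              rw [mul_one]
              gcongr
          _ = _ := by ring
  have hrest : 2 * ((j : ℝ) + 1) * y ^ (a + δ) ≤ Real.exp (ω ^ 3 * (1 + N / P)) := by
    have e1 : y ^ (a + δ) ≤ y * 2 := by
      rw [Real.rpow_add hy0]
      have : y ^ a ≤ y := by
        conv_rhs => rw [← Real.rpow_one y]
        exact Real.rpow_le_rpow_of_exponent_le hy (by linarith)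
      gcongr
    have hlω : Real.log y ≤ ω := by linarith
    have hyω : y ≤ Real.exp ω := (Real.log_le_iff_le_exp hy0).mp hlω
    have hωω : ω ≤ Real.exp ω := by linarith [Real.add_one_le_exp ω]
    have hK' : 24 * K ≤ ω := by linarith
    calc 2 * ((j : ℝ) + 1) * y ^ (a + δ) ≤ 2 * (6 * K * (ω * P)) * (y * 2) := by
          gcongr
          linarith
      _ = (24 * K) * ω * P * y := by ring
      _ ≤ Real.exp ω * Real.exp ω * Real.exp ω * Real.exp ω := by
          have := hPy.trans hyω
          have := hK'.trans hωω
          gcongr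
      _ = Real.exp (4 * ω) := by
          rw [← Real.exp_add, ← Real.exp_add, ← Real.exp_add]; ring_nf
      _ ≤ _ := by
          refine Real.exp_le_exp.mpr ?_
          have h4 : 4 * ω ≤ ω ^ 3 := by
            rw [pow_succ, pow_two]
            gcongr
            linarith
          have : 0 ≤ ω ^ 3 * (N / P) := by positivity
          linarith
  calc partialZeta a y * x ^ a
      ≤ 2 * ((j + 1) * r ^ j * y ^ (a + δ) * friableCount x y) := by linarith
    _ = (2 * (j + 1) * y ^ (a + δ)) * r ^ j * friableCount x y := by ring
    _ ≤ Real.exp (ω ^ 3 * (1 + N / P)) * Real.exp (ω ^ 3 * (1 + N / P)) * friableCount x y := by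
        gcongr
    _ ≤ _ := by
        rw [← Real.exp_add]
        gcongr
        have : 0 ≤ ω ^ 3 * (1 + N / P) := by positivity
        calc ω ^ 3 * (1 + N / P) + ω ^ 3 * (1 + N / P) = 2 * (ω ^ 3 * (1 + N / P)) := by ring
          _ ≤ ω * (ω ^ 3 * (1 + N / P)) := by gcongr; linarith
          _ = _ := by ring

/-- The saddle point lower bound for `Ψ(x, y)`. -/
lemma eventually_partialZeta_mul_rpow_le {a η : ℝ} (ha : 0 < a) (ha1 : a < 1) (hη : 0 < η) :
    ∀ᶠ y : ℝ in atTop, ∀ x, 0 < x → Real.log x = meanLog a y → partialZeta a y * x ^ a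
      ≤ Real.exp (y ^ η * (1 + y ^ (max (1 - 2 * a) 0 - (1 - a) / 2))) * friableCount x y := by
  -- With `ω = y^θ`, the first bound makes `ω^4 ≤ y^η` and the second makes `δ log y` small.
  set θ := min (η / 4) ((1 - a) / 4) with hθ
  have hθ0 : 0 < θ := lt_min (by linarith) (by linarith)
  have hθ1 : θ ≤ η / 4 := min_le_left _ _
  have hθ2 : θ ≤ (1 - a) / 4 := min_le_right _ _
  set κ := 1 - (2 : ℝ) ^ (-a) with hκ
  filter_upwards [eventually_half_le_sum_log_largePrimes, eventually_ge_atTop 1,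
    Real.tendsto_log_atTop.eventually_ge_atTop 2,
    eventually_const_mul_log_pow_le_rpow (60 * κ⁻¹ ^ 4) 6 hθ0,
    eventually_log_le_const_mul_rpow (c := 1 / 2) (b := (1 - a) / 4) (by norm_num) (by linarith)]
    with y hQ hy hlog hω hl x hx hsaddle
  have hy0 : 0 < y := by linarith
  have hP0 : 0 < y ^ ((1 - a) / 2) := by positivity
  have h := partialZeta_mul_rpow_le_exp_mul_friableCount (ω := y ^ θ) ha ha1 hκ rfl rfl hQ hlog
    (by linarith) (by
      rw [← Real.rpow_sub hy0]
      calc y ^ (θ - (1 - a) / 2) * Real.log y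
          ≤ y ^ (-((1 - a) / 4)) * (1 / 2 * y ^ ((1 - a) / 4)) := by
            gcongr
            linarith
        _ = 1 / 2 := by
            rw [Real.rpow_neg hy0.le]; field_simp) hy hx hsaddle
  refine h.trans ?_
  rw [← Real.rpow_sub hy0]
  gcongr
  rw [← Real.rpow_natCast, ← Real.rpow_mul hy0.le]
  exact Real.rpow_le_rpow_of_exponent_le hy (by push_cast; linarith)

end SaddlePointLowerBound

/-! ### `log ζ(a, y)` against the prime power sum -/

section LogPartialZeta

open Set

lemma sum_primes_le_primePowSum (a : ℝ) {y : ℝ} (hy : 0 ≤ y) :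
    ∑ p ∈ primesUpTo y, (p : ℝ) ^ (-a) ≤ primePowSum a y := by
  have h : ∑ p ∈ primesUpTo y, (p : ℝ) ^ (-a) = ∑ p ∈ primesUpTo y,
      ArithmeticFunction.vonMangoldt p / Real.log p * (p : ℝ) ^ (-a) := by
    refine Finset.sum_congr rfl fun p hp => ?_
    have hp' := prime_of_mem_primesUpTo hp
    have : Real.log p ≠ 0 := (Real.log_pos (by exact_mod_cast hp'.one_lt)).ne'
    rw [ArithmeticFunction.vonMangoldt_apply_prime hp', div_self this, one_mul]
  rw [h, primePowSum]
  refine Finset.sum_le_sum_of_subset_of_nonneg (fun p hp => ?_) fun n _ _ => ?_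
  · rw [mem_primesUpTo hy] at hp
    rw [Finset.mem_Icc]
    exact ⟨hp.1.one_le, Nat.le_floor hp.2⟩
  · exact primePowCoeff_nonneg a n

/-- Beyond its first term `p^(-a)`, each Euler factor contributes at most `κ⁻¹ p^(-2a)`. The prime
powers in `primePowSum` other than primes are simply dropped. -/
lemma logPartialZeta_le_primePowSum_add {a y κ : ℝ} (ha : 0 < a) (hy : 1 ≤ y)
    (hκ : κ = 1 - 2 ^ (-a)) :
    logPartialZeta a y
      ≤ primePowSum a y + κ⁻¹ * (y ^ max (1 - 2 * a) 0 * (1 + Real.log y)) := by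
  have hκ0 : 0 < κ := hκ ▸ one_sub_two_rpow_neg_pos ha
  calc logPartialZeta a y
      ≤ ∑ p ∈ primesUpTo y, ((p : ℝ) ^ (-a) + κ⁻¹ * (p : ℝ) ^ (-(2 * a))) := by
        refine Finset.sum_le_sum fun p hp => ?_
        have hp' := prime_of_mem_primesUpTo hp
        have hp0 : (0 : ℝ) < p := by exact_mod_cast hp'.pos
        have h1 := prime_rpow_neg_lt_one hp' ha
        have h2 : (p : ℝ) ^ (-a) ≤ 2 ^ (-a) :=
          Real.rpow_le_rpow_of_nonpos two_pos (by exact_mod_cast hp'.two_le) (by linarith)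
        rw [show -(2 * a) = -a + -a by ring, Real.rpow_add hp0]
        set t := (p : ℝ) ^ (-a)
        have ht : κ ≤ 1 - t := by linarith
        calc -Real.log (1 - t) = Real.log (1 - t)⁻¹ := (Real.log_inv _).symm
          _ ≤ (1 - t)⁻¹ - 1 := Real.log_le_sub_one_of_pos (inv_pos.mpr (by linarith))
          _ = t + (1 - t)⁻¹ * (t * t) := by
              have : 1 - t ≠ 0 := by linarith
              field_simp
              ring
          _ ≤ _ := by
              have : (1 - t)⁻¹ ≤ κ⁻¹ := inv_anti₀ hκ0 ht
              have := mul_self_nonneg t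
              gcongr
    _ = ∑ p ∈ primesUpTo y, (p : ℝ) ^ (-a) + κ⁻¹ * ∑ p ∈ primesUpTo y, (p : ℝ) ^ (-(2 * a)) := by
        rw [Finset.sum_add_distrib, Finset.mul_sum]
    _ ≤ _ := by
        have h1 := sum_primes_le_primePowSum a (by linarith : 0 ≤ y)
        have h2 := sum_primes_rpow_le hy (2 * a)
        gcongr

/-- `log ζ(a, y)` contains every power of every prime `p ≤ y`, whereas `primePowSum` stops at `p^k ≤
y`. The squares of the primes in `(√y, y]` are therefore a surplus, with coefficient `1/2`. -/
lemma primePowSum_add_le_logPartialZeta {a y : ℝ} (ha : 0 < a) (hy : 1 ≤ y) :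
    primePowSum a y + 1 / 2 * ∑ p ∈ largePrimes y, (p : ℝ) ^ (-(2 * a))
      ≤ logPartialZeta a y := by
  have hy0 : 0 ≤ y := by linarith
  -- Large enough to contain every `k` with `2^k ≤ y`, and at least 2 so that the surplus squares
  -- have a term to be compared with.
  set N := max 2 ⌊Real.log y / Real.log 2⌋₊ with hN
  have hterm : ∀ p : ℕ, p.Prime → ∀ k ∈ Finset.Icc 1 N,
      ArithmeticFunction.vonMangoldt (p ^ k) / Real.log ((p ^ k : ℕ) : ℝ)
        * ((p ^ k : ℕ) : ℝ) ^ (-a) = ((p : ℝ) ^ (-a)) ^ k / k := by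
    intro p hp k hk
    rw [Finset.mem_Icc] at hk
    have hp0 : (0 : ℝ) ≤ p := by positivity
    have hl : Real.log p ≠ 0 := (Real.log_pos (by exact_mod_cast hp.one_lt)).ne'
    have hk0 : (k : ℝ) ≠ 0 := by
      have : k ≠ 0 := by omega
      exact_mod_cast this
    rw [ArithmeticFunction.vonMangoldt_apply_pow (by omega),
      ArithmeticFunction.vonMangoldt_apply_prime hp]
    push_cast
    rw [Real.log_pow, Real.rpow_pow_comm hp0]
    field_simp
  have hS : primePowSum a y = ∑ k ∈ Finset.Icc 1 N,
      ∑ p ∈ Finset.Ioc 0 ⌊y ^ ((1 : ℝ) / k)⌋₊ with p.Prime, ((p : ℝ) ^ (-a)) ^ k / k := by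
    have h := Chebyshev.sum_PrimePow_eq_sum_sum' (fun n : ℕ =>
      ArithmeticFunction.vonMangoldt n / Real.log n * (n : ℝ) ^ (-a)) hy0
      (le_max_right 2 _ : _ ≤ N)
    rw [Finset.sum_filter_of_ne (fun n _ hn => by
      by_contra hc
      exact hn (by rw [ArithmeticFunction.vonMangoldt_eq_zero_iff.mpr hc]; simp))] at h
    rw [primePowSum, show Finset.Icc 1 ⌊y⌋₊ = Finset.Ioc 0 ⌊y⌋₊ from rfl, h]
    refine Finset.sum_congr rfl fun k hk => Finset.sum_congr rfl fun p hp => ?_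
    exact hterm p (Finset.mem_filter.mp hp).2 k hk
  have hf : ∑ k ∈ Finset.Icc 1 N, ∑ p ∈ primesUpTo y, ((p : ℝ) ^ (-a)) ^ k / k
      ≤ logPartialZeta a y := by
    rw [Finset.sum_comm, logPartialZeta]
    refine Finset.sum_le_sum fun p hp => ?_
    have h1 := prime_rpow_neg_lt_one (prime_of_mem_primesUpTo hp) ha
    have h0 : 0 ≤ (p : ℝ) ^ (-a) := by positivity
    have h := Real.hasSum_pow_div_log_of_abs_lt_one (by rwa [abs_of_nonneg h0])
    have := sum_le_hasSum (Finset.range N) (fun k _ => by positivity) h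
    refine le_trans (le_of_eq ?_) this
    have e := Finset.sum_Ico_add' (fun k : ℕ => ((p : ℝ) ^ (-a)) ^ k / (k : ℝ)) 0 N 1
    push_cast at e
    rw [Finset.range_eq_Ico, e]
    rfl
  have hhalf : 1 / 2 * ∑ p ∈ largePrimes y, (p : ℝ) ^ (-(2 * a)) = ∑ k ∈ Finset.Icc 1 N,
      if k = 2 then 1 / 2 * ∑ p ∈ largePrimes y, (p : ℝ) ^ (-(2 * a)) else 0 := by
    rw [Finset.sum_ite_eq' _ 2 (fun _ => _), if_pos]
    rw [Finset.mem_Icc]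
    exact ⟨by norm_num, le_max_left _ _⟩
  refine le_trans ?_ hf
  rw [hS, hhalf, ← Finset.sum_add_distrib]
  refine Finset.sum_le_sum fun k hk => ?_
  rw [Finset.mem_Icc] at hk
  have hk1 : (1 : ℝ) ≤ k := by exact_mod_cast hk.1
  have hyk : y ^ ((1 : ℝ) / k) ≤ y := by
    conv_rhs => rw [← Real.rpow_one y]
    exact Real.rpow_le_rpow_of_exponent_le hy (by rw [div_le_one (by linarith)]; exact hk1)
  have hsub : (Finset.Ioc 0 ⌊y ^ ((1 : ℝ) / k)⌋₊).filter Nat.Prime ⊆ primesUpTo y := by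
    intro p hp
    rw [Finset.mem_filter, Finset.mem_Ioc, Nat.le_floor_iff (by positivity)] at hp
    exact (mem_primesUpTo hy0).mpr ⟨hp.2, hp.1.2.trans hyk⟩
  split_ifs with hk2
  · subst hk2
    have e : 1 / 2 * ∑ p ∈ largePrimes y, (p : ℝ) ^ (-(2 * a))
        = ∑ p ∈ largePrimes y, ((p : ℝ) ^ (-a)) ^ 2 / (2 : ℕ) := by
      rw [Finset.mul_sum]
      refine Finset.sum_congr rfl fun p _ => ?_
      rw [← Real.rpow_natCast, ← Real.rpow_mul (by positivity)]
      push_cast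
      ring_nf
    rw [e, ← Finset.sum_union]
    · refine Finset.sum_le_sum_of_subset_of_nonneg
        (Finset.union_subset hsub (largePrimes_subset y)) fun p _ _ => by positivity
    · rw [Finset.disjoint_left]
      intro p hp hp'
      rw [Finset.mem_filter, Finset.mem_Ioc, Nat.le_floor_iff (by positivity)] at hp
      rw [mem_largePrimes hy0, Real.sqrt_eq_rpow] at hp'
      have := hp.1.2
      push_cast at this
      linarith [hp'.2.1]
  · rw [add_zero]
    exact Finset.sum_le_sum_of_subset_of_nonneg hsub fun p _ _ => by positivity

lemma le_sum_largePrimes_rpow {b y : ℝ} (hb : 0 ≤ b) (hy : 1 < y)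
    (hQ : y / 2 ≤ ∑ p ∈ largePrimes y, Real.log p) :
    y ^ (1 - b) / (2 * Real.log y) ≤ ∑ p ∈ largePrimes y, (p : ℝ) ^ (-b) := by
  have hl := Real.log_pos hy
  rw [← div_div, div_le_iff₀ hl, Finset.sum_mul]
  refine (rpow_mul_le_sum_largePrimes hy.le hb hQ).trans (Finset.sum_le_sum fun p hp => ?_)
  rw [mem_largePrimes (by linarith)] at hp
  rw [mul_comm]
  gcongr
  · exact_mod_cast hp.1.pos
  · exact hp.2.2

end LogPartialZeta

/-! ### `ξ` as the inverse of `(e^s - 1) / s` -/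

section Xi

open Set

lemma strictMono_expQuot : StrictMono expQuot := fun s t hst =>
  intervalIntegral.integral_lt_integral_of_continuousOn_of_le_of_exists_lt one_pos
    (by fun_prop) (by fun_prop)
    (fun r hr => Real.exp_le_exp.mpr (mul_le_mul_of_nonneg_left hst.le hr.1.le))
    ⟨1, ⟨zero_le_one, le_rfl⟩, Real.exp_lt_exp.mpr (by linarith)⟩

/-- For `t > 0` the equation `e^t = 1 + u t` says `expQuot t = u`, so strict monotonicity excludes
any solution above `s`. For `u = 1` the value is `s = 0`. -/
lemma xi_expQuot {s : ℝ} (hs : 0 ≤ s) : xi (expQuot s) = s := by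
  refine IsGreatest.csSup_eq ⟨⟨hs, by linarith [mul_expQuot s]⟩, fun t ht => ?_⟩
  by_contra! hst
  have ht0 : 0 < t := hs.trans_lt hst
  have h1 := mul_expQuot t
  rw [ht.2, add_sub_cancel_left, mul_comm] at h1
  exact (strictMono_expQuot hst).ne' (mul_right_cancel₀ ht0.ne' h1)

lemma exists_expQuot_eq {u : ℝ} (hu : 1 ≤ u) : ∃ s, 0 ≤ s ∧ expQuot s = u := by
  have h2u : u ≤ expQuot (2 * u) := by
    have h1 := Real.quadratic_le_exp_of_nonneg (by linarith : 0 ≤ 2 * u)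
    have h2 := mul_expQuot (2 * u)
    have h3 : (2 * u) * u ≤ (2 * u) * expQuot (2 * u) := by nlinarith
    exact le_of_mul_le_mul_left h3 (by linarith)
  obtain ⟨s, hs, hsu⟩ := intermediate_value_Icc (by linarith : (0 : ℝ) ≤ 2 * u)
    continuous_expQuot.continuousOn ⟨by rwa [expQuot_zero], h2u⟩
  exact ⟨s, hs.1, hsu⟩

/-- `σ(x, y) = a` exactly when `u = (e ^ s - 1) / s` with `s = (1 - a) log y`. -/
lemma sigma_eq_iff {a x y : ℝ} (ha : a < 1) (hy : 1 < y) (hx : 0 < x) :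
    y ≤ x ∧ sigma x y = a ↔ Real.log x = expQuot ((1 - a) * Real.log y) * Real.log y := by
  have hl := Real.log_pos hy
  have hs : 0 ≤ (1 - a) * Real.log y := mul_nonneg (by linarith) hl.le
  constructor
  · rintro ⟨hxy, h⟩
    have hu : 1 ≤ Real.log x / Real.log y := by
      rw [le_div_iff₀ hl, one_mul]
      exact Real.log_le_log (by linarith) hxy
    obtain ⟨t, ht, htu⟩ := exists_expQuot_eq hu
    rw [sigma, ← htu, xi_expQuot ht] at h
    have : (1 - a) * Real.log y = t := by
      rw [← h]; field_simp; ring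
    rw [this, htu]
    field_simp
  · intro h
    refine ⟨?_, ?_⟩
    · refine (Real.log_le_log_iff (by linarith) hx).mp ?_
      rw [h]
      exact le_mul_of_one_le_left hl.le (one_le_expQuot hs)
    · rw [sigma, h, mul_div_cancel_right₀ _ hl.ne', xi_expQuot hs]
      field_simp
      ring

end Xi

/-! ### Comparison of `Ψ(x, y)` with `x ρ(u)` -/

section Comparison

open Set

lemma friableCount_pos {x : ℝ} (hx : 1 ≤ x) (y : ℝ) : 0 < friableCount x y := by
  refine Finset.card_pos.mpr ⟨1, Nat.mem_smoothNumbersUpTo.mpr ⟨?_,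
    by simp [Nat.mem_smoothNumbers]⟩⟩
  exact Nat.le_floor (by exact_mod_cast hx)

/-- Upper bound for `Ψ(x, y) / (x ρ(u))` at the point where `σ(x, y) = a`. -/
lemma eventually_log_friableCount_div_le {a β : ℝ} (ha : 0 < a) (ha1 : a < 1)
    (hβ : max (1 - 2 * a) 0 < β) :
    ∀ᶠ y : ℝ in atTop, ∀ x, 1 ≤ x →
      Real.log x = expQuot ((1 - a) * Real.log y) * Real.log y →
      Real.log (friableCount x y / (x * dickman (Real.log x / Real.log y)))
        ≤ primePowSum a y - expQuotInt ((1 - a) * Real.log y) + y ^ β / 2 := by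
  have hβ0 : 0 < β := (le_max_right _ _).trans_lt hβ
  set κ := 1 - (2 : ℝ) ^ (-a) with hκ
  have hs : Tendsto (fun y => (1 - a) * Real.log y) atTop atTop :=
    Real.tendsto_log_atTop.const_mul_atTop (by linarith)
  filter_upwards [eventually_gt_atTop 1,
    -- This exponent turns `e^(ηs)` at `s = (1 - a) log y` into `y^(β/2)`.
    hs.eventually (eventually_exp_le_dickman (η := β / (2 * (1 - a)))
      (div_pos hβ0 (by linarith))),
    eventually_const_mul_log_pow_le_rpow (4 * κ⁻¹) 1
      (sub_pos.mpr hβ : 0 < β - max (1 - 2 * a) 0),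
    eventually_const_mul_log_pow_le_rpow 4 0 (half_pos hβ0)] with y hy hρ h1 h2 x hx hxy
  have hy0 : 0 < y := by linarith
  have hx0 : 0 < x := by linarith
  have hl := Real.log_pos hy
  have hu : Real.log x / Real.log y = expQuot ((1 - a) * Real.log y) := by
    rw [hxy, mul_div_cancel_right₀ _ hl.ne']
  rw [hu]
  have hEs : expQuot ((1 - a) * Real.log y) * ((1 - a) * Real.log y) = (1 - a) * Real.log x := by
    rw [hxy]; ring
  rw [hEs] at hρ
  have hη : Real.exp (β / (2 * (1 - a)) * ((1 - a) * Real.log y)) = y ^ (β / 2) := by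
    rw [Real.rpow_def_of_pos hy0]
    congr 1
    have : 1 - a ≠ 0 := by linarith
    field_simp
  rw [hη] at hρ
  have hρ' := (Real.le_log_iff_exp_le (Real.exp_pos _ |>.trans_le hρ)).mpr hρ
  have hΨ : (0 : ℝ) < friableCount x y := by exact_mod_cast friableCount_pos hx y
  have hρ0 := Real.exp_pos _ |>.trans_le hρ
  -- Rankin's bound at the exponent `a` itself: the terms `a log x`, `-log x` and `(1 - a) log x`
  -- (the latter from `ρ`) cancel.
  have hrank := friableCount_le ha hx0 y
  rw [mul_comm, partialZeta_mul_rpow ha hx0] at hrank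
  have hrank' := (Real.log_le_iff_le_exp hΨ).mpr hrank
  rw [Real.log_div hΨ.ne' (by positivity), Real.log_mul hx0.ne' hρ0.ne']
  have hf := logPartialZeta_le_primePowSum_add ha hy.le hκ
  have e1 : κ⁻¹ * (y ^ max (1 - 2 * a) 0 * (1 + Real.log y)) ≤ y ^ β / 4 := by
    have : y ^ β = y ^ max (1 - 2 * a) 0 * y ^ (β - max (1 - 2 * a) 0) := by
      rw [← Real.rpow_add hy0]; ring_nf
    rw [this]
    rw [pow_one] at h1
    have h3 := mul_le_mul_of_nonneg_left h1 (by positivity : 0 ≤ y ^ max (1 - 2 * a) 0)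
    linarith
  have e2 : y ^ (β / 2) ≤ y ^ β / 4 := by
    have : y ^ β = y ^ (β / 2) * y ^ (β / 2) := by
      rw [← Real.rpow_add hy0]; ring_nf
    rw [this]
    rw [pow_zero, mul_one] at h2
    have h3 := mul_le_mul_of_nonneg_left h2 (by positivity : 0 ≤ y ^ (β / 2))
    linarith
  linarith

/-- Guarantees `u ≥ 1` at the saddle point, as required by the upper bound for `ρ`. -/
lemma eventually_log_le_meanLog {a : ℝ} (ha : 0 < a) (ha1 : a < 1) :
    ∀ᶠ y : ℝ in atTop, Real.log y ≤ meanLog a y := by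
  filter_upwards [eventually_half_le_sum_log_largePrimes, eventually_ge_atTop 1,
    eventually_log_le_const_mul_rpow (c := 1 / 2) (b := 1 - a) (by norm_num) (by linarith)]
    with y hQ hy hl
  have := rpow_mul_le_sum_largePrimes hy ha.le hQ
  have := sum_largePrimes_le_meanLog (y := y) ha
  linarith

/-- Lower bound for `Ψ(x, y) / (x ρ(u))` at the point where `α(x, y) = a`. -/
lemma eventually_le_log_friableCount_div {a η : ℝ} (ha : 0 < a) (ha1 : a < 1) (hη : 0 < η) :
    ∀ᶠ y : ℝ in atTop, ∀ x, 0 < x → Real.log x = meanLog a y →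
      primePowSum a y - expQuotInt ((1 - a) * Real.log y) + y ^ (1 - 2 * a) / (4 * Real.log y)
        - y ^ η * (1 + y ^ (max (1 - 2 * a) 0 - (1 - a) / 2)) - Real.log y
        - Real.log (dickmanLaplace 0)
      ≤ Real.log (friableCount x y / (x * dickman (Real.log x / Real.log y))) := by
  filter_upwards [eventually_gt_atTop 1, eventually_log_le_meanLog ha ha1,
    eventually_half_le_sum_log_largePrimes, eventually_partialZeta_mul_rpow_le ha ha1 hη]
    with y hy hm hQ hmain x hx hsaddle
  have hl := Real.log_pos hy
  have hx1 : 1 ≤ x := (Real.log_nonneg_iff hx).mp (hsaddle ▸ meanLog_nonneg ha y)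
  have hu : 1 ≤ Real.log x / Real.log y := by rwa [le_div_iff₀ hl, one_mul, hsaddle]
  have hρ0 := dickman_pos (Real.log x / Real.log y)
  have hΨ : (0 : ℝ) < friableCount x y := by exact_mod_cast friableCount_pos hx1 y
  -- Taking `s = (1 - a) log y`, the product `s u` is `(1 - a) log x`, which cancels the powers of
  -- `x`; the `-1` in `u - 1` costs at most `log y`.
  have h1 := dickman_mul_exp_le hu (mul_nonneg (by linarith : 0 ≤ 1 - a) hl.le)
  have hL := dickmanLaplace_pos 0
  have h1' := Real.log_le_log (by positivity) h1
  rw [Real.log_mul hρ0.ne' (Real.exp_pos _).ne', Real.log_mul hL.ne' (Real.exp_pos _).ne',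
    Real.log_exp, Real.log_exp] at h1'
  have e1 : (1 - a) * Real.log y * (Real.log x / Real.log y - 1)
      = (1 - a) * Real.log x - (1 - a) * Real.log y := by field_simp
  rw [e1] at h1'
  have h2 := hmain x hx hsaddle
  rw [partialZeta_mul_rpow ha hx] at h2
  have h2' := Real.log_le_log (Real.exp_pos _) h2
  rw [Real.log_mul (Real.exp_pos _).ne' hΨ.ne', Real.log_exp, Real.log_exp] at h2'
  have h3 := primePowSum_add_le_logPartialZeta ha hy.le
  have h4 := le_sum_largePrimes_rpow (by linarith : 0 ≤ 2 * a) hy hQ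
  have e2 : y ^ (1 - 2 * a) / (4 * Real.log y)
      = 1 / 2 * (y ^ (1 - 2 * a) / (2 * Real.log y)) := by field_simp; norm_num
  rw [Real.log_div hΨ.ne' (by positivity), Real.log_mul hx.ne' hρ0.ne', e2]
  have : 0 ≤ a * Real.log y := by positivity
  linarith

/-- The error terms in the lower bound are of smaller order than the main terms. -/
lemma eventually_error_le {a β C : ℝ} (ha : 0 < a) (ha1 : a < 1) (hβ : 0 < β) :
    ∃ η > (0 : ℝ), ∀ᶠ y : ℝ in atTop,
      y ^ η * (1 + y ^ (max (1 - 2 * a) 0 - (1 - a) / 2)) + Real.log y + C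
        + 1 / 8 * y ^ max (1 - 2 * a) (1 / 2 - a) / Real.log y
      ≤ y ^ β / 2 + y ^ (1 - 2 * a) / (4 * Real.log y) := by
  have hη : 0 < min (β / 2) ((1 - a) / 4) := lt_min (by linarith) (by linarith)
  refine ⟨min (β / 2) ((1 - a) / 4), hη, ?_⟩
  set η := min (β / 2) ((1 - a) / 4)
  have hη1 : η ≤ β / 2 := min_le_left _ _
  have hη2 : η ≤ (1 - a) / 4 := min_le_right _ _
  filter_upwards [Real.tendsto_log_atTop.eventually_ge_atTop 1, eventually_ge_atTop 1,
    eventually_const_mul_log_pow_le_rpow 16 1 hβ,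
    eventually_const_mul_log_pow_le_rpow (16 * (C + 1)) 0 hβ,
    eventually_const_mul_log_pow_le_rpow 16 0 (half_pos hβ),
    eventually_const_mul_log_pow_le_rpow 8 1 (by linarith : 0 < (1 - a) / 4)]
    with y hl hy h1 h2 h3 h4
  have hy0 : 0 < y := by linarith
  have hl0 : 0 < Real.log y := by linarith
  simp only [pow_zero, mul_one, pow_one] at h1 h2 h3 h4
  have e1 : y ^ η ≤ y ^ (β / 2) := Real.rpow_le_rpow_of_exponent_le hy hη1
  have e2 : y ^ (β / 2) ≤ y ^ β / 16 := by
    have : y ^ β = y ^ (β / 2) * y ^ (β / 2) := by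
      rw [← Real.rpow_add hy0]; ring_nf
    rw [this]
    have h5 := mul_le_mul_of_nonneg_left h3 (by positivity : 0 ≤ y ^ (β / 2))
    linarith
  have hpos : 0 ≤ y ^ (1 - 2 * a) / (8 * Real.log y) := by positivity
  have e3 : y ^ η * y ^ (max (1 - 2 * a) 0 - (1 - a) / 2)
      ≤ y ^ β / 16 + y ^ (1 - 2 * a) / (8 * Real.log y) := by
    -- For `a ≤ 1/2` the exponent is at most `1 - 2a - (1 - a)/4`, so half of the prime square term
    -- absorbs it. For `a ≥ 1/2` the second power is at most 1.
    rcases le_total a (1 / 2) with h | h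
    · have : y ^ η * y ^ (max (1 - 2 * a) 0 - (1 - a) / 2)
          ≤ y ^ (1 - 2 * a) / (8 * Real.log y) := by
        rw [max_eq_left (by linarith), le_div_iff₀ (by positivity), ← Real.rpow_add hy0]
        calc y ^ (η + (1 - 2 * a - (1 - a) / 2)) * (8 * Real.log y)
            ≤ y ^ (1 - 2 * a - (1 - a) / 4) * y ^ ((1 - a) / 4) := by
              gcongr
              · linarith
              · linarith
          _ = y ^ (1 - 2 * a) := by rw [← Real.rpow_add hy0]; ring_nf
      have : 0 ≤ y ^ β / 16 := by positivity
      linarith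
    · have : y ^ (max (1 - 2 * a) 0 - (1 - a) / 2) ≤ 1 :=
        Real.rpow_le_one_of_one_le_of_nonpos hy (by rw [max_eq_right (by linarith)]; linarith)
      have : y ^ η * y ^ (max (1 - 2 * a) 0 - (1 - a) / 2) ≤ y ^ η :=
        mul_le_of_le_one_right (by positivity) this
      linarith
  -- For `a ≤ 1/2` the maximum is `1 - 2a`, and the other half of the prime square term is used. For
  -- `a ≥ 1/2` both exponents are nonpositive and the term is bounded.
  have e4 : 1 / 8 * y ^ max (1 - 2 * a) (1 / 2 - a) / Real.log y
      ≤ 1 + y ^ (1 - 2 * a) / (8 * Real.log y) := by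
    rcases le_total a (1 / 2) with h | h
    · rw [max_eq_left (by linarith)]
      have : 1 / 8 * y ^ (1 - 2 * a) / Real.log y = y ^ (1 - 2 * a) / (8 * Real.log y) := by
        field_simp
      linarith
    · have : y ^ max (1 - 2 * a) (1 / 2 - a) ≤ 1 :=
        Real.rpow_le_one_of_one_le_of_nonpos hy (max_le (by linarith) (by linarith))
      have : 1 / 8 * y ^ max (1 - 2 * a) (1 / 2 - a) / Real.log y ≤ 1 := by
        rw [div_le_one hl0]; linarith
      linarith
  have e5 : y ^ (1 - 2 * a) / (4 * Real.log y) = 2 * (y ^ (1 - 2 * a) / (8 * Real.log y)) := by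
    field_simp; norm_num
  rw [mul_add, mul_one, e5]
  linarith

end Comparison
-- The two bounds for `Ψ`
theorem proposition2 :
    (¬ RiemannHypothesis →
      (∀ σ₀ ∈ Set.Ioo (1 - zetaTheta) zetaTheta, ∀ y > (2 : ℝ),
        ∃! x : ℝ, y ≤ x ∧ sigma x y = σ₀) ∧
      ∃ C > (0 : ℝ), ∀ σ₀ ∈ Set.Ioo (1 - zetaTheta) zetaTheta, ∀ ε > (0 : ℝ), ∀ x : ℝ → ℝ,
        (∀ y > (2 : ℝ), y ≤ x y ∧ sigma (x y) y = σ₀) →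
        ∃ h : ℝ → ℝ, IsOmegaMinus h (fun y => y ^ (zetaTheta - σ₀ - ε)) ∧
          ∀ y > (2 : ℝ), (friableCount (x y) y : ℝ) ≤
            C * (x y * dickman (Real.log (x y) / Real.log y) * Real.exp (h y))) ∧
    ((∀ α₀ ∈ Set.Ioo 0 zetaTheta, ∀ y > (2 : ℝ),
        ∃! x : ℝ, 0 < x ∧ IsSaddlePoint x y α₀) ∧
      ∃ C > (0 : ℝ), ∀ α₀ ∈ Set.Ioo 0 zetaTheta, ∃ c > (0 : ℝ), ∀ ε > (0 : ℝ), ∀ x : ℝ → ℝ,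
        (∀ y > (2 : ℝ), 0 < x y ∧ IsSaddlePoint (x y) y α₀) →
        ∃ h : ℝ → ℝ, IsOmegaPlus h (fun y => y ^ (zetaTheta - α₀ - ε)) ∧
          ∀ y > (2 : ℝ),
            C * (x y * dickman (Real.log (x y) / Real.log y) *
              Real.exp (c * y ^ max (1 - 2 * α₀) (1 / 2 - α₀) / Real.log y) * Real.exp (h y))
            ≤ (friableCount (x y) y : ℝ)) := by
  -- The constants can be 1: `h` is taken to be exactly the logarithm of the quotient, so the
  -- inequalities are equalities and the content is the Ω-statement.
  refine ⟨fun _ => ⟨?_, 1, one_pos, ?_⟩, ?_, 1, one_pos, ?_⟩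
  · intro σ₀ hσ y hy
    have hσ1 : σ₀ < 1 := hσ.2.trans_le zetaTheta_le_one
    set v := expQuot ((1 - σ₀) * Real.log y) * Real.log y with hv
    refine ⟨Real.exp v, (sigma_eq_iff hσ1 (by linarith) (Real.exp_pos v)).mpr
      (Real.log_exp v), fun x hx => ?_⟩
    have hx0 : 0 < x := by linarith [hx.1]
    rw [← Real.exp_log hx0, (sigma_eq_iff hσ1 (by linarith) hx0).mp hx]
  · intro σ₀ hσ ε hε x hx
    have hσ1 : σ₀ < 1 := hσ.2.trans_le zetaTheta_le_one
    have hσ0 : 0 < σ₀ := by linarith [hσ.1, zetaTheta_le_one]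
    -- An exponent above both the target and the prime square error, yet below `Θ - σ₀`. Such a `β`
    -- exists because `1 - 2σ₀ < Θ - σ₀` amounts to `σ₀ > 1 - Θ`.
    obtain ⟨β, hβ, hβΘ⟩ := exists_between (show max (zetaTheta - σ₀ - ε) (max (1 - 2 * σ₀) 0)
      < zetaTheta - σ₀ from max_lt (by linarith) (max_lt (by linarith [hσ.1]) (by linarith [hσ.2])))
    have hβ1 := (le_max_left _ _).trans_lt hβ
    have hβ2 := (le_max_right _ _).trans_lt hβ
    have hβ0 := (le_max_right _ _).trans_lt hβ2
    refine ⟨fun y => Real.log (friableCount (x y) y /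
      (x y * dickman (Real.log (x y) / Real.log y))), ⟨1 / 2, by norm_num, ?_⟩, fun y hy => ?_⟩
    -- The oscillation gives `-y^β` infinitely often and the error is at most `y^β / 2`, whence the
    -- constant `1/2`.
    · refine ((frequently_rpow_le_primePowSum_sub hσ0 hσ1 hβ0 (by norm_num : (-1 : ℝ) ≠ 0)
        (by linarith)).and_eventually ((eventually_log_friableCount_div_le hσ0 hσ1 hβ2).and
        (eventually_gt_atTop 2))).mono ?_
      rintro y ⟨h1, h2, hy⟩
      have hxy := hx y hy
      have h3 := h2 (x y) (by linarith) ((sigma_eq_iff hσ1 (by linarith) (by linarith)).mp hxy)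
      have h4 : y ^ (zetaTheta - σ₀ - ε) ≤ y ^ β :=
        Real.rpow_le_rpow_of_exponent_le (by linarith) hβ1.le
      linarith
    · have hxy := (hx y hy).1
      have hΨ : (0 : ℝ) < friableCount (x y) y := by
        exact_mod_cast friableCount_pos (by linarith) y
      have hx0 : 0 < x y := by linarith
      have hρ := dickman_pos (Real.log (x y) / Real.log y)
      rw [Real.exp_log (by positivity), one_mul, mul_div_cancel₀ _ (by positivity)]
  · intro α hα y hy
    refine ⟨Real.exp (meanLog α y), ⟨Real.exp_pos _, (isSaddlePoint_iff (Real.exp_pos _)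
      hα.1).mpr (Real.log_exp _)⟩, fun x hx => ?_⟩
    rw [← (isSaddlePoint_iff hx.1 hα.1).mp hx.2, Real.exp_log hx.1]
  · intro α hα
    -- The squares of primes give `y^(1 - 2α) / (4 log y)`; half is kept for this constant and half
    -- is reserved for errors.
    refine ⟨1 / 8, by norm_num, fun ε hε x hx => ?_⟩
    have hα1 : α < 1 := hα.2.trans_le zetaTheta_le_one
    obtain ⟨β, hβ, hβΘ⟩ := exists_between (show max (zetaTheta - α - ε) 0
      < zetaTheta - α from max_lt (by linarith) (by linarith [hα.2]))
    have hβ1 := (le_max_left _ _).trans_lt hβ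
    have hβ0 := (le_max_right _ _).trans_lt hβ
    obtain ⟨η, hη, herr⟩ := eventually_error_le (C := Real.log (dickmanLaplace 0)) hα.1 hα1 hβ0
    refine ⟨fun y => Real.log (friableCount (x y) y /
      (x y * dickman (Real.log (x y) / Real.log y)))
        - 1 / 8 * y ^ max (1 - 2 * α) (1 / 2 - α) / Real.log y, ⟨1 / 2, by norm_num, ?_⟩,
      fun y hy => ?_⟩
    -- The oscillation gives `y^β`, of which half pays for the remaining errors in `herr`.
    · refine ((frequently_rpow_le_primePowSum_sub hα.1 hα1 hβ0 one_ne_zero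
        (by linarith)).and_eventually ((eventually_le_log_friableCount_div hα.1 hα1 hη).and
        (herr.and (eventually_gt_atTop 2)))).mono ?_
      rintro y ⟨h1, h2, h3, hy⟩
      have hxy := hx y hy
      have h4 := h2 (x y) hxy.1 ((isSaddlePoint_iff hxy.1 hα.1).mp hxy.2)
      have h5 : y ^ (zetaTheta - α - ε) ≤ y ^ β :=
        Real.rpow_le_rpow_of_exponent_le (by linarith) hβ1.le
      linarith
    · have hxy := hx y hy
      have hx0 := hxy.1
      have hx1 : 1 ≤ x y := (Real.log_nonneg_iff hx0).mp
        ((isSaddlePoint_iff hx0 hα.1).mp hxy.2 ▸ meanLog_nonneg hα.1 y)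
      have hΨ : (0 : ℝ) < friableCount (x y) y := by exact_mod_cast friableCount_pos hx1 y
      have hρ := dickman_pos (Real.log (x y) / Real.log y)
      rw [one_mul, mul_assoc, ← Real.exp_add, add_sub_cancel, Real.exp_log (by positivity),
        mul_div_cancel₀ _ (by positivity)]
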